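/- Let $d>2$ be an integer and, for $r>0$, let $B^r\subset\mathbb R^d$ be the ball of radius $r$ centered at the origin. There exist an exponent $\alpha>0$ and a constant $C<\infty$, both depending only on $d$, such that the following holds for all $\rho\ge 4$, all $T\ge 1$, all $g_1,g_2,\bar v\in\mathbb R$ and all $v\in H^1(B^\rho)$. Assume that $$\frac1T v-\Delta v=g_2\ \text{ in } B^\rho\setminus B^1 \text{ (weakly)},\qquad v\equiv\bar v\ \text{ on }\partial B^1 \text{ (in the sense of traces)}.$$ Then the normal derivative $\nabla v\cdot n$ on $\partial B^1$ (taken from outside $B^1$, with $n$ the outward unit normal of $B^1$, and defined through Green's formula on $B^\rho\setminus B^1$) is an integrable function on $\partial B^1$. If moreover $$\frac1{|\partial B^1|}\int_{\partial B^1}\nabla v\cdot n=g_1,$$ then $$\int_{\partial B^1}\big|\nabla v\cdot n-g_1\big|\ \le\ C\,\rho^{-\alpha}\Big(\int_{B^\rho}|\nabla v|^2+\rho^{d}\Big(1+\frac{\rho^2}{T}\Big)\Big(g_1^2+\rho^2\Big(g_2^2+\frac{\bar v^2}{T^2}\Big)\Big)\Big)^{\frac12}.$$ -/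

import Mathlib

open MeasureTheory Set Metric
open scoped ContDiff

/-- Euclidean space of dimension `d`. -/
abbrev Euc (d : ℕ) : Type := EuclideanSpace ℝ (Fin d)

/-- The centred open annulus: points `x` with `1 < |x| < ρ`. -/
def annulus (d : ℕ) (ρ : ℝ) : Set (Euc d) := ball 0 ρ \ closedBall 0 1

/-- Surface measure on the unit sphere (the boundary of the unit ball). Its total mass is `d` times
the volume of the unit ball. -/
noncomputable def surfaceMeasure (d : ℕ) : Measure (sphere (0 : Euc d) 1) :=
  (volume : Measure (Euc d)).toSphere

/-- Smooth test functions with compact support in `Ω`. -/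
structure IsTestFunction {d : ℕ} (Ω : Set (Euc d)) (φ : Euc d → ℝ) : Prop where
  smooth : ContDiff ℝ ∞ φ
  compact : HasCompactSupport φ
  support : tsupport φ ⊆ Ω

/-- `v` lies in the Sobolev space `H¹(Ω)` and `G` is its weak gradient on `Ω`. -/
structure IsH1WithGradient {d : ℕ} (Ω : Set (Euc d)) (v : Euc d → ℝ) (G : Euc d → Euc d) :
    Prop where
  memLp : MemLp v 2 (volume.restrict Ω)
  gradient_memLp : MemLp G 2 (volume.restrict Ω)
  weak_gradient : ∀ φ : Euc d → ℝ, IsTestFunction Ω φ →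
    ∫ x in Ω, v x • gradient φ x = - ∫ x in Ω, φ x • G x

/-- `v`, with weak gradient `G`, is a weak solution of `v / T - Δ v = g` in `Ω`
(with a constant right-hand side `g`). -/
def IsWeakSolution {d : ℕ} (Ω : Set (Euc d)) (T g : ℝ) (v : Euc d → ℝ) (G : Euc d → Euc d) :
    Prop :=
  ∀ φ : Euc d → ℝ, IsTestFunction Ω φ →
    (∫ x in Ω, (1 / T * v x * φ x + inner ℝ (G x) (gradient φ x))) = ∫ x in Ω, g * φ x

/-- `b` is the trace on the unit sphere of the function `v`, of class `H¹` near the sphere with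
weak gradient `G`. The trace is determined by Green's formula on the annulus: for test functions
`φ` of the open ball of radius `ρ`, which need not vanish on the unit sphere, the integral of
`∇(v φ)` over the annulus is minus the integral of `b φ n` over the unit sphere, where
`n(y) = y` is the outward unit normal of the unit ball. -/
def HasSphereTrace {d : ℕ} (ρ : ℝ) (v : Euc d → ℝ) (G : Euc d → Euc d)
    (b : sphere (0 : Euc d) 1 → ℝ) : Prop :=
  Integrable b (surfaceMeasure d) ∧
    ∀ φ : Euc d → ℝ, IsTestFunction (ball 0 ρ) φ →
      (∫ x in annulus d ρ, (v x • gradient φ x + φ x • G x)) =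
        - ∫ y, (b y * φ (y : Euc d)) • (y : Euc d) ∂(surfaceMeasure d)

/-- `h` is the normal trace `q · n` on the unit sphere, taken from the outside, of the vector field
`q`, where `n(y) = y` is the outward unit normal of the unit ball: `q` has a square integrable weak
divergence `F` in the annulus, and for test functions `φ` of the open ball of radius `ρ`, which need
not vanish on the unit sphere, the integral of `div (φ q) = q · ∇φ + φ F` over the annulus is minus
the integral of `h φ` over the unit sphere. For `q = ∇v` this is the normal derivative of `v`. -/
def HasNormalTrace {d : ℕ} (ρ : ℝ) (q : Euc d → Euc d) (h : sphere (0 : Euc d) 1 → ℝ) : Prop :=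
  Integrable h (surfaceMeasure d) ∧
    ∃ F : Euc d → ℝ, MemLp F 2 (volume.restrict (annulus d ρ)) ∧
      ∀ φ : Euc d → ℝ, IsTestFunction (ball 0 ρ) φ →
        (∫ x in annulus d ρ, (inner ℝ (q x) (gradient φ x) + φ x * F x)) =
          - ∫ y, h y * φ (y : Euc d) ∂(surfaceMeasure d)

/-! The proof compares `v` with its own rotations. For a rotation `R` the difference `w = v ∘ R - v`
solves `w / T - Δ w = 0` in the annulus and vanishes on the unit sphere, because both the right-hand
side and the boundary value are constants (`AnnulusSol.rotation_difference`). Such a `w` is small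
near the unit sphere, hence so is its normal derivative `h ∘ R - h`; averaging over all rotations
replaces `h ∘ R` by the mean value of `h`.

Smallness: extended by zero into the unit ball, `w ^ 2` is subharmonic in the ball of radius `ρ`,
since its Laplacian is at least `2 (|∇w| ^ 2 + w ^ 2 / T)` (`ZeroTraceSol.energy_identity`,
`ZeroTraceSol.chain_rule`). Testing with `(1 + |x| ^ 2) ^ (-(d - 2) / 2)`, cut off at scale `ρ`,
gives `∫_{B^3} w ^ 2 ≤ C ρ ^ (-d) ∫ w ^ 2` (`exists_interior_decay`). This barrier is strictly
superharmonic on `B^3`, and the cutoff costs only `ρ ^ (-d)`.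

Normal derivative: the functional `φ ↦ ∫ (∇v · ∇φ + φ Δv)` depends only on `φ` on the unit sphere,
so `φ` may be replaced by a radial extension. The radial derivative of this extension contains no
derivative of `φ`. The tangential part is written with the generators of coordinate rotations
(`sum_inner_generator`) and integrated by parts along them, which requires difference quotients of
`∇v` along rotations. These are gradients of `v ∘ R_t - v`, controlled by Caccioppoli's inequality
and the `O(t)` modulus of continuity of `v`. Thus the functional is bounded by the `L²` norm of `φ`
on the sphere, and the normal derivative is an `L²` function (`exists_normal_trace_bound`). The same
bound applied to `w`, together with the decay, yields `∫ |h ∘ R - h| ≤ C (ρ ^ (-d) ∫ |v ∘ R - v| ^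
2) ^ (1 / 2)`.

Finally `∫ |v ∘ R - v| ^ 2 ≤ C ρ ^ 2 ∫ |∇v| ^ 2` uniformly over rotations, because `R` is a product
of at most `d / 2` plane rotations (`AnnulusSol.integral_sq_isometry_sub_le`). Averaging with Haar
measure (`integral_abs_sub_average_le`) gives the theorem with `α = d / 2 - 1`. -/

/-- Cauchy-Schwarz for square integrable functions. -/
theorem abs_integral_inner_le {X F : Type*} [MeasurableSpace X] {μ : Measure X}
    [NormedAddCommGroup F] [InnerProductSpace ℝ F] {f g : X → F}
    (hf : MemLp f 2 μ) (hg : MemLp g 2 μ) :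
    |∫ x, inner ℝ (f x) (g x) ∂μ| ≤
      Real.sqrt (∫ x, ‖f x‖ ^ 2 ∂μ) * Real.sqrt (∫ x, ‖g x‖ ^ 2 ∂μ) := by
  have key : ∀ {f : X → F} (hf : MemLp f 2 μ), ‖hf.toLp f‖ = Real.sqrt (∫ x, ‖f x‖ ^ 2 ∂μ) := by
    intro f hf
    rw [@norm_eq_sqrt_real_inner _ _ _, L2.inner_def]
    congr 1
    refine integral_congr_ae ?_
    filter_upwards [hf.coeFn_toLp] with x hx
    rw [hx, real_inner_self_eq_norm_sq]
  have h1 : ∫ x, inner ℝ (f x) (g x) ∂μ = inner ℝ (hf.toLp f) (hg.toLp g) := by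
    rw [L2.inner_def]
    refine integral_congr_ae ?_
    filter_upwards [hf.coeFn_toLp, hg.coeFn_toLp] with x hx hy
    rw [hx, hy]
  rw [h1, ← key hf, ← key hg]
  exact abs_real_inner_le_norm _ _

theorem abs_integral_mul_le {X : Type*} [MeasurableSpace X] {μ : Measure X} {f g : X → ℝ}
    (hf : MemLp f 2 μ) (hg : MemLp g 2 μ) :
    |∫ x, f x * g x ∂μ| ≤ Real.sqrt (∫ x, f x ^ 2 ∂μ) * Real.sqrt (∫ x, g x ^ 2 ∂μ) := by
  have := abs_integral_inner_le hf hg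
  simpa [mul_comm] using this

theorem MemLp.integrable_inner' {X F : Type*} [MeasurableSpace X] {μ : Measure X}
    [NormedAddCommGroup F] [InnerProductSpace ℝ F] {f g : X → F}
    (hf : MemLp f 2 μ) (hg : MemLp g 2 μ) : Integrable (fun x => inner ℝ (f x) (g x)) μ := by
  have h := L2.integrable_inner (𝕜 := ℝ) (hf.toLp f) (hg.toLp g)
  refine h.congr ?_
  filter_upwards [hf.coeFn_toLp, hg.coeFn_toLp] with x hx hy
  rw [hx, hy]

theorem MemLp.integrable_sq_norm {X F : Type*} [MeasurableSpace X] {μ : Measure X}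
    [NormedAddCommGroup F] {f : X → F} (hf : MemLp f 2 μ) :
    Integrable (fun x => ‖f x‖ ^ 2) μ :=
  hf.integrable_norm_pow (by norm_num)

/-- A linear functional which is bounded by the norm of `ι φ` in a Hilbert space is represented by
an element of that space. -/
theorem exists_inner_eq_of_bound {V H : Type*} [AddCommGroup V] [Module ℝ V]
    [NormedAddCommGroup H] [InnerProductSpace ℝ H] [CompleteSpace H]
    (ι : V →ₗ[ℝ] H) (L : V →ₗ[ℝ] ℝ) (M : ℝ) (hM : 0 ≤ M) (hL : ∀ φ, |L φ| ≤ M * ‖ι φ‖) :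
    ∃ h : H, ‖h‖ ≤ M ∧ ∀ φ, L φ = inner ℝ h (ι φ) := by
  -- The bound makes `L` vanish on the kernel of `ι`, so `L` factors through the range of `ι`.
  have hker : LinearMap.ker ι.rangeRestrict ≤ LinearMap.ker L := by
    intro φ hφ
    rw [LinearMap.ker_rangeRestrict, LinearMap.mem_ker] at hφ
    have := hL φ
    rw [hφ, norm_zero, mul_zero] at this
    exact abs_nonpos_iff.mp this
  let e := ι.rangeRestrict.quotKerEquivOfSurjective (LinearMap.surjective_rangeRestrict ι)
  let L' : LinearMap.range ι →ₗ[ℝ] ℝ := (Submodule.liftQ _ L hker).comp e.symm.toLinearMap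
  have hL' : ∀ φ, L' (ι.rangeRestrict φ) = L φ := by
    intro φ
    have : e.symm (ι.rangeRestrict φ) = Submodule.Quotient.mk φ := by
      rw [LinearEquiv.symm_apply_eq]
      rfl
    simp only [L', LinearMap.comp_apply, LinearEquiv.coe_coe, this]
    rfl
  have hb : ∀ x, ‖L' x‖ ≤ M * ‖x‖ := by
    intro x
    obtain ⟨φ, rfl⟩ := LinearMap.surjective_rangeRestrict ι x
    rw [hL', Real.norm_eq_abs]
    exact hL φ
  -- Hahn-Banach extends without increasing the norm, so the range need be neither closed nor dense;
  -- Riesz then gives the representing vector.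
  obtain ⟨g, hg, hgn⟩ := _root_.exists_extension_norm_eq (LinearMap.range ι)
    (L'.mkContinuous M hb)
  refine ⟨(InnerProductSpace.toDual ℝ H).symm g, ?_, fun φ => ?_⟩
  · rw [LinearIsometryEquiv.norm_map, hgn]
    exact LinearMap.mkContinuous_norm_le _ hM _
  · rw [InnerProductSpace.toDual_symm_apply, ← hL' φ]
    exact (hg (ι.rangeRestrict φ)).symm

/-! ### Calculus of gradients and test functions; duality in `L²` -/

section TestFunctions

variable {d : ℕ}

theorem gradient_eq_of_hasFDerivAt {φ : Euc d → ℝ} {L : Euc d →L[ℝ] ℝ} {x g : Euc d}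
    (h : HasFDerivAt φ L x) (hL : ∀ y, L y = inner ℝ g y) : gradient φ x = g := by
  refine ext_inner_right ℝ fun y => ?_
  rw [inner_gradient_left, h.fderiv, hL]

theorem hasFDerivAt_of_contDiff {φ : Euc d → ℝ} (h : ContDiff ℝ ∞ φ) (x : Euc d) :
    HasFDerivAt φ (fderiv ℝ φ x) x :=
  (h.differentiable (by simp) x).hasFDerivAt

theorem gradient_mul {φ ψ : Euc d → ℝ} (hφ : ContDiff ℝ ∞ φ) (hψ : ContDiff ℝ ∞ ψ) (x : Euc d) :
    gradient (fun y => φ y * ψ y) x = φ x • gradient ψ x + ψ x • gradient φ x := by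
  refine gradient_eq_of_hasFDerivAt
    ((hasFDerivAt_of_contDiff hφ x).mul (hasFDerivAt_of_contDiff hψ x)) fun y => ?_
  simp [inner_add_left, inner_smul_left]

theorem gradient_comp_isometry {φ : Euc d → ℝ} (hφ : ContDiff ℝ ∞ φ) (R : Euc d ≃ₗᵢ[ℝ] Euc d)
    (x : Euc d) : gradient (fun y => φ (R y)) x = R.symm (gradient φ (R x)) := by
  refine gradient_eq_of_hasFDerivAt ((hasFDerivAt_of_contDiff hφ (R x)).comp x
    R.toContinuousLinearEquiv.toContinuousLinearMap.hasFDerivAt) fun y => ?_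
  have h := R.inner_map_map (R.symm (gradient φ (R x))) y
  rw [LinearIsometryEquiv.apply_symm_apply] at h
  rw [← h, inner_gradient_left]
  rfl

theorem gradient_comp_smul {φ : Euc d → ℝ} (hφ : ContDiff ℝ ∞ φ) (c : ℝ)
    (x : Euc d) : gradient (fun y => φ (c • y)) x = c • gradient φ (c • x) := by
  refine gradient_eq_of_hasFDerivAt ((hasFDerivAt_of_contDiff hφ (c • x)).comp x
    (c • ContinuousLinearMap.id ℝ (Euc d)).hasFDerivAt) fun y => ?_
  simp [inner_smul_left]

theorem gradient_comp_const_sub {φ : Euc d → ℝ} (hφ : ContDiff ℝ ∞ φ) (a : Euc d)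
    (x : Euc d) : gradient (fun y => φ (a - y)) x = - gradient φ (a - x) := by
  refine gradient_eq_of_hasFDerivAt ((hasFDerivAt_of_contDiff hφ (a - x)).comp x
    ((hasFDerivAt_id x).const_sub a)) fun y => ?_
  simp [inner_neg_left]

theorem continuous_gradient {φ : Euc d → ℝ} (hφ : ContDiff ℝ ∞ φ) : Continuous (gradient φ) := by
  unfold gradient
  exact (LinearIsometryEquiv.continuous _).comp (hφ.continuous_fderiv (by simp))

theorem support_gradient_subset (φ : Euc d → ℝ) :
    Function.support (gradient φ) ⊆ tsupport φ := by
  intro x hx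
  by_contra h
  apply hx
  have : fderiv ℝ φ x = 0 := by
    by_contra h'
    exact h (support_fderiv_subset ℝ h')
  simp [gradient, this]

theorem HasCompactSupport.gradient' {φ : Euc d → ℝ} (hφ : HasCompactSupport φ) :
    HasCompactSupport (gradient φ) :=
  hφ.mono' (support_gradient_subset φ)

theorem contDiff_gradient_apply {φ : Euc d → ℝ} (hφ : ContDiff ℝ ∞ φ) (y : Euc d) :
    ContDiff ℝ ∞ (fun x => inner ℝ y (gradient φ x)) := by
  have : ∀ x, inner ℝ y (gradient φ x) = fderiv ℝ φ x y := fun x => inner_gradient_right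
  simp only [this]
  exact (hφ.fderiv_right (m := ∞) (by simp)).clm_apply contDiff_const

namespace IsTestFunction

variable {Ω Ω' : Set (Euc d)} {φ ψ : Euc d → ℝ}

theorem mono (h : IsTestFunction Ω φ) (hΩ : Ω ⊆ Ω') : IsTestFunction Ω' φ :=
  ⟨h.smooth, h.compact, h.support.trans hΩ⟩

theorem mul_smooth (h : IsTestFunction Ω φ) (hψ : ContDiff ℝ ∞ ψ) :
    IsTestFunction Ω (fun x => φ x * ψ x) :=
  ⟨h.smooth.mul hψ, h.compact.mul_right, (tsupport_mul_subset_left).trans h.support⟩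

theorem smooth_mul (h : IsTestFunction Ω φ) (hψ : ContDiff ℝ ∞ ψ) :
    IsTestFunction Ω (fun x => ψ x * φ x) :=
  ⟨hψ.mul h.smooth, h.compact.mul_left, (tsupport_mul_subset_right).trans h.support⟩

theorem add (h : IsTestFunction Ω φ) (h' : IsTestFunction Ω ψ) :
    IsTestFunction Ω (fun x => φ x + ψ x) :=
  ⟨h.smooth.add h'.smooth, h.compact.add h'.compact,
    (tsupport_add φ ψ).trans (union_subset h.support h'.support)⟩

theorem sub (h : IsTestFunction Ω φ) (h' : IsTestFunction Ω ψ) :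
    IsTestFunction Ω (fun x => φ x - ψ x) :=
  ⟨h.smooth.sub h'.smooth, h.compact.sub h'.compact,
    (tsupport_sub φ ψ).trans (union_subset h.support h'.support)⟩

theorem const_mul (h : IsTestFunction Ω φ) (c : ℝ) : IsTestFunction Ω (fun x => c * φ x) :=
  h.smooth_mul contDiff_const

theorem comp_isometry (h : IsTestFunction Ω φ) (R : Euc d ≃ₗᵢ[ℝ] Euc d)
    (hΩ : ∀ x, R x ∈ Ω → x ∈ Ω) : IsTestFunction Ω (fun x => φ (R x)) := by
  refine ⟨h.smooth.comp R.toContinuousLinearEquiv.contDiff,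
    h.compact.comp_homeomorph R.toHomeomorph, ?_⟩
  intro x hx
  apply hΩ
  apply h.support
  have := tsupport_comp_eq_preimage φ R.toHomeomorph
  exact (this ▸ hx : x ∈ R.toHomeomorph ⁻¹' tsupport φ)

theorem gradient_apply (h : IsTestFunction Ω φ) (y : Euc d) :
    IsTestFunction Ω (fun x => inner ℝ y (gradient φ x)) := by
  have hs : Function.support (fun x => inner ℝ y (gradient φ x)) ⊆ tsupport φ := by
    intro x hx
    apply support_gradient_subset φ
    intro h0
    apply hx
    simp [h0]
  exact ⟨contDiff_gradient_apply h.smooth y, h.compact.mono' hs,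
    (closure_minimal hs (isClosed_tsupport φ)).trans h.support⟩

theorem eq_zero (h : IsTestFunction Ω φ) {x : Euc d} (hx : x ∉ Ω) : φ x = 0 := by
  by_contra h0
  exact hx (h.support (subset_tsupport φ h0))

theorem gradient_eq_zero (h : IsTestFunction Ω φ) {x : Euc d} (hx : x ∉ Ω) : gradient φ x = 0 := by
  by_contra h0
  exact hx (h.support (support_gradient_subset φ h0))

theorem continuous_gradient (h : IsTestFunction Ω φ) : Continuous (gradient φ) :=
  _root_.continuous_gradient h.smooth

theorem memLp (h : IsTestFunction Ω φ) {μ : Measure (Euc d)} [IsFiniteMeasureOnCompacts μ]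
    (p : ENNReal) : MemLp φ p μ :=
  h.smooth.continuous.memLp_of_hasCompactSupport h.compact

theorem gradient_memLp (h : IsTestFunction Ω φ) {μ : Measure (Euc d)}
    [IsFiniteMeasureOnCompacts μ] (p : ENNReal) : MemLp (gradient φ) p μ :=
  h.continuous_gradient.memLp_of_hasCompactSupport h.compact.gradient'

theorem exists_bound (h : IsTestFunction Ω φ) :
    ∃ C : ℝ, 0 ≤ C ∧ ∀ x, |φ x| ≤ C ∧ ‖gradient φ x‖ ≤ C := by
  obtain ⟨C₁, h₁⟩ := h.compact.exists_bound_of_continuous h.smooth.continuous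
  obtain ⟨C₂, h₂⟩ := h.compact.gradient'.exists_bound_of_continuous h.continuous_gradient
  refine ⟨max C₁ C₂, ?_, fun x => ⟨(h₁ x).trans (le_max_left _ _), (h₂ x).trans (le_max_right _ _)⟩⟩
  exact (norm_nonneg _).trans ((h₁ 0).trans (le_max_left _ _))

end IsTestFunction

/-- The space of test functions in `Ω`. -/
def testSubmodule (Ω : Set (Euc d)) : Submodule ℝ (Euc d → ℝ) where
  carrier := {φ | IsTestFunction Ω φ}
  add_mem' h h' := h.add h'
  zero_mem' := ⟨contDiff_const, HasCompactSupport.zero, by simp⟩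
  smul_mem' c _ h := h.const_mul c

/-- Duality with test functions computes the `L²` norm on an open set. -/
theorem integral_sq_le_of_test {Ω : Set (Euc d)} (hΩ : IsOpen Ω) {f : Euc d → ℝ}
    (hf : MemLp f 2 (volume.restrict Ω)) {M : ℝ} (hM : 0 ≤ M)
    (h : ∀ φ, IsTestFunction Ω φ →
      |∫ x in Ω, f x * φ x| ≤ M * Real.sqrt (∫ x in Ω, φ x ^ 2)) :
    ∫ x in Ω, f x ^ 2 ≤ M ^ 2 := by
  let μ := volume.restrict Ω
  let ι : testSubmodule Ω →ₗ[ℝ] Lp ℝ 2 μ :=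
    { toFun := fun φ => (IsTestFunction.memLp φ.2 2).toLp φ.1
      map_add' := fun φ ψ => rfl
      map_smul' := fun c φ => rfl }
  have hint : ∀ φ : testSubmodule Ω, Integrable (fun x => f x * φ.1 x) μ := fun φ =>
    hf.integrable_mul (IsTestFunction.memLp φ.2 2)
  let L : testSubmodule Ω →ₗ[ℝ] ℝ :=
    { toFun := fun φ => ∫ x, f x * φ.1 x ∂μ
      map_add' := fun φ ψ => by
        rw [← integral_add (hint φ) (hint ψ)]
        refine integral_congr_ae (Filter.Eventually.of_forall fun x => ?_)
        exact mul_add _ _ _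
      map_smul' := fun c φ => by
        rw [RingHom.id_apply, smul_eq_mul, ← integral_const_mul]
        refine integral_congr_ae (Filter.Eventually.of_forall fun x => ?_)
        simp
        ring }
  have norm_sq : ∀ {g : Euc d → ℝ} (hg : MemLp g 2 μ), ‖hg.toLp g‖ ^ 2 = ∫ x, g x ^ 2 ∂μ := by
    intro g hg
    rw [← @real_inner_self_eq_norm_sq, L2.inner_def]
    refine integral_congr_ae ?_
    filter_upwards [hg.coeFn_toLp] with x hx
    rw [hx, real_inner_self_eq_norm_sq, Real.norm_eq_abs, sq_abs]
  have hnorm : ∀ φ : testSubmodule Ω, ‖ι φ‖ = Real.sqrt (∫ x, φ.1 x ^ 2 ∂μ) := by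
    intro φ
    rw [← norm_sq (IsTestFunction.memLp φ.2 2), Real.sqrt_sq (norm_nonneg _)]
    rfl
  obtain ⟨g, hgM, hg⟩ := exists_inner_eq_of_bound ι L M hM (fun φ => by
    rw [hnorm]
    exact h φ.1 φ.2)
  -- The fundamental lemma of the calculus of variations identifies `f` with the Riesz
  -- representative `g`, whose norm is at most `M`.
  have hfg : ∀ᵐ x ∂volume, x ∈ Ω → f x - g x = 0 := by
    have hmem : MemLp (fun x => f x - g x) 2 μ := hf.sub (Lp.memLp g)
    apply hΩ.ae_eq_zero_of_integral_contDiff_smul_eq_zero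
    · have : LocallyIntegrable (fun x => f x - g x) μ := hmem.locallyIntegrable (by norm_num)
      exact locallyIntegrableOn_of_locallyIntegrable_restrict this
    · intro φ h1 h2 h3
      have hφ : IsTestFunction Ω φ := ⟨h1, h2, h3⟩
      have e1 : ∫ x, φ x • (f x - g x) = ∫ x, φ x • (f x - g x) ∂μ := by
        refine (setIntegral_eq_integral_of_forall_compl_eq_zero fun x hx => ?_).symm
        rw [hφ.eq_zero hx, zero_smul]
      have e2 := hg ⟨φ, hφ⟩
      have e3 : inner ℝ g (ι ⟨φ, hφ⟩) = ∫ x, g x * φ x ∂μ := by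
        rw [L2.inner_def]
        refine integral_congr_ae ?_
        filter_upwards [(IsTestFunction.memLp (μ := μ) hφ 2).coeFn_toLp] with x hx
        have : (ι ⟨φ, hφ⟩ : Euc d → ℝ) x = φ x := hx
        rw [this]
        simp [mul_comm]
      have e4 : L ⟨φ, hφ⟩ = ∫ x, f x * φ x ∂μ := rfl
      have hi : Integrable (fun x => g x * φ x) μ := (Lp.memLp g).integrable_mul (hφ.memLp 2)
      rw [e1]
      calc ∫ x, φ x • (f x - g x) ∂μ = ∫ x, (f x * φ x - g x * φ x) ∂μ := by
            refine integral_congr_ae (Filter.Eventually.of_forall fun x => ?_)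
            simp
            ring
        _ = 0 := by
            rw [integral_sub (hint ⟨φ, hφ⟩) hi, ← e4, e2, e3, sub_self]
  have hae : f =ᵐ[μ] g := by
    rw [Filter.EventuallyEq, ae_restrict_iff' hΩ.measurableSet]
    filter_upwards [hfg] with x hx hxΩ
    exact sub_eq_zero.mp (hx hxΩ)
  calc ∫ x in Ω, f x ^ 2 = ‖hf.toLp f‖ ^ 2 := (norm_sq hf).symm
    _ = ‖g‖ ^ 2 := by
        congr 2
        exact Lp.ext (hf.coeFn_toLp.trans hae)
    _ ≤ M ^ 2 := by gcongr

end TestFunctions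

/-! ### Continuity of `L²` pairings under dilations and translations -/

section AffineContinuity

open Filter Topology

variable {d : ℕ} {F : Type*} [NormedAddCommGroup F] [InnerProductSpace ℝ F]

theorem memLp_comp_affine {V : Type*} [NormedAddCommGroup V] {U : Euc d → V}
    (hU : MemLp U 2 volume) {m : ℝ} (hm : m ≠ 0)
    (t : Euc d) : MemLp (fun x => U (m • (x - t))) 2 volume := by
  have hq : Measure.QuasiMeasurePreserving (fun x : Euc d => m • (x - t)) volume volume :=
    (Measure.quasiMeasurePreserving_smul volume hm).comp
      (measurePreserving_sub_right volume t).quasiMeasurePreserving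
  have hmeas : AEStronglyMeasurable (fun x => U (m • (x - t))) volume :=
    hU.1.comp_quasiMeasurePreserving hq
  rw [memLp_two_iff_integrable_sq_norm hmeas]
  exact ((MemLp.integrable_sq_norm hU).comp_smul hm).comp_sub_right t

theorem integral_comp_affine (f : Euc d → ℝ) (m : ℝ) (t : Euc d) :
    ∫ x, f (m • (x - t)) = |(m ^ d)⁻¹| * ∫ x, f x := by
  rw [integral_sub_right_eq_self (fun x => f (m • x)) t, Measure.integral_comp_smul]
  simp

theorem integral_inner_affine (K U : Euc d → F) {m : ℝ} (hm : m ≠ 0) (t : Euc d) :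
    ∫ x, inner ℝ (K x) (U (m • (x - t))) =
      |(m ^ d)⁻¹| * ∫ x, inner ℝ (K (m⁻¹ • x + t)) (U x) := by
  rw [← integral_comp_affine (fun x => inner ℝ (K (m⁻¹ • x + t)) (U x)) m t]
  congr 1
  ext x
  simp [smul_smul, hm]

/-- A change of variables moves the affine map onto the continuous factor `K`, after which dominated
convergence applies. -/
theorem tendsto_integral_inner_affine_of_continuous {K U : Euc d → F} (hK : Continuous K)
    (hKc : HasCompactSupport K) (hU : MemLp U 2 volume) :
    Tendsto (fun p : ℝ × Euc d => ∫ x, inner ℝ (K x) (U (p.1 • (x - p.2))))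
      (𝓝 (1, 0)) (𝓝 (∫ x, inner ℝ (K x) (U x))) := by
  have h1 : ∀ᶠ p : ℝ × Euc d in 𝓝 (1, 0), 1 / 2 < p.1 ∧ p.1 < 2 ∧ ‖p.2‖ < 1 := by
    have a : ∀ᶠ p : ℝ × Euc d in 𝓝 (1, 0), 1 / 2 < p.1 :=
      continuous_fst.continuousAt.eventually (lt_mem_nhds (by norm_num))
    have b : ∀ᶠ p : ℝ × Euc d in 𝓝 (1, 0), p.1 < 2 :=
      continuous_fst.continuousAt.eventually (gt_mem_nhds (by norm_num))
    have c : ∀ᶠ p : ℝ × Euc d in 𝓝 (1, 0), ‖p.2‖ < 1 :=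
      continuous_snd.norm.continuousAt.eventually (gt_mem_nhds (by simp))
    filter_upwards [a, b, c] with p ha hb hc using ⟨ha, hb, hc⟩
  obtain ⟨r, hr⟩ : ∃ r : ℝ, ∀ x, r < ‖x‖ → K x = 0 := by
    obtain ⟨r, hr⟩ := hKc.isCompact.isBounded.subset_closedBall (0 : Euc d)
    refine ⟨r, fun x hx => ?_⟩
    by_contra h
    have := hr (subset_tsupport K h)
    rw [mem_closedBall_zero_iff] at this
    linarith
  obtain ⟨C, hC⟩ := hKc.exists_bound_of_continuous hK
  -- For `m` in `(1/2, 2)` and `|t| < 1`, `K (m⁻¹ x + t) ≠ 0` forces `|x| ≤ 2 (|r| + 1)`: a fixed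
  -- ball carries the dominating function.
  have h2 : Tendsto (fun p : ℝ × Euc d => ∫ x, inner ℝ (K (p.1⁻¹ • x + p.2)) (U x))
      (𝓝 (1, 0)) (𝓝 (∫ x, inner ℝ (K x) (U x))) := by
    refine tendsto_integral_filter_of_dominated_convergence
      (fun x => (closedBall 0 (2 * (|r| + 1))).indicator (fun x => C * ‖U x‖) x) ?_ ?_ ?_ ?_
    · refine Eventually.of_forall fun p => ?_
      exact (hK.comp ((continuous_const_smul _).add continuous_const)).aestronglyMeasurable.inner
        hU.1
    · filter_upwards [h1] with p hp
      refine Eventually.of_forall fun x => ?_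
      by_cases hx : x ∈ closedBall (0 : Euc d) (2 * (|r| + 1))
      · rw [indicator_of_mem hx]
        exact (norm_inner_le_norm _ _).trans (by gcongr; exact hC _)
      · rw [indicator_of_notMem hx, hr, inner_zero_left, norm_zero]
        rw [mem_closedBall_zero_iff, not_le] at hx
        have hp0 : 0 < p.1 := by linarith
        have e1 : ‖p.1⁻¹ • x‖ ≤ ‖p.1⁻¹ • x + p.2‖ + ‖p.2‖ := by
          simpa using norm_sub_le (p.1⁻¹ • x + p.2) p.2
        have e2 : ‖p.1⁻¹ • x‖ = p.1⁻¹ * ‖x‖ := by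
          rw [norm_smul, norm_inv, Real.norm_of_nonneg hp0.le]
        have e3 : (|r| + 1) < p.1⁻¹ * ‖x‖ := by
          rw [inv_mul_eq_div, lt_div_iff₀ hp0]
          nlinarith [abs_nonneg r]
        linarith [le_abs_self r]
    · rw [integrable_indicator_iff measurableSet_closedBall]
      exact ((hU.norm.locallyIntegrable (by norm_num)).integrableOn_isCompact
        (isCompact_closedBall _ _)).const_mul C
    · refine Eventually.of_forall fun x => ?_
      have hc : ContinuousAt (fun p : ℝ × Euc d => inner ℝ (K (p.1⁻¹ • x + p.2)) (U x)) (1, 0) := by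
        refine ContinuousAt.inner ?_ continuousAt_const
        refine hK.continuousAt.comp ?_
        exact ((continuousAt_fst.inv₀ (by norm_num)).smul continuousAt_const).add continuousAt_snd
      have := hc.tendsto
      simpa using this
  have h3 : Tendsto (fun p : ℝ × Euc d => |(p.1 ^ d)⁻¹|) (𝓝 (1, 0)) (𝓝 1) := by
    have : ContinuousAt (fun p : ℝ × Euc d => |(p.1 ^ d)⁻¹|) (1, 0) :=
      ((continuousAt_fst.pow d).inv₀ (by simp)).abs
    simpa using this.tendsto
  have h4 := h3.mul h2
  rw [one_mul] at h4
  refine h4.congr' ?_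
  filter_upwards [h1] with p hp
  exact (integral_inner_affine K U (by linarith) p.2).symm

theorem sqrt_integral_affine_le {V : Type*} [NormedAddCommGroup V] {U : Euc d → V} {m : ℝ}
    (hm : 1 / 2 < m) (t : Euc d) :
    Real.sqrt (∫ x, ‖U (m • (x - t))‖ ^ 2) ≤ Real.sqrt (2 ^ d) * Real.sqrt (∫ x, ‖U x‖ ^ 2) := by
  rw [← Real.sqrt_mul (by positivity), integral_comp_affine (fun x => ‖U x‖ ^ 2)]
  refine Real.sqrt_le_sqrt (mul_le_mul_of_nonneg_right ?_ (integral_nonneg fun x => by positivity))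
  have hm0 : 0 < m := by linarith
  rw [abs_of_pos (by positivity), ← inv_pow]
  refine pow_le_pow_left₀ (by positivity) ?_ d
  rw [inv_le_comm₀ hm0 (by norm_num)]
  linarith

/-- The `L²` pairing with an affinely transformed function is continuous in the transformation. -/
theorem tendsto_integral_inner_affine {K U : Euc d → F}
    (hK : MemLp K 2 volume) (hU : MemLp U 2 volume) :
    Tendsto (fun p : ℝ × Euc d => ∫ x, inner ℝ (K x) (U (p.1 • (x - p.2))))
      (𝓝 (1, 0)) (𝓝 (∫ x, inner ℝ (K x) (U x))) := by
  rw [Metric.tendsto_nhds]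
  intro ε hε
  -- `c` dominates the `L²` norm of `U` and of all its affine transforms with `m > 1/2`, so
  -- approximating `K` within `ε / (4 c)` costs at most `ε / 4` in every pairing.
  set c : ℝ := (Real.sqrt (2 ^ d) + 1) * (Real.sqrt (∫ x, ‖U x‖ ^ 2) + 1) with hc
  have hc0 : 0 < c := by positivity
  obtain ⟨K', hKc, hKd, hK', hKm⟩ := MemLp.exists_hasCompactSupport_integral_rpow_sub_le
    (p := 2) (by norm_num) (f := K) (μ := volume) (by simpa using hK)
    (ε := (ε / (4 * c)) ^ 2) (by positivity)
  have hKm2 : MemLp K' 2 volume := by simpa using hKm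
  have hsub : MemLp (fun x => K x - K' x) 2 volume := hK.sub hKm2
  have hKd' : Real.sqrt (∫ x, ‖K x - K' x‖ ^ 2) ≤ ε / (4 * c) := by
    rw [Real.sqrt_le_left (by positivity)]
    simpa using hKd
  have hdiff : ∀ V : Euc d → F, MemLp V 2 volume → Real.sqrt (∫ x, ‖V x‖ ^ 2) ≤ c →
      |(∫ x, inner ℝ (K x) (V x)) - ∫ x, inner ℝ (K' x) (V x)| ≤ ε / 4 := by
    intro V hV hVc
    rw [← integral_sub (MemLp.integrable_inner' hK hV) (MemLp.integrable_inner' hKm2 hV)]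
    simp only [← inner_sub_left]
    refine (abs_integral_inner_le hsub hV).trans ?_
    calc _ ≤ ε / (4 * c) * c := by gcongr
      _ = ε / 4 := by field_simp
  have h1 : ∀ᶠ p : ℝ × Euc d in 𝓝 (1, 0), 1 / 2 < p.1 :=
    continuous_fst.continuousAt.eventually (lt_mem_nhds (by norm_num))
  have h2 := (Metric.tendsto_nhds.mp
    (tendsto_integral_inner_affine_of_continuous hK' hKc hU)) (ε / 4) (by positivity)
  have hs0 := Real.sqrt_nonneg (∫ x, ‖U x‖ ^ 2)
  have hs1 := Real.sqrt_nonneg ((2 : ℝ) ^ d)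
  filter_upwards [h1, h2] with p hp1 hp2
  have a := hdiff _ (memLp_comp_affine hU (by linarith : p.1 ≠ 0) p.2)
    ((sqrt_integral_affine_le hp1 p.2).trans (by rw [hc]; gcongr <;> linarith))
  have b := hdiff U hU (by rw [hc]; nlinarith)
  rw [Real.dist_eq] at hp2 ⊢
  rw [abs_le] at a b
  rw [abs_lt] at hp2 ⊢
  constructor <;> linarith [a.1, a.2, b.1, b.2, hp2.1, hp2.2]

end AffineContinuity

/-! ### Mollification and enlargement of the class of test functions -/

section Mollification

open Filter Topology

variable {d : ℕ} {F : Type*} [NormedAddCommGroup F] [InnerProductSpace ℝ F]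

/-- Needed for Fubini: translations preserve the `L²` norm, so by Cauchy-Schwarz the integral in `x`
is at most `|η s| ‖K‖ ‖U‖`, which is integrable in `s`. -/
theorem integrable_prod_inner_mollify {K U : Euc d → F} (hK : MemLp K 2 volume)
    (hU : MemLp U 2 volume) {η : Euc d → ℝ} (hη : Continuous η) (hηc : HasCompactSupport η) :
    Integrable (fun p : Euc d × Euc d => inner ℝ (K p.1) (η p.2 • U (p.1 - p.2)))
      (volume.prod volume) := by
  have hmeas : AEStronglyMeasurable
      (fun p : Euc d × Euc d => inner ℝ (K p.1) (η p.2 • U (p.1 - p.2))) (volume.prod volume) :=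
    hK.1.comp_fst.inner
      (hη.aestronglyMeasurable.convolution_integrand (ContinuousLinearMap.lsmul ℝ ℝ) hU.1)
  rw [integrable_prod_iff' hmeas]
  have hUs : ∀ s, MemLp (fun x => U (x - s)) 2 volume := fun s => by
    simpa using memLp_comp_affine hU one_ne_zero s
  constructor
  · refine Eventually.of_forall fun s => ?_
    simp only [inner_smul_right]
    exact (MemLp.integrable_inner' hK (hUs s)).const_mul _
  · refine Integrable.mono'
      (g := fun s => |η s| * (Real.sqrt (∫ x, ‖K x‖ ^ 2) * Real.sqrt (∫ x, ‖U x‖ ^ 2))) ?_ ?_ ?_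
    · exact ((hη.integrable_of_hasCompactSupport hηc).abs).mul_const _
    · exact hmeas.norm.prod_swap.integral_prod_right'
    · refine Eventually.of_forall fun s => ?_
      rw [Real.norm_of_nonneg (integral_nonneg fun x => norm_nonneg _)]
      have h1 : ∀ x, ‖inner ℝ (K x) (η s • U (x - s))‖ ≤ |η s| * (‖K x‖ * ‖U (x - s)‖) := by
        intro x
        rw [inner_smul_right, norm_mul]
        exact mul_le_mul_of_nonneg_left (norm_inner_le_norm _ _) (norm_nonneg _)
      have h2 : Integrable (fun x => ‖K x‖ * ‖U (x - s)‖) volume :=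
        hK.norm.integrable_mul (hUs s).norm
      calc ∫ x, ‖inner ℝ (K x) (η s • U (x - s))‖ ≤ ∫ x, |η s| * (‖K x‖ * ‖U (x - s)‖) :=
            integral_mono_of_nonneg (Eventually.of_forall fun x => norm_nonneg _)
              (h2.const_mul _) (Eventually.of_forall h1)
        _ = |η s| * ∫ x, ‖K x‖ * ‖U (x - s)‖ := integral_const_mul _ _
        _ ≤ _ := by
            gcongr
            refine (le_abs_self _).trans ((abs_integral_mul_le hK.norm (hUs s).norm).trans ?_)
            rw [integral_sub_right_eq_self (fun x => ‖U x‖ ^ 2) s]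

/-- Fubini turns the pairing with a mollification into an `η`-average of pairings with translates,
which depend continuously on the translation. -/
theorem integral_inner_mollify {K U : Euc d → F} [CompleteSpace F] (hK : MemLp K 2 volume)
    (hU : MemLp U 2 volume) {η : Euc d → ℝ} (hη : Continuous η) (hηc : HasCompactSupport η) :
    ∫ x, inner ℝ (K x) (∫ s, η s • U (x - s)) = ∫ s, η s * ∫ x, inner ℝ (K x) (U (x - s)) := by
  have hi := integrable_prod_inner_mollify hK hU hη hηc
  have h1 : ∀ x, inner ℝ (K x) (∫ s, η s • U (x - s)) =
      ∫ s, inner ℝ (K x) (η s • U (x - s)) := by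
    intro x
    refine (integral_inner ?_ _).symm
    have : LocallyIntegrable (fun s => U (x - s)) volume := by
      have hUx : MemLp (fun s => U (x - s)) 2 volume := by
        simpa [neg_sub] using memLp_comp_affine hU (neg_ne_zero.mpr one_ne_zero : (-1 : ℝ) ≠ 0) x
      exact hUx.locallyIntegrable (by norm_num)
    exact this.integrable_smul_left_of_hasCompactSupport hη hηc
  simp only [h1]
  rw [integral_integral_swap hi]
  congr 1
  ext s
  simp only [inner_smul_right]
  rw [integral_const_mul]

theorem integrable_mul_integral_inner {K U : Euc d → F} (hK : MemLp K 2 volume)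
    (hU : MemLp U 2 volume) {η : Euc d → ℝ} (hη : Continuous η) (hηc : HasCompactSupport η) :
    Integrable (fun s => η s * ∫ x, inner ℝ (K x) (U (x - s))) volume := by
  have := (integrable_prod_inner_mollify hK hU hη hηc).integral_prod_right
  refine this.congr (Eventually.of_forall fun s => ?_)
  simp only [inner_smul_right]
  rw [integral_const_mul]

/-- `U` is the weak gradient of `u` on the whole space, and both are square integrable. -/
structure IsGlobalH1 (u : Euc d → ℝ) (U : Euc d → Euc d) : Prop where
  memLp : MemLp u 2 volume
  gradient_memLp : MemLp U 2 volume
  weak_gradient : ∀ φ : Euc d → ℝ, ContDiff ℝ ∞ φ → HasCompactSupport φ →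
    ∫ x, u x • gradient φ x = - ∫ x, φ x • U x

/-- The derivative falls on the kernel; the weak gradient tested with `s ↦ η (x - s)` transfers it
to `u`. -/
theorem gradient_mollify {u : Euc d → ℝ} {U : Euc d → Euc d} (h : IsGlobalH1 u U)
    {η : Euc d → ℝ} (hη : ContDiff ℝ ∞ η) (hηc : HasCompactSupport η) :
    ContDiff ℝ ∞ (fun x => ∫ s, η s * u (x - s)) ∧
      ∀ x, gradient (fun x => ∫ s, η s * u (x - s)) x = ∫ s, η s • U (x - s) := by
  have hu : LocallyIntegrable u volume := h.memLp.locallyIntegrable (by norm_num)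
  have hU : LocallyIntegrable U volume := h.gradient_memLp.locallyIntegrable (by norm_num)
  have heq : (fun x => ∫ s, η s * u (x - s)) =
      MeasureTheory.convolution η u (ContinuousLinearMap.mul ℝ ℝ) volume := rfl
  constructor
  · rw [heq]
    exact hηc.contDiff_convolution_left _ hη hu
  · intro x
    rw [heq]
    refine gradient_eq_of_hasFDerivAt
      (hηc.hasFDerivAt_convolution_left _ (hη.of_le (by exact_mod_cast le_top)) hu x) fun y => ?_
    have hw := h.weak_gradient (fun s => η (x - s)) (hη.comp (contDiff_const.sub contDiff_id))
      (hηc.comp_homeomorph (Homeomorph.subLeft x))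
    simp only [gradient_comp_const_sub hη, smul_neg, integral_neg, neg_inj] at hw
    have e1 : ∫ s, η s • U (x - s) = ∫ s, η (x - s) • U s := by
      rw [← integral_sub_left_eq_self _ volume x]
      simp
    rw [e1, ← hw]
    have i1 : Integrable (fun t => u t • gradient η (x - t)) volume := by
      refine hu.integrable_smul_right_of_hasCompactSupport
        ((continuous_gradient hη).comp (continuous_const.sub continuous_id)) ?_
      exact (HasCompactSupport.gradient' hηc).comp_homeomorph (Homeomorph.subLeft x)
    rw [real_inner_comm, ← integral_inner i1, convolution_eq_swap]
    have i2 : Integrable (fun t => ((ContinuousLinearMap.mul ℝ ℝ).precompL (Euc d))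
        (fderiv ℝ η (x - t)) (u t)) volume := by
      have := hηc.fderiv (𝕜 := ℝ) |>.convolutionExists_left
        ((ContinuousLinearMap.mul ℝ ℝ).precompL (Euc d)) (hη.continuous_fderiv (by simp)) hu x
      exact (convolutionExistsAt_iff_integrable_swap).mp this
    rw [ContinuousLinearMap.integral_apply i2]
    refine integral_congr_ae (Eventually.of_forall fun t => ?_)
    simp [inner_smul_right, ContinuousLinearMap.precompL_apply, inner_gradient_right, mul_comm]

/-- A weak identity for test functions extends to `H¹` functions with compact support. -/
theorem weak_identity_of_compact {Ω : Set (Euc d)} (hΩ : IsOpen Ω) {q : Euc d → Euc d}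
    {f : Euc d → ℝ} (hq : MemLp q 2 volume) (hf : MemLp f 2 volume)
    (h : ∀ φ, IsTestFunction Ω φ → ∫ x, (inner ℝ (q x) (gradient φ x) + f x * φ x) = 0)
    {u : Euc d → ℝ} {U : Euc d → Euc d} (hu : IsGlobalH1 u U) {S : Set (Euc d)}
    (hS : IsCompact S) (hSΩ : S ⊆ Ω) (huS : ∀ x ∉ S, u x = 0) :
    ∫ x, (inner ℝ (q x) (U x) + f x * u x) = 0 := by
  -- `c s` is the left-hand side evaluated at the translate `u (· - s)`. It is continuous at `0`,
  -- and its averages against small mollifiers vanish because mollifications of `u` are admissible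
  -- tests.
  set c : Euc d → ℝ := fun s => (∫ x, inner ℝ (q x) (U (x - s))) + ∫ x, inner ℝ (f x) (u (x - s))
    with hc
  have hlim : Tendsto c (𝓝 0) (𝓝 (c 0)) := by
    have hp : Tendsto (fun s : Euc d => ((1 : ℝ), s)) (𝓝 0) (𝓝 (1, 0)) :=
      (continuous_const.prodMk continuous_id).tendsto' _ _ rfl
    have h1 := (tendsto_integral_inner_affine hq hu.gradient_memLp).comp hp
    have h2 := (tendsto_integral_inner_affine hf hu.memLp).comp hp
    have := h1.add h2
    simpa [hc, Function.comp_def] using this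
  obtain ⟨δ, hδ, hδS⟩ := hS.exists_cthickening_subset_open hΩ hSΩ
  have hc0 : c 0 = 0 := by
    by_contra hne
    have hpos : 0 < |c 0| := abs_pos.mpr hne
    obtain ⟨r, hr, hrc⟩ := Metric.tendsto_nhds_nhds.mp hlim (|c 0| / 2) (by positivity)
    have hm : 0 < min r δ := lt_min hr hδ
    -- The support radius is below `δ`, so the mollification stays supported in `Ω`, and below `r`,
    -- so `c` stays within `|c 0| / 2` of `c 0` on the support of `η`. An average of `c` over such a
    -- bump cannot vanish unless `c 0` does.
    let b : ContDiffBump (0 : Euc d) := ⟨min r δ / 4, min r δ / 2, by positivity, by linarith⟩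
    set η : Euc d → ℝ := b.normed volume with hη
    have hηs : ContDiff ℝ ∞ η := b.contDiff_normed
    have hηc : HasCompactSupport η := b.hasCompactSupport_normed
    have hηsupp : ∀ s, η s ≠ 0 → ‖s‖ < min r δ / 2 := by
      intro s hs
      have : s ∈ Function.support η := hs
      rw [hη, b.support_normed_eq, mem_ball_zero_iff] at this
      exact this
    obtain ⟨hsm, hgr⟩ := gradient_mollify hu hηs hηc
    have hsupp : tsupport (fun x => ∫ s, η s * u (x - s)) ⊆ cthickening δ S := by
      refine closure_minimal ?_ isClosed_cthickening
      intro x hx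
      by_contra hxS
      apply hx
      refine integral_eq_zero_of_ae (Eventually.of_forall fun s => ?_)
      by_cases hs : η s = 0
      · simp [hs]
      · have : x - s ∉ S := by
          intro hmem
          apply hxS
          refine mem_cthickening_of_dist_le x (x - s) δ S hmem ?_
          have := hηsupp s hs
          rw [dist_eq_norm, sub_sub_cancel]
          linarith [min_le_right r δ]
        simp [huS _ this]
    have htest : IsTestFunction Ω (fun x => ∫ s, η s * u (x - s)) :=
      ⟨hsm, HasCompactSupport.intro' (hS.cthickening) isClosed_cthickening
        (fun x hx => by_contra fun h0 => hx (hsupp (subset_tsupport _ h0))),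
        hsupp.trans hδS⟩
    have h0 := h _ htest
    simp only [hgr] at h0
    have i1 : Integrable (fun x => inner ℝ (q x) (∫ s, η s • U (x - s))) volume :=
      (integrable_prod_inner_mollify hq hu.gradient_memLp hηs.continuous hηc).integral_prod_left.congr
        (Eventually.of_forall fun x => by
          refine integral_inner (f := fun s => η s • U (x - s)) ?_ (q x)
          have hUx : MemLp (fun s => U (x - s)) 2 volume := by
            simpa [neg_sub] using memLp_comp_affine hu.gradient_memLp
              (neg_ne_zero.mpr one_ne_zero : (-1 : ℝ) ≠ 0) x
          exact (hUx.locallyIntegrable (by norm_num)).integrable_smul_left_of_hasCompactSupport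
            hηs.continuous hηc)
    have i2 : Integrable (fun x => f x * ∫ s, η s * u (x - s)) volume :=
      hf.integrable_mul (htest.memLp 2)
    rw [integral_add i1 i2, integral_inner_mollify hq hu.gradient_memLp hηs.continuous hηc] at h0
    have e2 := integral_inner_mollify hf hu.memLp hηs.continuous hηc
    have e3 : ∫ x, f x * ∫ s, η s * u (x - s) = ∫ x, inner ℝ (f x) (∫ s, η s • u (x - s)) := by
      simp [mul_comm]
    rw [e3, e2, ← integral_add
      (integrable_mul_integral_inner hq hu.gradient_memLp hηs.continuous hηc)
      (integrable_mul_integral_inner hf hu.memLp hηs.continuous hηc)] at h0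
    have i3 := (integrable_mul_integral_inner hq hu.gradient_memLp hηs.continuous hηc).add
      (integrable_mul_integral_inner hf hu.memLp hηs.continuous hηc)
    have i3' : Integrable (fun s => η s * c s) volume := by
      refine i3.congr (Eventually.of_forall fun s => ?_)
      simp [hc, mul_add]
    have h0' : ∫ s, η s * c s = 0 := by
      rw [← h0]
      refine integral_congr_ae (Eventually.of_forall fun s => ?_)
      simp [hc, mul_add]
    have hη1 : ∫ s, η s = 1 := b.integral_normed
    have i4 : Integrable η volume := b.integrable_normed
    have hfin : |∫ s, η s * (c 0 - c s)| ≤ ∫ s, η s * (|c 0| / 2) := by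
      rw [← Real.norm_eq_abs]
      refine norm_integral_le_of_norm_le (i4.mul_const _) (Eventually.of_forall fun s => ?_)
      rw [norm_mul, Real.norm_of_nonneg (b.nonneg_normed s)]
      by_cases hs : η s = 0
      · have hs' : b.normed volume s = 0 := hs
        simp [hs, hs']
      · refine mul_le_mul_of_nonneg_left ?_ (b.nonneg_normed s)
        have hs1 := hηsupp s hs
        have := hrc (x := s) (by rw [dist_zero_right]; linarith [min_le_left r δ])
        rw [dist_comm, dist_eq_norm] at this
        exact this.le
    simp only [mul_sub] at hfin
    rw [integral_sub (i4.mul_const _) i3', h0', integral_mul_const, integral_mul_const, hη1] at hfin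
    simp only [one_mul, sub_zero] at hfin
    linarith
  rw [← hc0, hc]
  simp only [sub_zero]
  rw [← integral_add (MemLp.integrable_inner' hq hu.gradient_memLp)
    (MemLp.integrable_inner' hf hu.memLp)]
  refine integral_congr_ae (Eventually.of_forall fun x => ?_)
  simp [mul_comm]

end Mollification

/-! ### Testing the equation with `w ζ` when `w` has zero trace -/

section ZeroTrace

open Filter Topology

variable {d : ℕ}

theorem isOpen_annulus (d : ℕ) (ρ : ℝ) : IsOpen (annulus d ρ) :=
  isOpen_ball.sdiff isClosed_closedBall

theorem mem_annulus {ρ : ℝ} {x : Euc d} : x ∈ annulus d ρ ↔ ‖x‖ < ρ ∧ 1 < ‖x‖ := by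
  simp [annulus]

/-- A function on the annulus, extended by zero, which vanishes on the unit sphere in the sense of
traces and solves `w / T - Δ w = 0` weakly. -/
structure ZeroTraceSol (ρ T : ℝ) (w : Euc d → ℝ) (W : Euc d → Euc d) : Prop where
  memLp : MemLp w 2 volume
  gradient_memLp : MemLp W 2 volume
  zero : ∀ x ∉ annulus d ρ, w x = 0
  weak_gradient : ∀ φ, IsTestFunction (ball 0 ρ) φ →
    ∫ x, w x • gradient φ x = - ∫ x, φ x • W x
  weak_eq : ∀ φ, IsTestFunction (annulus d ρ) φ →
    ∫ x, (inner ℝ (W x) (gradient φ x) + 1 / T * w x * φ x) = 0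

namespace ZeroTraceSol

variable {ρ T : ℝ} {w : Euc d → ℝ} {W : Euc d → Euc d}

/-- Scaling in the weak gradient. The condition `m ≤ 1` keeps the rescaled test function `χ (m⁻¹ x)`
supported in the ball of radius `ρ`. -/
theorem integral_comp_smul_gradient (h : ZeroTraceSol ρ T w W) {m : ℝ} (hm : 0 < m) (hm1 : m ≤ 1)
    {χ : Euc d → ℝ} (hχ : IsTestFunction (ball 0 ρ) χ) :
    ∫ x, w (m • x) • gradient χ x = - ∫ x, χ x • (m • W (m • x)) := by
  have hχ' : IsTestFunction (ball 0 ρ) (fun x => χ (m⁻¹ • x)) := by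
    refine ⟨hχ.smooth.comp (contDiff_const_smul _),
      hχ.compact.comp_homeomorph (Homeomorph.smulOfNeZero m⁻¹ (inv_ne_zero hm.ne')), ?_⟩
    intro x hx
    have := tsupport_comp_eq_preimage χ (Homeomorph.smulOfNeZero m⁻¹ (inv_ne_zero hm.ne') :
      Euc d ≃ₜ Euc d)
    have hx' : m⁻¹ • x ∈ tsupport χ := (this ▸ hx : x ∈ (Homeomorph.smulOfNeZero m⁻¹
      (inv_ne_zero hm.ne')) ⁻¹' tsupport χ)
    have h1 := hχ.support hx'
    rw [mem_ball_zero_iff, norm_smul, norm_inv, Real.norm_of_nonneg hm.le] at h1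
    rw [mem_ball_zero_iff]
    have h2 : ‖x‖ = m * (m⁻¹ * ‖x‖) := by field_simp
    have h3 : 0 ≤ m⁻¹ * ‖x‖ := by positivity
    nlinarith
  have hw := h.weak_gradient _ hχ'
  simp only [gradient_comp_smul hχ.smooth] at hw
  have e1 := Measure.integral_comp_smul volume (fun x => w x • (m⁻¹ • gradient χ (m⁻¹ • x))) m
  have e2 := Measure.integral_comp_smul volume (fun x => χ (m⁻¹ • x) • W x) m
  simp only [smul_smul, inv_mul_cancel₀ hm.ne', one_smul] at e1 e2 hw
  rw [hw, smul_neg, ← e2] at e1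
  have e3 : ∫ x, w (m • x) • gradient χ x =
      m • ∫ x, (w (m • x) * m⁻¹) • gradient χ x := by
    rw [← integral_smul]
    congr 1
    ext1 x
    rw [smul_smul]
    congr 1
    field_simp
  rw [e3, e1, smul_neg, ← integral_smul]
  congr 2
  ext1 x
  rw [smul_smul, smul_smul, mul_comm]

/-- The product rule, valid on the whole space thanks to `ζ`. For `m < 1` the dilate `w (m x)`
vanishes for `|x| ≤ 1 / m`, that is, on a neighbourhood of the closed unit ball; this replaces an
approximation of zero-trace functions by test functions. -/
theorem isGlobalH1_smul_mul (h : ZeroTraceSol ρ T w W) {m : ℝ} (hm : 0 < m) (hm1 : m ≤ 1)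
    {ζ : Euc d → ℝ} (hζ : IsTestFunction (ball 0 ρ) ζ) :
    IsGlobalH1 (fun x => w (m • x) * ζ x)
      (fun x => ζ x • (m • W (m • x)) + w (m • x) • gradient ζ x) := by
  have h1 : MemLp (fun x => w (m • x)) 2 volume := by
    simpa using memLp_comp_affine h.memLp hm.ne' 0
  have h2 : MemLp (fun x => m • W (m • x)) 2 volume := by
    have h3 : MemLp (fun x => W (m • x)) 2 volume := by
      simpa using memLp_comp_affine h.gradient_memLp hm.ne' 0
    exact h3.const_smul m
  refine ⟨?_, ?_, ?_⟩
  · exact (hζ.memLp ⊤).mul h1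
  · exact (h2.smul (hζ.memLp ⊤)).add ((hζ.gradient_memLp ⊤).smul h1)
  · intro φ hφ hφc
    have hφ' : IsTestFunction univ φ := ⟨hφ, hφc, subset_univ _⟩
    have hχ : IsTestFunction (ball 0 ρ) (fun x => ζ x * φ x) := hζ.mul_smooth hφ
    have hw := h.integral_comp_smul_gradient hm hm1 hχ
    simp only [gradient_mul hζ.smooth hφ] at hw
    have hζφ : IsTestFunction univ (fun x => ζ x * φ x) := hχ.mono (subset_univ _)
    have i1 : Integrable (fun x => (w (m • x) * ζ x) • gradient φ x) volume :=
      memLp_one_iff_integrable.mp (((hφ'.gradient_memLp 2).smul ((hζ.memLp ⊤).mul (r := 2) h1)))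
    have i2 : Integrable (fun x => w (m • x) • φ x • gradient ζ x) volume :=
      memLp_one_iff_integrable.mp (((hζ.gradient_memLp 2).smul (r := 2) (hφ'.memLp ⊤)).smul h1)
    have i3 : Integrable (fun x => (ζ x * φ x) • m • W (m • x)) volume :=
      memLp_one_iff_integrable.mp (h2.smul (hζφ.memLp 2))
    have e1 : ∫ x, w (m • x) • (ζ x • gradient φ x + φ x • gradient ζ x) =
        (∫ x, (w (m • x) * ζ x) • gradient φ x) + ∫ x, w (m • x) • φ x • gradient ζ x := by
      rw [← integral_add i1 i2]
      congr 1
      ext1 x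
      rw [smul_add, smul_smul]
    have e2 : ∫ x, φ x • (ζ x • m • W (m • x) + w (m • x) • gradient ζ x) =
        (∫ x, (ζ x * φ x) • m • W (m • x)) + ∫ x, w (m • x) • φ x • gradient ζ x := by
      rw [← integral_add i3 i2]
      congr 1
      ext1 x
      rw [smul_add, smul_smul, smul_comm (φ x) (w (m • x)), mul_comm]
    rw [e1] at hw
    rw [e2, neg_add, ← hw]
    abel

/-- The identity obtained by testing the equation with `w ζ`. -/
theorem energy_identity (h : ZeroTraceSol ρ T w W) {ζ : Euc d → ℝ}
    (hζ : IsTestFunction (ball 0 ρ) ζ) :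
    (∫ x, ζ x * ‖W x‖ ^ 2) + (∫ x, w x * inner ℝ (W x) (gradient ζ x)) +
      1 / T * ∫ x, ζ x * w x ^ 2 = 0 := by
  have hK1 : MemLp (fun x => ζ x • W x) 2 volume := h.gradient_memLp.smul (hζ.memLp ⊤)
  have hK2 : MemLp (fun x => inner ℝ (W x) (gradient ζ x)) 2 volume := by
    obtain ⟨C, hC0, hC⟩ := hζ.exists_bound
    refine (h.gradient_memLp.norm.const_mul C).mono
      (h.gradient_memLp.1.inner hζ.continuous_gradient.aestronglyMeasurable)
      (Eventually.of_forall fun x => ?_)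
    rw [Real.norm_of_nonneg (by positivity : 0 ≤ C * ‖W x‖), mul_comm]
    exact (norm_inner_le_norm _ _).trans (by gcongr; exact (hC x).2)
  have hK3 : MemLp (fun x => ζ x * w x) 2 volume := h.memLp.mul (hζ.memLp ⊤)
  -- For `m < 1` the function `w (m x) ζ x` has compact support in the open annulus, so it is
  -- admissible in the equation; the claim is the limit `m ↑ 1`.
  have hm : ∀ m : ℝ, 0 < m → m < 1 →
      m * (∫ x, inner ℝ (ζ x • W x) (W (m • x))) +
        (∫ x, inner ℝ (inner ℝ (W x) (gradient ζ x)) (w (m • x))) +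
        1 / T * ∫ x, inner ℝ (ζ x * w x) (w (m • x)) = 0 := by
    intro m hm hm1
    have hS : IsCompact ({x : Euc d | 1 ≤ ‖m • x‖} ∩ tsupport ζ) :=
      hζ.compact.isCompact.inter_left
        (isClosed_le continuous_const (continuous_const_smul m).norm)
    have h1 : MemLp (fun x => w (m • x)) 2 volume := by
      simpa using memLp_comp_affine h.memLp hm.ne' 0
    have h2 : MemLp (fun x => W (m • x)) 2 volume := by
      simpa using memLp_comp_affine h.gradient_memLp hm.ne' 0
    have := weak_identity_of_compact (isOpen_annulus d ρ) h.gradient_memLp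
      (h.memLp.const_mul (1 / T)) h.weak_eq (h.isGlobalH1_smul_mul hm hm1.le hζ) hS ?_ ?_
    · have i1 := MemLp.integrable_inner' hK1 h2
      have i2 := MemLp.integrable_inner' hK2 h1
      have i3 := MemLp.integrable_inner' hK3 h1
      have e := integral_add ((i1.const_mul m).add i2) (i3.const_mul (1 / T))
      have e' := integral_add (i1.const_mul m) i2
      rw [← integral_const_mul, ← integral_const_mul, ← e', ← this]
      refine e.symm.trans ?_
      congr 1
      ext1 x
      simp [inner_add_right, inner_smul_left, inner_smul_right]
      ring
    · rintro x ⟨hx1, hx2⟩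
      have h3 := hζ.support hx2
      rw [mem_ball_zero_iff] at h3
      rw [mem_ofPred_eq, norm_smul, Real.norm_of_nonneg hm.le] at hx1
      rw [mem_annulus]
      refine ⟨h3, ?_⟩
      nlinarith [norm_nonneg x]
    · intro x hx
      by_cases hx1 : 1 ≤ ‖m • x‖
      · have : x ∉ tsupport ζ := fun h' => hx ⟨hx1, h'⟩
        rw [image_eq_zero_of_notMem_tsupport this, mul_zero]
      · rw [h.zero _ (fun h' => hx1 (mem_annulus.mp h').2.le), zero_mul]
  have hp : Tendsto (fun m : ℝ => (m, (0 : Euc d))) (𝓝[<] 1) (𝓝 (1, 0)) :=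
    ((continuous_id.prodMk continuous_const).tendsto' _ _ rfl).mono_left nhdsWithin_le_nhds
  have t1 := (tendsto_integral_inner_affine hK1 h.gradient_memLp).comp hp
  have t2 := (tendsto_integral_inner_affine hK2 h.memLp).comp hp
  have t3 := (tendsto_integral_inner_affine hK3 h.memLp).comp hp
  have t0 : Tendsto (fun m : ℝ => m) (𝓝[<] 1) (𝓝 1) := nhdsWithin_le_nhds
  have t := ((t0.mul t1).add t2).add (t3.const_mul (1 / T))
  simp only [Function.comp_def, sub_zero] at t
  have hev : ∀ᶠ m : ℝ in 𝓝[<] 1, m ∈ Ioo (0 : ℝ) 1 := Ioo_mem_nhdsLT (by norm_num)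
  have t' := t.congr' (hev.mono fun m hm' => hm m hm'.1 hm'.2)
  have := tendsto_nhds_unique t' tendsto_const_nhds
  rw [one_mul] at this
  rw [← this]
  congr 1
  · congr 1
    · congr 1
      ext1 x
      rw [inner_smul_left, real_inner_self_eq_norm_sq]
      rfl
  · congr 2
    ext1 x
    simp
    ring

/-- The chain rule for `w ^ 2`, in the direction `y`. -/
theorem chain_rule (h : ZeroTraceSol ρ T w W) {ξ : Euc d → ℝ}
    (hξ : IsTestFunction (ball 0 ρ) ξ) (y : Euc d) :
    2 * (∫ x, w x * ξ x * inner ℝ (W x) y) + ∫ x, w x ^ 2 * inner ℝ y (gradient ξ x) = 0 := by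
  have hq : MemLp (fun x => w x • y) 2 volume := by
    refine (h.memLp.norm.const_mul ‖y‖).mono (h.memLp.1.smul aestronglyMeasurable_const)
      (Eventually.of_forall fun x => ?_)
    rw [norm_smul, norm_mul, norm_norm, norm_norm, mul_comm]
  have hf : MemLp (fun x => inner ℝ (W x) y) 2 volume := by
    refine (h.gradient_memLp.norm.const_mul ‖y‖).mono
      (h.gradient_memLp.1.inner aestronglyMeasurable_const) (Eventually.of_forall fun x => ?_)
    rw [norm_mul, norm_norm, norm_norm, mul_comm]
    exact norm_inner_le_norm _ _
  have hu := h.isGlobalH1_smul_mul one_pos le_rfl hξ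
  -- The definition of the weak derivative in the direction `y`, read as a weak identity with `q = w
  -- y` and `f = W · y`, is tested with `w ξ` itself.
  have := weak_identity_of_compact isOpen_ball hq hf ?_ hu hξ.compact.isCompact hξ.support ?_
  · simp only [one_smul] at this hu
    have i1 : Integrable (fun x => w x * ξ x * inner ℝ (W x) y) volume :=
      ((hξ.memLp ⊤).mul (r := 2) h.memLp).integrable_mul hf
    have i2 : Integrable (fun x => w x ^ 2 * inner ℝ y (gradient ξ x)) volume := by
      have hm : MemLp (fun x => w x * inner ℝ y (gradient ξ x)) 2 volume :=
        (((hξ.gradient_apply y).memLp ⊤).mul (r := 2) h.memLp)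
      refine (h.memLp.integrable_mul hm).congr (Eventually.of_forall fun x => ?_)
      simp
      ring
    rw [← integral_const_mul, ← integral_add (i1.const_mul 2) i2, ← this]
    congr 1
    ext1 x
    rw [inner_add_right, inner_smul_left, inner_smul_left, inner_smul_right, inner_smul_right,
      real_inner_comm (W x) y]
    simp
    ring
  · intro φ hφ
    have hw := h.weak_gradient φ hφ
    have i1 : Integrable (fun x => w x • gradient φ x) volume :=
      memLp_one_iff_integrable.mp ((hφ.gradient_memLp 2).smul h.memLp)
    have i2 : Integrable (fun x => φ x • W x) volume :=
      memLp_one_iff_integrable.mp (h.gradient_memLp.smul (hφ.memLp 2))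
    have e1 := integral_inner (𝕜 := ℝ) i1 y
    have e2 := integral_inner (𝕜 := ℝ) i2 y
    rw [← neg_eq_iff_eq_neg] at hw
    rw [← hw, inner_neg_right, ← e1] at e2
    have j1 : Integrable (fun x => inner ℝ y (w x • gradient φ x)) volume :=
      i1.const_inner (𝕜 := ℝ) y
    have j2 : Integrable (fun x => inner ℝ y (φ x • W x)) volume := i2.const_inner (𝕜 := ℝ) y
    have e3 := integral_add j1 j2
    rw [e2, add_neg_cancel] at e3
    rw [← e3]
    congr 1
    ext1 x
    rw [inner_smul_left, inner_smul_right, inner_smul_right, real_inner_comm y (W x)]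
    simp
    ring
  · intro x hx
    rw [image_eq_zero_of_notMem_tsupport hx, mul_zero]

end ZeroTraceSol

end ZeroTrace

/-! ### Caccioppoli's inequality and subharmonicity of `w ^ 2` -/

section InteriorEstimates

open Filter Topology

variable {d : ℕ}

namespace ZeroTraceSol

variable {ρ T : ℝ} {w : Euc d → ℝ} {W : Euc d → Euc d}

theorem integrable_sq_mul (h : ZeroTraceSol ρ T w W) {Ω : Set (Euc d)} {φ : Euc d → ℝ}
    (hφ : IsTestFunction Ω φ) : Integrable (fun x => w x ^ 2 * φ x) volume := by
  refine (h.memLp.integrable_mul ((hφ.memLp ⊤).mul (r := 2) h.memLp)).congr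
    (Eventually.of_forall fun x => ?_)
  simp
  ring

theorem integrable_mul_inner_gradient (h : ZeroTraceSol ρ T w W) {Ω : Set (Euc d)}
    {φ : Euc d → ℝ} (hφ : IsTestFunction Ω φ) :
    Integrable (fun x => w x * inner ℝ (W x) (gradient φ x)) volume := by
  have := MemLp.integrable_inner' h.gradient_memLp ((hφ.gradient_memLp ⊤).smul (r := 2) h.memLp)
  refine this.congr (Eventually.of_forall fun x => ?_)
  simp [inner_smul_right]

/-- The chain rule with `ξ = ∂ᵢψ` and `y = eᵢ`, summed over `i`; the inner sum is the Laplacian of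
`ψ`. -/
theorem chain_rule_laplacian (h : ZeroTraceSol ρ T w W) {ψ : Euc d → ℝ}
    (hψ : IsTestFunction (ball 0 ρ) ψ) :
    2 * (∫ x, w x * inner ℝ (W x) (gradient ψ x)) + ∫ x, w x ^ 2 *
      ∑ i, inner ℝ (EuclideanSpace.basisFun (Fin d) ℝ i)
        (gradient (fun z => inner ℝ (EuclideanSpace.basisFun (Fin d) ℝ i) (gradient ψ z)) x) = 0 := by
  set e := EuclideanSpace.basisFun (Fin d) ℝ with he
  have hi := fun i => h.chain_rule (hψ.gradient_apply (e i)) (e i)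
  have hs : ∑ i, (2 * (∫ x, w x * inner ℝ (e i) (gradient ψ x) * inner ℝ (W x) (e i)) +
      ∫ x, w x ^ 2 * inner ℝ (e i) (gradient (fun z => inner ℝ (e i) (gradient ψ z)) x)) = 0 :=
    Finset.sum_eq_zero fun i _ => hi i
  rw [Finset.sum_add_distrib, ← Finset.mul_sum, ← integral_finsetSum, ← integral_finsetSum] at hs
  · rw [← hs]
    congr 3
    · ext1 x
      rw [← e.sum_inner_mul_inner (W x) (gradient ψ x), Finset.mul_sum]
      refine Finset.sum_congr rfl fun i _ => ?_
      ring
    · ext1 x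
      rw [Finset.mul_sum]
  · intro i _
    exact h.integrable_sq_mul ((hψ.gradient_apply (e i)).gradient_apply (e i))
  · intro i _
    have hm : MemLp (fun x => w x * inner ℝ (e i) (gradient ψ x)) 2 volume :=
      ((hψ.gradient_apply (e i)).memLp ⊤).mul h.memLp
    have := MemLp.integrable_inner' h.gradient_memLp ((memLp_top_const (e i) :
      MemLp (fun _ => e i) ⊤ volume).smul (r := 2) hm)
    refine this.congr (Eventually.of_forall fun x => ?_)
    simp [inner_smul_right]

end ZeroTraceSol

/-- Caccioppoli's inequality for solutions with zero trace on the unit sphere. -/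
theorem exists_caccioppoli (d : ℕ) {r R : ℝ} (hr : 0 < r) (hrR : r < R) :
    ∃ C : ℝ, 0 < C ∧ ∀ {ρ T : ℝ}, R < ρ → 0 < T → ∀ {w : Euc d → ℝ} {W : Euc d → Euc d},
      ZeroTraceSol ρ T w W →
      ∫ x in ball (0 : Euc d) r, ‖W x‖ ^ 2 ≤ C * ∫ x in ball (0 : Euc d) R, w x ^ 2 := by
  let η : ContDiffBump (0 : Euc d) := ⟨r, (r + R) / 2, hr, by linarith⟩
  have hηt : IsTestFunction (ball 0 R) η := ⟨η.contDiff, η.hasCompactSupport, by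
    rw [η.tsupport_eq]
    exact closedBall_subset_ball (show (r + R) / 2 < R by linarith)⟩
  obtain ⟨C, hC0, hC⟩ := hηt.exists_bound
  refine ⟨4 * C ^ 2 + 1, by positivity, ?_⟩
  intro ρ T hρ hT w W h
  have hηρ : IsTestFunction (ball 0 ρ) η := hηt.mono (ball_subset_ball hρ.le)
  have hζ : IsTestFunction (ball 0 ρ) (fun x => η x * η x) := hηρ.mul_smooth η.contDiff
  have hen := h.energy_identity hζ
  have hiW : Integrable (fun x => η x * η x * ‖W x‖ ^ 2) volume := by
    have := MemLp.integrable_sq_norm (h.gradient_memLp.smul (hηρ.memLp ⊤) : MemLp _ 2 volume)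
    refine this.congr (Eventually.of_forall fun x => ?_)
    simp [norm_smul]
    rw [mul_pow, sq_abs]
    ring
  have hiw : IntegrableOn (fun x => w x ^ 2) (ball 0 R) volume := by
    have := MemLp.integrable_sq_norm h.memLp
    simp only [Real.norm_eq_abs, sq_abs] at this
    exact this.integrableOn
  have hiw' : Integrable ((ball (0 : Euc d) R).indicator (fun x => 2 * C ^ 2 * w x ^ 2)) volume :=
    (integrable_indicator_iff measurableSet_ball).mpr (hiw.const_mul _)
  have h3 : 0 ≤ 1 / T * ∫ x, η x * η x * w x ^ 2 :=
    mul_nonneg (by positivity) (integral_nonneg fun x => mul_nonneg (mul_self_nonneg _) (sq_nonneg _))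
  -- Young's inequality `2 C |η w| |W| ≤ η² |W|² / 2 + 2 C² w²` in the energy identity with `ζ =
  -- η²`; absorbing the first term produces the constant `4 C²`.
  have hpt : ∀ x, -(w x * inner ℝ (W x) (gradient (fun x => η x * η x) x)) ≤
      1 / 2 * (η x * η x * ‖W x‖ ^ 2) +
        (ball (0 : Euc d) R).indicator (fun x => 2 * C ^ 2 * w x ^ 2) x := by
    intro x
    rw [gradient_mul η.contDiff η.contDiff, ← two_smul ℝ, smul_smul, inner_smul_right]
    by_cases hx : x ∈ ball (0 : Euc d) R
    · rw [indicator_of_mem hx]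
      have h1 : |inner ℝ (W x) (gradient η x)| ≤ ‖W x‖ * C :=
        (abs_real_inner_le_norm _ _).trans (by gcongr; exact (hC x).2)
      have h2 : -(w x * (2 * η x * inner ℝ (W x) (gradient η x))) ≤
          2 * (|η x| * |w x| * (‖W x‖ * C)) := by
        calc -(w x * (2 * η x * inner ℝ (W x) (gradient η x)))
            ≤ |w x * (2 * η x * inner ℝ (W x) (gradient η x))| := neg_le_abs _
          _ = 2 * (|η x| * |w x| * |inner ℝ (W x) (gradient η x)|) := by
              rw [abs_mul, abs_mul, abs_mul, abs_two]
              ring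
          _ ≤ _ := by gcongr
      have h4 := sq_abs (η x)
      have h5 := sq_abs (w x)
      nlinarith [sq_nonneg (|η x| * ‖W x‖ - 2 * C * |w x|)]
    · rw [indicator_of_notMem hx, hηt.gradient_eq_zero hx, inner_zero_right]
      simp only [mul_zero, neg_zero, add_zero]
      exact mul_nonneg (by norm_num) (mul_nonneg (mul_self_nonneg _) (sq_nonneg _))
  have hint := integral_mono (h.integrable_mul_inner_gradient hζ).neg
    ((hiW.const_mul (1 / 2)).add hiw') hpt
  have e1 := integral_add (hiW.const_mul (1 / 2)) hiw'
  simp only [Pi.neg_apply, integral_neg] at hint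
  have hint' := hint.trans_eq e1
  rw [integral_const_mul, integral_indicator measurableSet_ball, integral_const_mul] at hint'
  have h6 : ∫ x in ball (0 : Euc d) r, ‖W x‖ ^ 2 ≤ ∫ x, η x * η x * ‖W x‖ ^ 2 := by
    rw [← integral_indicator measurableSet_ball]
    refine integral_mono ((integrable_indicator_iff measurableSet_ball).mpr
      (MemLp.integrable_sq_norm h.gradient_memLp).integrableOn) hiW fun x => ?_
    by_cases hx : x ∈ ball (0 : Euc d) r
    · rw [indicator_of_mem hx, η.one_of_mem_closedBall (ball_subset_closedBall hx)]
      simp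
    · rw [indicator_of_notMem hx]
      exact mul_nonneg (mul_self_nonneg _) (sq_nonneg _)
  have h7 : 0 ≤ ∫ x in ball (0 : Euc d) R, w x ^ 2 := integral_nonneg fun x => by positivity
  nlinarith

/-- The Laplacian of a radial function. -/
theorem laplacian_radial {p : ℝ → ℝ} (hp : ContDiffOn ℝ ∞ p (Ioi (-1))) (x : Euc d) :
    gradient (fun z : Euc d => p (‖z‖ ^ 2)) x = (2 * deriv p (‖x‖ ^ 2)) • x ∧
    ∑ i, inner ℝ (EuclideanSpace.basisFun (Fin d) ℝ i) (gradient (fun z =>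
      inner ℝ (EuclideanSpace.basisFun (Fin d) ℝ i)
        (gradient (fun z : Euc d => p (‖z‖ ^ 2)) z)) x) =
      4 * ‖x‖ ^ 2 * deriv (deriv p) (‖x‖ ^ 2) + 2 * d * deriv p (‖x‖ ^ 2) := by
  -- Smoothness on `(-1, ∞)` makes every value of `|z| ^ 2`, including `0`, an interior point; it
  -- also admits the non-integer powers of `1 + s` in the barrier.
  have hmem : ∀ z : Euc d, Ioi (-1 : ℝ) ∈ 𝓝 (‖z‖ ^ 2) := fun z =>
    Ioi_mem_nhds (by nlinarith [sq_nonneg ‖z‖])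
  have hgrad : ∀ z : Euc d, gradient (fun z : Euc d => p (‖z‖ ^ 2)) z =
      (2 * deriv p (‖z‖ ^ 2)) • z := by
    intro z
    have h1 : HasDerivAt p (deriv p (‖z‖ ^ 2)) (‖z‖ ^ 2) :=
      ((hp.contDiffAt (hmem z)).differentiableAt (by simp)).hasDerivAt
    refine gradient_eq_of_hasFDerivAt (h1.comp_hasFDerivAt z
      (hasStrictFDerivAt_norm_sq z).hasFDerivAt) fun y => ?_
    simp [inner_smul_left]
    ring
  refine ⟨hgrad x, ?_⟩
  set e := EuclideanSpace.basisFun (Fin d) ℝ with he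
  have hdp : ContDiffOn ℝ ∞ (deriv p) (Ioi (-1)) :=
    ((contDiffOn_infty_iff_deriv_of_isOpen isOpen_Ioi).mp hp).2
  have hi : ∀ i, inner ℝ (e i) (gradient (fun z => inner ℝ (e i)
        (gradient (fun z : Euc d => p (‖z‖ ^ 2)) z)) x) =
      4 * deriv (deriv p) (‖x‖ ^ 2) * (inner ℝ x (e i) * inner ℝ (e i) x) +
        2 * deriv p (‖x‖ ^ 2) := by
    intro i
    simp only [hgrad, inner_smul_right]
    have h1 : HasDerivAt (deriv p) (deriv (deriv p) (‖x‖ ^ 2)) (‖x‖ ^ 2) :=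
      ((hdp.contDiffAt (hmem x)).differentiableAt (by simp)).hasDerivAt
    have h2 := (h1.comp_hasFDerivAt x (hasStrictFDerivAt_norm_sq x).hasFDerivAt).const_mul 2
    have h3 : HasFDerivAt (fun z : Euc d => inner ℝ (e i) z) (innerSL ℝ (e i)) x :=
      (innerSL ℝ (e i)).hasFDerivAt
    have h4 := h2.mul h3
    have h5 : gradient (fun z : Euc d => 2 * deriv p (‖z‖ ^ 2) * inner ℝ (e i) z) x =
        (2 * deriv p (‖x‖ ^ 2)) • e i +
          (4 * deriv (deriv p) (‖x‖ ^ 2) * inner ℝ (e i) x) • x := by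
      refine gradient_eq_of_hasFDerivAt h4 fun y => ?_
      simp [inner_smul_left, inner_add_left]
      ring
    rw [h5, inner_add_right, inner_smul_right, inner_smul_right, real_inner_self_eq_norm_sq,
      e.orthonormal.1 i, real_inner_comm x (e i)]
    ring
  simp only [hi]
  rw [Finset.sum_add_distrib, ← Finset.mul_sum, e.sum_inner_mul_inner, real_inner_self_eq_norm_sq]
  simp
  ring

/-- Weak subharmonicity of `w ^ 2` against nonnegative radial tests `ψ`: the chain rule and the
energy identity give `∫ w² Δψ = 2 ∫ ψ (|W|² + w² / T)`. -/
theorem ZeroTraceSol.radial_subharmonic {ρ T : ℝ} (hρ : 0 < ρ) (hT : 0 < T) {w : Euc d → ℝ}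
    {W : Euc d → Euc d} (h : ZeroTraceSol ρ T w W) {p : ℝ → ℝ}
    (hp : ContDiffOn ℝ ∞ p (Ioi (-1))) (hpos : ∀ s, 0 ≤ s → 0 ≤ p s) {b : ℝ} (hb : b < ρ ^ 2)
    (hpb : ∀ s, b ≤ s → p s = 0) :
    Integrable (fun x => w x ^ 2 *
      (4 * ‖x‖ ^ 2 * deriv (deriv p) (‖x‖ ^ 2) + 2 * d * deriv p (‖x‖ ^ 2))) volume ∧
    0 ≤ ∫ x, w x ^ 2 *
      (4 * ‖x‖ ^ 2 * deriv (deriv p) (‖x‖ ^ 2) + 2 * d * deriv p (‖x‖ ^ 2)) := by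
  have hsupp : tsupport (fun z : Euc d => p (‖z‖ ^ 2)) ⊆ {z | ‖z‖ ^ 2 ≤ b} := by
    refine closure_minimal (fun z hz => ?_) (isClosed_le (by fun_prop) continuous_const)
    by_contra hlt
    exact hz (hpb _ (not_le.mp hlt).le)
  have hsub : {z : Euc d | ‖z‖ ^ 2 ≤ b} ⊆ ball 0 ρ := by
    intro z hz
    rw [mem_ball_zero_iff]
    exact lt_of_pow_lt_pow_left₀ 2 hρ.le (lt_of_le_of_lt hz hb)
  have htest : IsTestFunction (ball (0 : Euc d) ρ) (fun z => p (‖z‖ ^ 2)) := by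
    refine ⟨?_, ?_, hsupp.trans hsub⟩
    · rw [contDiff_iff_contDiffAt]
      intro z
      exact (hp.contDiffAt (Ioi_mem_nhds (by nlinarith [sq_nonneg ‖z‖]))).comp z
        (contDiff_norm_sq ℝ).contDiffAt
    · refine (isCompact_closedBall (0 : Euc d) ρ).of_isClosed_subset (isClosed_tsupport _) ?_
      exact (hsupp.trans hsub).trans ball_subset_closedBall
  have h1 := h.chain_rule_laplacian htest
  have h2 := h.energy_identity htest
  have h3 : 0 ≤ ∫ x, p (‖x‖ ^ 2) * ‖W x‖ ^ 2 :=
    integral_nonneg fun x => mul_nonneg (hpos _ (by positivity)) (by positivity)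
  have h4 : 0 ≤ 1 / T * ∫ x, p (‖x‖ ^ 2) * w x ^ 2 :=
    mul_nonneg (by positivity)
      (integral_nonneg fun x => mul_nonneg (hpos _ (by positivity)) (by positivity))
  simp only [fun x => (laplacian_radial (d := d) hp x).2] at h1
  refine ⟨?_, by linarith⟩
  simp only [← fun x => (laplacian_radial (d := d) hp x).2, Finset.mul_sum]
  refine integrable_finsetSum _ fun i _ => ?_
  exact h.integrable_sq_mul ((htest.gradient_apply _).gradient_apply _)

end InteriorEstimates

/-! ### The radial barrier and the decay of solutions with zero trace -/

section Decay

open Filter Topology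

variable {d : ℕ}

/-- To be used at `s = |x|² / ρ²`. For `ρ ≥ 4` the value `9/16` leaves the barrier untouched where
`|x| ≤ 3`, and `3/4 < 1` keeps the support inside the ball of radius `ρ`. -/
theorem exists_cutoff : ∃ (χ : ℝ → ℝ) (M : ℝ), ContDiff ℝ ∞ χ ∧ 0 ≤ M ∧
    (∀ s, 0 ≤ χ s) ∧ (∀ s, χ s ≤ 1) ∧ (∀ s, s ≤ 9 / 16 → χ s = 1) ∧ (∀ s, 3 / 4 ≤ s → χ s = 0) ∧
    (∀ s, |deriv χ s| ≤ M ∧ |deriv (deriv χ) s| ≤ M) ∧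
    (∀ s, s < 9 / 16 → deriv χ s = 0 ∧ deriv (deriv χ) s = 0) ∧
    (∀ s, 3 / 4 < s → deriv χ s = 0 ∧ deriv (deriv χ) s = 0) := by
  set χ : ℝ → ℝ := fun s => Real.smoothTransition (4 - 16 / 3 * s) with hχ
  have hs : ContDiff ℝ ∞ χ :=
    Real.smoothTransition.contDiff.comp (contDiff_const.sub (contDiff_const.mul contDiff_id))
  have h1 : ∀ s, s ≤ 9 / 16 → χ s = 1 := fun s hs =>
    Real.smoothTransition.one_of_one_le (by linarith)
  have h0 : ∀ s, 3 / 4 ≤ s → χ s = 0 := fun s hs =>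
    Real.smoothTransition.zero_of_nonpos (by linarith)
  have hs' : ContDiff ℝ ∞ (deriv χ) := (contDiff_infty_iff_deriv.mp hs).2
  have hs'' : ContDiff ℝ ∞ (deriv (deriv χ)) := (contDiff_infty_iff_deriv.mp hs').2
  have hd1 : ∀ s, s < 9 / 16 → deriv χ s = 0 := by
    intro s hs
    have : χ =ᶠ[𝓝 s] fun _ => 1 := by
      filter_upwards [Iio_mem_nhds hs] with t ht using h1 t (le_of_lt ht)
    rw [this.deriv_eq, deriv_const]
  have hd2 : ∀ s, 3 / 4 < s → deriv χ s = 0 := by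
    intro s hs
    have : χ =ᶠ[𝓝 s] fun _ => 0 := by
      filter_upwards [Ioi_mem_nhds hs] with t ht using h0 t (le_of_lt ht)
    rw [this.deriv_eq, deriv_const]
  have hdd1 : ∀ s, s < 9 / 16 → deriv (deriv χ) s = 0 := by
    intro s hs
    have : deriv χ =ᶠ[𝓝 s] fun _ => 0 := by
      filter_upwards [Iio_mem_nhds hs] with t ht using hd1 t ht
    rw [this.deriv_eq, deriv_const]
  have hdd2 : ∀ s, 3 / 4 < s → deriv (deriv χ) s = 0 := by
    intro s hs
    have : deriv χ =ᶠ[𝓝 s] fun _ => 0 := by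
      filter_upwards [Ioi_mem_nhds hs] with t ht using hd2 t ht
    rw [this.deriv_eq, deriv_const]
  have hcs : ∀ f : ℝ → ℝ, (∀ s, s < 9 / 16 → f s = 0) → (∀ s, 3 / 4 < s → f s = 0) →
      HasCompactSupport f := by
    intro f hf1 hf2
    refine HasCompactSupport.intro (isCompact_Icc (a := (9 / 16 : ℝ)) (b := 3 / 4)) fun s hs => ?_
    rcases lt_or_ge s (9 / 16) with h | h
    · exact hf1 s h
    · exact hf2 s (not_le.mp fun h' => hs ⟨h, h'⟩)
  obtain ⟨M₁, hM₁⟩ := (hcs _ hd1 hd2).exists_bound_of_continuous hs'.continuous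
  obtain ⟨M₂, hM₂⟩ := (hcs _ hdd1 hdd2).exists_bound_of_continuous hs''.continuous
  refine ⟨χ, max M₁ M₂, hs, (norm_nonneg _).trans ((hM₁ 0).trans (le_max_left _ _)),
    fun s => Real.smoothTransition.nonneg _, fun s => Real.smoothTransition.le_one _, h1, h0,
    fun s => ⟨(hM₁ s).trans (le_max_left _ _), (hM₂ s).trans (le_max_right _ _)⟩,
    fun s hs => ⟨hd1 s hs, hdd1 s hs⟩, fun s hs => ⟨hd2 s hs, hdd2 s hs⟩⟩

/-- A radial barrier, superharmonic up to an error of order `ρ ^ (-d)`. -/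
theorem exists_radial_barrier (hd : 2 < d) : ∃ c C : ℝ, 0 < c ∧ 0 < C ∧ ∀ ρ : ℝ, 4 ≤ ρ →
    ∃ p : ℝ → ℝ, ContDiffOn ℝ ∞ p (Ioi (-1)) ∧ (∀ s, 0 ≤ s → 0 ≤ p s) ∧
      (∀ s, 3 / 4 * ρ ^ 2 ≤ s → p s = 0) ∧
      (∀ s, 0 ≤ s → 4 * s * deriv (deriv p) s + 2 * d * deriv p s ≤ C * (ρ ^ d)⁻¹) ∧
      (∀ s, 0 ≤ s → s < 9 → 4 * s * deriv (deriv p) s + 2 * d * deriv p s ≤ - c) := by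
  obtain ⟨χ, M, hχ, hM, hχ0, hχ1, hχone, hχzero, hχM, hχl, hχr⟩ := exists_cutoff
  set β : ℝ := ((d : ℝ) - 2) / 2 with hβ
  have hd' : (2 : ℝ) < d := by exact_mod_cast hd
  have hβ0 : 0 < β := by rw [hβ]; linarith
  -- The barrier `(1 + |x|²) ^ (-β)` with `β = (d - 2) / 2` has Laplacian `-d (d - 2) (1 + |x|²) ^
  -- (-β - 2)`; the constant `c` is its absolute value at `|x|² = 9`. The other constant collects
  -- the terms in which a derivative falls on the cutoff.
  refine ⟨d * (d - 2) * (10 : ℝ) ^ (-β - 2), 2 ^ (d - 2) * (8 * β + 4 + 2 * d) * M + 1,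
    by have : (0 : ℝ) < d - 2 := by linarith
       positivity, by positivity, ?_⟩
  intro ρ hρ
  have hρ0 : 0 < ρ := by linarith
  set p : ℝ → ℝ := fun s => (1 + s) ^ (-β) * χ (ρ⁻¹ ^ 2 * s) with hp
  have hm : ∀ γ : ℝ, ∀ s ∈ Ioi (-1 : ℝ),
      HasDerivAt (fun s : ℝ => (1 + s) ^ γ) (γ * (1 + s) ^ (γ - 1)) s := by
    intro γ s hs
    have hs' : -1 < s := hs
    have := ((hasDerivAt_id s).const_add 1).rpow_const (p := γ)
      (Or.inl (by simp only [id]; linarith : 1 + id s ≠ 0))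
    simpa using this
  have hc : ∀ s, HasDerivAt (fun s => χ (ρ⁻¹ ^ 2 * s)) (ρ⁻¹ ^ 2 * deriv χ (ρ⁻¹ ^ 2 * s)) s := by
    intro s
    have h1 := (hχ.differentiable (by simp) (ρ⁻¹ ^ 2 * s)).hasDerivAt
    have h2 := h1.comp s ((hasDerivAt_id s).const_mul (ρ⁻¹ ^ 2))
    simp only [mul_one] at h2
    rw [mul_comm]
    exact h2
  have hχ' : ContDiff ℝ ∞ (deriv χ) := (contDiff_infty_iff_deriv.mp hχ).2
  have hc' : ∀ s, HasDerivAt (fun s => ρ⁻¹ ^ 2 * deriv χ (ρ⁻¹ ^ 2 * s))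
      (ρ⁻¹ ^ 2 * (ρ⁻¹ ^ 2 * deriv (deriv χ) (ρ⁻¹ ^ 2 * s))) s := by
    intro s
    have h1 := (hχ'.differentiable (by simp) (ρ⁻¹ ^ 2 * s)).hasDerivAt
    have h2 := (h1.comp s ((hasDerivAt_id s).const_mul (ρ⁻¹ ^ 2))).const_mul (ρ⁻¹ ^ 2)
    simp only [mul_one] at h2
    rw [mul_comm (ρ⁻¹ ^ 2) (deriv (deriv χ) _)]
    exact h2
  have hp1 : ∀ s ∈ Ioi (-1 : ℝ), HasDerivAt p (-β * (1 + s) ^ (-β - 1) * χ (ρ⁻¹ ^ 2 * s) +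
      (1 + s) ^ (-β) * (ρ⁻¹ ^ 2 * deriv χ (ρ⁻¹ ^ 2 * s))) s :=
    fun s hs => (hm _ s hs).mul (hc s)
  have hp2 : ∀ s ∈ Ioi (-1 : ℝ), HasDerivAt (deriv p)
      (((-β) * ((-β - 1) * (1 + s) ^ (-β - 1 - 1)) * χ (ρ⁻¹ ^ 2 * s) +
        -β * (1 + s) ^ (-β - 1) * (ρ⁻¹ ^ 2 * deriv χ (ρ⁻¹ ^ 2 * s))) +
      (-β * (1 + s) ^ (-β - 1) * (ρ⁻¹ ^ 2 * deriv χ (ρ⁻¹ ^ 2 * s)) +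
        (1 + s) ^ (-β) * (ρ⁻¹ ^ 2 * (ρ⁻¹ ^ 2 * deriv (deriv χ) (ρ⁻¹ ^ 2 * s))))) s := by
    intro s hs
    have h1 := (((hm (-β - 1) s hs).const_mul (-β)).mul (hc s)).add ((hm (-β) s hs).mul (hc' s))
    refine h1.congr_of_eventuallyEq ?_
    filter_upwards [Ioi_mem_nhds hs] with t ht
    exact (hp1 t ht).deriv
  have key : ∀ s, 0 ≤ s → 4 * s * deriv (deriv p) s + 2 * d * deriv p s =
      -(d * (d - 2) * (1 + s) ^ (-β - 2)) * χ (ρ⁻¹ ^ 2 * s) +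
      (1 + s) ^ (-β) * (ρ⁻¹ ^ 2 * ((-8 * β * (s / (1 + s)) + 2 * d) * deriv χ (ρ⁻¹ ^ 2 * s) +
        4 * (ρ⁻¹ ^ 2 * s) * deriv (deriv χ) (ρ⁻¹ ^ 2 * s))) := by
    intro s hs
    have hs1 : s ∈ Ioi (-1 : ℝ) := by
      rw [mem_Ioi]
      linarith
    have h1s : 0 < 1 + s := by linarith
    rw [(hp1 s hs1).deriv, (hp2 s hs1).deriv]
    have r1 : (1 + s) ^ (-β - 1) = (1 + s) ^ (-β) * (1 + s)⁻¹ := by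
      rw [Real.rpow_sub_one h1s.ne', div_eq_mul_inv]
    have r2 : (1 + s) ^ (-β - 1 - 1) = (1 + s) ^ (-β) * (1 + s)⁻¹ * (1 + s)⁻¹ := by
      rw [Real.rpow_sub_one h1s.ne', r1, div_eq_mul_inv]
    have r3 : -β - 2 = -β - 1 - 1 := by ring
    rw [r3, r2, r1]
    have hd2 : (d : ℝ) = 2 * β + 2 := by rw [hβ]; ring
    rw [hd2]
    field_simp
    ring
  refine ⟨p, ?_, ?_, ?_, ?_, ?_⟩
  · refine ContDiffOn.mul ?_ (hχ.comp (contDiff_const.mul contDiff_id)).contDiffOn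
    refine ContDiffOn.rpow_const_of_ne (contDiffOn_const.add contDiffOn_id) fun s hs => ?_
    have hs' : -1 < s := hs
    linarith
  · intro s hs
    exact mul_nonneg (Real.rpow_nonneg (by linarith) _) (hχ0 _)
  · intro s hs
    rw [hp]
    simp only
    rw [hχzero, mul_zero]
    rw [inv_pow, inv_mul_eq_div, le_div_iff₀ (by positivity)]
    linarith
  · intro s hs
    rw [key s hs]
    have h1s : 0 < 1 + s := by linarith
    have hfirst : -(d * (d - 2) * (1 + s) ^ (-β - 2)) * χ (ρ⁻¹ ^ 2 * s) ≤ 0 := by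
      have : (0 : ℝ) ≤ d - 2 := by linarith
      have := hχ0 (ρ⁻¹ ^ 2 * s)
      rw [neg_mul]
      exact neg_nonpos.mpr (by positivity)
    set σ := ρ⁻¹ ^ 2 * s with hσ
    have hσs : s = ρ ^ 2 * σ := by rw [hσ]; field_simp
    rcases lt_or_ge σ (9 / 16) with h | h
    · rw [(hχl σ h).1, (hχl σ h).2]
      simp only [mul_zero, add_zero]
      exact hfirst.trans (by positivity)
    rcases lt_or_ge (3 / 4) σ with h' | h'
    · rw [(hχr σ h').1, (hχr σ h').2]
      simp only [mul_zero, add_zero]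
      exact hfirst.trans (by positivity)
    -- Where the cutoff varies, `|x| ≥ ρ / 2`, so the barrier is of order `ρ ^ (-(d - 2))`; the two
    -- derivatives contribute the missing `ρ ^ (-2)`.
    have hb1 : (1 + s) ^ (-β) ≤ 2 ^ (d - 2) * (ρ ^ (d - 2))⁻¹ := by
      have e1 : ((ρ / 2) ^ 2) ≤ 1 + s := by
        rw [hσs]
        nlinarith [sq_nonneg ρ]
      have e2 : (1 + s) ^ (-β) ≤ ((ρ / 2) ^ 2) ^ (-β) :=
        Real.rpow_le_rpow_of_nonpos (by positivity) e1 (by linarith)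
      have e3 : ((ρ / 2) ^ 2) ^ (-β) = 2 ^ (d - 2) * (ρ ^ (d - 2))⁻¹ := by
        rw [← Real.rpow_natCast (ρ / 2) 2, ← Real.rpow_mul (by positivity)]
        have : ((2 : ℕ) : ℝ) * -β = -((d - 2 : ℕ) : ℝ) := by
          rw [Nat.cast_sub hd.le, hβ]
          push_cast
          ring
        rw [this, Real.rpow_neg (by positivity), Real.rpow_natCast, div_pow, inv_div,
          div_eq_mul_inv]
      exact e2.trans_eq e3
    have hfr : 0 ≤ s / (1 + s) ∧ s / (1 + s) ≤ 1 :=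
      ⟨by positivity, by rw [div_le_one h1s]; linarith⟩
    have hb2 : (-8 * β * (s / (1 + s)) + 2 * d) * deriv χ σ + 4 * σ * deriv (deriv χ) σ ≤
        (8 * β + 4 + 2 * d) * M := by
      have a1 : |-8 * β * (s / (1 + s)) + 2 * d| ≤ 8 * β + 2 * d := by
        rw [abs_le]
        constructor <;> nlinarith [hfr.1, hfr.2]
      have a2 : (-8 * β * (s / (1 + s)) + 2 * d) * deriv χ σ ≤ (8 * β + 2 * d) * M := by
        refine (le_abs_self _).trans ?_
        rw [abs_mul]
        exact mul_le_mul a1 (hχM σ).1 (abs_nonneg _) (by positivity)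
      have a3 : 4 * σ * deriv (deriv χ) σ ≤ 4 * M := by
        refine (le_abs_self _).trans ?_
        rw [abs_mul, abs_of_nonneg (by linarith : 0 ≤ 4 * σ)]
        have := (hχM σ).2
        nlinarith [abs_nonneg (deriv (deriv χ) σ)]
      linarith
    have hpow : (ρ ^ (d - 2))⁻¹ * ρ⁻¹ ^ 2 = (ρ ^ d)⁻¹ := by
      rw [inv_pow, ← mul_inv, ← pow_add, Nat.sub_add_cancel hd.le]
    have hr0 : 0 ≤ (1 + s) ^ (-β) := Real.rpow_nonneg h1s.le _
    calc _ ≤ 0 + (2 ^ (d - 2) * (ρ ^ (d - 2))⁻¹) * (ρ⁻¹ ^ 2 * ((8 * β + 4 + 2 * d) * M)) := by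
          refine add_le_add hfirst ?_
          refine (mul_le_mul_of_nonneg_left (mul_le_mul_of_nonneg_left hb2 (by positivity))
            hr0).trans ?_
          exact mul_le_mul_of_nonneg_right hb1 (by positivity)
      _ = 2 ^ (d - 2) * (8 * β + 4 + 2 * d) * M * (ρ ^ d)⁻¹ := by
          rw [← hpow]
          ring
      _ ≤ _ := by
          refine mul_le_mul_of_nonneg_right (by linarith) (by positivity)
  · intro s hs hs9
    have hσ : ρ⁻¹ ^ 2 * s < 9 / 16 := by
      rw [inv_pow, inv_mul_eq_div, div_lt_iff₀ (by positivity)]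
      nlinarith
    rw [key s hs, (hχl _ hσ).1, (hχl _ hσ).2, hχone _ hσ.le]
    simp only [mul_zero, add_zero, mul_one]
    have : (10 : ℝ) ^ (-β - 2) ≤ (1 + s) ^ (-β - 2) :=
      Real.rpow_le_rpow_of_nonpos (by linarith) (by linarith) (by linarith)
    have h2 : (0 : ℝ) < d * (d - 2) := mul_pos (by linarith) (by linarith)
    nlinarith

/-- The mass of a solution with zero trace near the unit sphere. -/
theorem exists_interior_decay (hd : 2 < d) : ∃ C : ℝ, 0 < C ∧ ∀ {ρ T : ℝ}, 4 ≤ ρ → 0 < T →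
    ∀ {w : Euc d → ℝ} {W : Euc d → Euc d}, ZeroTraceSol ρ T w W →
      ∫ x in ball (0 : Euc d) 3, w x ^ 2 ≤ C * (ρ ^ d)⁻¹ * ∫ x, w x ^ 2 := by
  obtain ⟨c, C, hc, hC, h⟩ := exists_radial_barrier hd
  refine ⟨C / c, by positivity, ?_⟩
  intro ρ T hρ hT w W hw
  obtain ⟨p, hp, hp0, hpb, hp1, hp2⟩ := h ρ hρ
  obtain ⟨hi, hsub⟩ := hw.radial_subharmonic (by linarith) hT hp hp0 (b := 3 / 4 * ρ ^ 2)
    (by nlinarith) hpb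
  have hiw : Integrable (fun x => w x ^ 2) volume := by
    have := MemLp.integrable_sq_norm hw.memLp
    simpa only [Real.norm_eq_abs, sq_abs] using this
  have hind : Integrable ((ball (0 : Euc d) 3).indicator fun x => c * w x ^ 2) volume :=
    (integrable_indicator_iff measurableSet_ball).mpr (hiw.const_mul c).integrableOn
  -- Pointwise, the Laplacian of the barrier plus `c` on `B^3` is at most `C ρ ^ (-d)`. After
  -- multiplication by `w²` and integration, subharmonicity removes the Laplacian term.
  have hmono := integral_mono (hi.add hind) ((hiw.const_mul (C * (ρ ^ d)⁻¹))) fun x => ?_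
  · have e1 := integral_add hi hind
    have hmono' := e1.symm.trans_le hmono
    rw [integral_indicator measurableSet_ball, integral_const_mul, integral_const_mul] at hmono'
    rw [div_mul_eq_mul_div, div_mul_eq_mul_div, le_div_iff₀ hc]
    linarith
  · simp only [Pi.add_apply]
    have hs : (0 : ℝ) ≤ ‖x‖ ^ 2 := by positivity
    have hw2 : 0 ≤ w x ^ 2 := sq_nonneg _
    by_cases hx : x ∈ ball (0 : Euc d) 3
    · rw [indicator_of_mem hx]
      rw [mem_ball_zero_iff] at hx
      have h9 : ‖x‖ ^ 2 < 9 := by nlinarith [norm_nonneg x]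
      have h1 := mul_le_mul_of_nonneg_left (hp2 _ hs h9) hw2
      have h2 : 0 ≤ C * (ρ ^ d)⁻¹ * w x ^ 2 := by positivity
      linarith
    · rw [indicator_of_notMem hx, add_zero, mul_comm (C * (ρ ^ d)⁻¹)]
      exact mul_le_mul_of_nonneg_left (hp1 _ hs) hw2

end Decay

/-! ### Plane rotations, their generators, and weak differentiation along them -/

section Rotations

open Filter Topology

variable {d : ℕ}

theorem measurePreserving_isometry (R : Euc d ≃ₗᵢ[ℝ] Euc d) {Ω : Set (Euc d)}
    (hΩ : MeasurableSet Ω) (hR : ∀ x, R x ∈ Ω ↔ x ∈ Ω) :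
    MeasurePreserving R (volume.restrict Ω) (volume.restrict Ω) := by
  have h := R.measurePreserving.restrict_preimage hΩ
  have : R ⁻¹' Ω = Ω := by
    ext x
    exact hR x
  rwa [this] at h

theorem setIntegral_comp_isometry {F : Type*} [NormedAddCommGroup F] [NormedSpace ℝ F]
    (R : Euc d ≃ₗᵢ[ℝ] Euc d) {Ω : Set (Euc d)} (hΩ : MeasurableSet Ω)
    (hR : ∀ x, R x ∈ Ω ↔ x ∈ Ω) (f : Euc d → F) : ∫ x in Ω, f (R x) = ∫ x in Ω, f x :=
  (measurePreserving_isometry R hΩ hR).integral_comp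
    R.toHomeomorph.measurableEmbedding f

/-- `b` and `c` are orthonormal. -/
structure OrthoPair (b c : Euc d) : Prop where
  norm_left : ‖b‖ = 1
  norm_right : ‖c‖ = 1
  inner_eq : inner ℝ b c = 0

namespace OrthoPair

variable {b c : Euc d}

/-- The generator of the rotations in the plane spanned by `b` and `c`. -/
noncomputable def generator (b c : Euc d) : Euc d →ₗ[ℝ] Euc d where
  toFun x := inner ℝ b x • c - inner ℝ c x • b
  map_add' x y := by
    simp only [inner_add_right]
    module
  map_smul' r x := by
    simp only [inner_smul_right, RingHom.id_apply]
    module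

theorem generator_apply (b c x : Euc d) :
    generator b c x = inner ℝ b x • c - inner ℝ c x • b := rfl

/-- The rotation by the angle `t` in the plane spanned by `b` and `c`, as a linear map. -/
noncomputable def rotLin (b c : Euc d) (t : ℝ) : Euc d →ₗ[ℝ] Euc d where
  toFun x := x + (Real.cos t - 1) • (inner ℝ b x • b + inner ℝ c x • c) +
    Real.sin t • (inner ℝ b x • c - inner ℝ c x • b)
  map_add' x y := by
    simp only [inner_add_right]
    module
  map_smul' r x := by
    simp only [inner_smul_right, RingHom.id_apply]
    module

theorem rotLin_apply (b c : Euc d) (t : ℝ) (x : Euc d) :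
    rotLin b c t x = x + (Real.cos t - 1) • (inner ℝ b x • b + inner ℝ c x • c) +
      Real.sin t • (inner ℝ b x • c - inner ℝ c x • b) := rfl

theorem inner_left_self (h : OrthoPair b c) : inner ℝ b b = (1 : ℝ) := by
  rw [real_inner_self_eq_norm_sq, h.norm_left, one_pow]

theorem inner_right_self (h : OrthoPair b c) : inner ℝ c c = (1 : ℝ) := by
  rw [real_inner_self_eq_norm_sq, h.norm_right, one_pow]

theorem inner_eq' (h : OrthoPair b c) : inner ℝ c b = (0 : ℝ) := by
  rw [real_inner_comm, h.inner_eq]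

theorem inner_left_rotLin (h : OrthoPair b c) (t : ℝ) (x : Euc d) :
    inner ℝ b (rotLin b c t x) = Real.cos t * inner ℝ b x - Real.sin t * inner ℝ c x := by
  simp only [rotLin_apply, inner_add_right, inner_sub_right, inner_smul_right, h.inner_left_self,
    h.inner_eq]
  ring

theorem inner_right_rotLin (h : OrthoPair b c) (t : ℝ) (x : Euc d) :
    inner ℝ c (rotLin b c t x) = Real.cos t * inner ℝ c x + Real.sin t * inner ℝ b x := by
  simp only [rotLin_apply, inner_add_right, inner_sub_right, inner_smul_right, h.inner_right_self,
    h.inner_eq']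
  ring

/-- The one-parameter group law; it supplies the inverse needed to make the rotation an equivalence.
-/
theorem rotLin_rotLin (h : OrthoPair b c) (s t : ℝ) (x : Euc d) :
    rotLin b c s (rotLin b c t x) = rotLin b c (s + t) x := by
  rw [rotLin_apply b c s, h.inner_left_rotLin, h.inner_right_rotLin, rotLin_apply, rotLin_apply,
    Real.cos_add, Real.sin_add]
  module

theorem inner_rotLin_self (h : OrthoPair b c) (t : ℝ) (x : Euc d) :
    inner ℝ (rotLin b c t x) (rotLin b c t x) = inner ℝ x x := by
  simp only [rotLin_apply, inner_add_left, inner_add_right, inner_sub_left, inner_sub_right,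
    inner_smul_left, inner_smul_right, h.inner_left_self, h.inner_right_self, h.inner_eq,
    h.inner_eq', real_inner_comm b x, real_inner_comm c x, conj_trivial]
  linear_combination ((inner ℝ b x) ^ 2 + (inner ℝ c x) ^ 2) * Real.sin_sq_add_cos_sq t

/-- The rotation by the angle `t` in the plane spanned by `b` and `c`. -/
noncomputable def rot (h : OrthoPair b c) (t : ℝ) : Euc d ≃ₗᵢ[ℝ] Euc d where
  toLinearEquiv := LinearEquiv.ofLinearMap (rotLin b c t) (rotLin b c (-t))
    (by
      ext1 x
      simp only [LinearMap.comp_apply, h.rotLin_rotLin, add_neg_cancel]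
      simp [rotLin_apply])
    (by
      ext1 x
      simp only [LinearMap.comp_apply, h.rotLin_rotLin, neg_add_cancel]
      simp [rotLin_apply])
  norm_map' x := by
    have := h.inner_rotLin_self t x
    rw [real_inner_self_eq_norm_sq, real_inner_self_eq_norm_sq] at this
    exact (sq_eq_sq₀ (norm_nonneg _) (norm_nonneg _)).mp this

theorem rot_apply (h : OrthoPair b c) (t : ℝ) (x : Euc d) : h.rot t x =
    x + (Real.cos t - 1) • (inner ℝ b x • b + inner ℝ c x • c) +
      Real.sin t • (inner ℝ b x • c - inner ℝ c x • b) := rfl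

theorem rot_symm (h : OrthoPair b c) (t : ℝ) : (h.rot t).symm = h.rot (-t) := by
  ext1 x
  rfl

theorem rot_zero (h : OrthoPair b c) (x : Euc d) : h.rot 0 x = x := by
  simp [rot_apply]

theorem hasDerivAt_rot (h : OrthoPair b c) (t : ℝ) (x : Euc d) :
    HasDerivAt (fun s => h.rot s x) (generator b c (h.rot t x)) t := by
  have h1 := ((((Real.hasDerivAt_cos t).sub_const 1).smul_const
    (inner ℝ b x • b + inner ℝ c x • c)).const_add x).add
    ((Real.hasDerivAt_sin t).smul_const (inner ℝ b x • c - inner ℝ c x • b))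
  refine HasDerivAt.congr_deriv h1 ?_
  rw [generator_apply]
  have e1 := h.inner_left_rotLin t x
  have e2 := h.inner_right_rotLin t x
  change inner ℝ b (h.rot t x) = _ at e1
  change inner ℝ c (h.rot t x) = _ at e2
  rw [e1, e2]
  module

/-- A flow commutes with its generator; this makes the generator field equivariant when a rotation
is moved from one factor of an integral to another. -/
theorem generator_rot (h : OrthoPair b c) (t : ℝ) (x : Euc d) :
    generator b c (h.rot t x) = h.rot t (generator b c x) := by
  have e1 := h.inner_left_rotLin t x
  have e2 := h.inner_right_rotLin t x
  change inner ℝ b (h.rot t x) = _ at e1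
  change inner ℝ c (h.rot t x) = _ at e2
  rw [rot_apply h t (generator b c x), generator_apply, generator_apply, e1, e2]
  simp only [inner_sub_right, inner_smul_right, h.inner_left_self, h.inner_right_self, h.inner_eq,
    h.inner_eq']
  module

theorem inner_generator (b c x y : Euc d) : inner ℝ y (generator b c x) =
    inner ℝ b x * inner ℝ c y - inner ℝ c x * inner ℝ b y := by
  rw [generator_apply, inner_sub_right, inner_smul_right, inner_smul_right, real_inner_comm y b,
    real_inner_comm y c]

theorem norm_generator_le (h : OrthoPair b c) (x : Euc d) : ‖generator b c x‖ ≤ 2 * ‖x‖ := by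
  rw [generator_apply]
  have h1 : |inner ℝ b x| ≤ ‖x‖ := by simpa [h.norm_left] using abs_real_inner_le_norm b x
  have h2 : |inner ℝ c x| ≤ ‖x‖ := by simpa [h.norm_right] using abs_real_inner_le_norm c x
  refine (norm_sub_le _ _).trans ?_
  rw [norm_smul, norm_smul, h.norm_left, h.norm_right, Real.norm_eq_abs, Real.norm_eq_abs]
  linarith

theorem continuous_generator (b c : Euc d) : Continuous (generator b c) :=
  (generator b c).continuous_of_finiteDimensional

end OrthoPair

/-- Weak differentiation along the generator of a rotation. -/
theorem integral_mul_inner_generator {Ω : Set (Euc d)} {w : Euc d → ℝ} {W : Euc d → Euc d}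
    (hw : MemLp w 2 (volume.restrict Ω)) (hW : MemLp W 2 (volume.restrict Ω))
    (hweak : ∀ φ, IsTestFunction Ω φ →
      ∫ x in Ω, w x • gradient φ x = - ∫ x in Ω, φ x • W x)
    {b c : Euc d} (h : OrthoPair b c) {ψ : Euc d → ℝ} (hψ : IsTestFunction Ω ψ) :
    ∫ x in Ω, w x * inner ℝ (gradient ψ x) (OrthoPair.generator b c x) =
      - ∫ x in Ω, ψ x * inner ℝ (W x) (OrthoPair.generator b c x) := by
  -- The field `x ↦ (y · x) z` is divergence free exactly because `y ⟂ z`; the generator is a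
  -- difference of two such fields, so integration by parts leaves no zero-order term.
  have key : ∀ y z : Euc d, inner ℝ y z = (0 : ℝ) →
      Integrable (fun x => w x * (inner ℝ y x * inner ℝ z (gradient ψ x))) (volume.restrict Ω) ∧
      Integrable (fun x => ψ x * (inner ℝ y x * inner ℝ z (W x))) (volume.restrict Ω) ∧
      ∫ x in Ω, w x * (inner ℝ y x * inner ℝ z (gradient ψ x)) =
        - ∫ x in Ω, ψ x * (inner ℝ y x * inner ℝ z (W x)) := by
    intro y z hyz
    have hl : ContDiff ℝ ∞ (fun x : Euc d => inner ℝ y x) := contDiff_const.inner ℝ contDiff_id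
    have ht : IsTestFunction Ω (fun x => ψ x * inner ℝ y x) := hψ.mul_smooth hl
    have hgl : ∀ x, gradient (fun x : Euc d => inner ℝ y x) x = y := fun x =>
      gradient_eq_of_hasFDerivAt (innerSL ℝ y).hasFDerivAt fun _ => rfl
    have hg : ∀ x, inner ℝ z (gradient (fun x => ψ x * inner ℝ y x) x) =
        inner ℝ y x * inner ℝ z (gradient ψ x) := by
      intro x
      rw [gradient_mul hψ.smooth hl, hgl, inner_add_right, inner_smul_right, inner_smul_right,
        real_inner_comm y z, hyz, mul_zero, zero_add]
    have i1 : Integrable (fun x => w x • gradient (fun x => ψ x * inner ℝ y x) x)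
        (volume.restrict Ω) := memLp_one_iff_integrable.mp ((ht.gradient_memLp 2).smul hw)
    have i2 : Integrable (fun x => (ψ x * inner ℝ y x) • W x) (volume.restrict Ω) :=
      memLp_one_iff_integrable.mp (hW.smul (ht.memLp 2))
    have j1 := i1.const_inner (𝕜 := ℝ) z
    have j2 := i2.const_inner (𝕜 := ℝ) z
    have e1 := integral_inner (𝕜 := ℝ) i1 z
    have e2 := integral_inner (𝕜 := ℝ) i2 z
    rw [hweak _ ht, inner_neg_right, ← e2] at e1
    simp only [inner_smul_right, hg] at e1 j1 j2
    simp only [mul_assoc] at e1 j2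
    exact ⟨j1, j2, e1⟩
  obtain ⟨a1, a2, a3⟩ := key b c h.inner_eq
  obtain ⟨b1, b2, b3⟩ := key c b h.inner_eq'
  simp only [OrthoPair.inner_generator, mul_sub]
  rw [integral_sub a1 b1, integral_sub a2 b2, a3, b3]
  ring

/-- The `L²` modulus of continuity of an `H¹` function along a group of rotations. -/
theorem integral_sq_comp_rot_sub_le {Ω : Set (Euc d)} (hΩ : IsOpen Ω) {r : ℝ}
    (hr : ∀ x ∈ Ω, ‖x‖ ≤ r) (hinv : ∀ (R : Euc d ≃ₗᵢ[ℝ] Euc d) x, R x ∈ Ω ↔ x ∈ Ω)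
    {w : Euc d → ℝ} {W : Euc d → Euc d}
    (hw : MemLp w 2 (volume.restrict Ω)) (hW : MemLp W 2 (volume.restrict Ω))
    (hweak : ∀ φ, IsTestFunction Ω φ →
      ∫ x in Ω, w x • gradient φ x = - ∫ x in Ω, φ x • W x)
    {b c : Euc d} (h : OrthoPair b c) (t : ℝ) :
    ∫ x in Ω, (w (h.rot t x) - w x) ^ 2 ≤ (2 * r * |t|) ^ 2 * ∫ x in Ω, ‖W x‖ ^ 2 := by
  by_cases hne : Ω.Nonempty
  swap
  · rw [not_nonempty_iff_eq_empty] at hne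
    simp [hne]
  have hr0 : 0 ≤ r := by
    obtain ⟨x, hx⟩ := hne
    exact (norm_nonneg x).trans (hr x hx)
  have hfin : IsFiniteMeasure (volume.restrict Ω) := by
    refine isFiniteMeasure_restrict.mpr (ne_of_lt ?_)
    refine (measure_mono (t := closedBall (0 : Euc d) r) fun x hx => ?_).trans_lt
      (isCompact_closedBall _ _).measure_lt_top
    rw [mem_closedBall_zero_iff]
    exact hr x hx
  have hwi : Integrable w (volume.restrict Ω) := hw.integrable (by norm_num)
  have hwR : MemLp (fun x => w (h.rot t x)) 2 (volume.restrict Ω) :=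
    hw.comp_measurePreserving (measurePreserving_isometry _ hΩ.measurableSet (hinv _))
  have hdiff : MemLp (fun x => w (h.rot t x) - w x) 2 (volume.restrict Ω) := hwR.sub hw
  have hM : 0 ≤ 2 * r * |t| * Real.sqrt (∫ x in Ω, ‖W x‖ ^ 2) := by positivity
  -- The bound is proved by duality, so that only smooth functions are differentiated along the
  -- rotation.
  have hmain := integral_sq_le_of_test hΩ hdiff hM fun φ hφ => ?_
  · rwa [mul_pow, Real.sq_sqrt (integral_nonneg fun x => by positivity)] at hmain
  obtain ⟨C, hC0, hC⟩ := hφ.exists_bound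
  -- The rotation is carried by the test function; the derivative in `s` is then moved back to `w`,
  -- and the mean value inequality bounds `I t - I 0`.
  set I : ℝ → ℝ := fun s => ∫ x in Ω, w x * φ (h.rot (-s) x) with hI
  have hcr : ∀ s, IsTestFunction Ω (fun x => φ (h.rot s x)) := fun s =>
    hφ.comp_isometry _ fun x hx => (hinv _ x).mp hx
  have hderiv : ∀ s, HasDerivAt I
      (∫ x in Ω, w x * -inner ℝ (gradient φ (h.rot (-s) x))
        (OrthoPair.generator b c (h.rot (-s) x))) s := by
    intro s
    refine (hasDerivAt_integral_of_dominated_loc_of_deriv_le (F := fun s x => w x * φ (h.rot (-s) x))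
      (F' := fun s x => w x * -inner ℝ (gradient φ (h.rot (-s) x))
        (OrthoPair.generator b c (h.rot (-s) x)))
      (bound := fun x => |w x| * (C * (2 * r))) (s := univ) Filter.univ_mem ?_ ?_ ?_ ?_ ?_ ?_).2
    · exact Eventually.of_forall fun s => hw.1.mul (hcr _).smooth.continuous.aestronglyMeasurable
    · exact hw.integrable_mul ((hcr _).memLp 2)
    · refine hw.1.mul (Continuous.aestronglyMeasurable ?_)
      exact ((hφ.continuous_gradient.comp (h.rot _).continuous).inner
        ((OrthoPair.continuous_generator b c).comp (h.rot _).continuous)).neg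
    · refine (ae_restrict_mem hΩ.measurableSet).mono fun x hx s _ => ?_
      rw [norm_mul, norm_neg, Real.norm_eq_abs]
      refine mul_le_mul_of_nonneg_left ?_ (abs_nonneg _)
      refine (norm_inner_le_norm _ _).trans (mul_le_mul (hC _).2 ?_ (norm_nonneg _) hC0)
      refine (h.norm_generator_le _).trans ?_
      rw [LinearIsometryEquiv.norm_map]
      have := hr x hx
      linarith
    · exact hwi.abs.mul_const _
    · refine Eventually.of_forall fun x s _ => HasDerivAt.const_mul _ ?_
      have h1 := (h.hasDerivAt_rot (-s) x).scomp s (hasDerivAt_neg s)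
      have h2 := (hasFDerivAt_of_contDiff hφ.smooth (h.rot (-s) x)).comp_hasDerivAt s h1
      refine h2.congr_deriv ?_
      rw [neg_smul, one_smul, map_neg, inner_gradient_left]
  have hbound : ∀ s, |∫ x in Ω, w x * -inner ℝ (gradient φ (h.rot (-s) x))
        (OrthoPair.generator b c (h.rot (-s) x))| ≤
      2 * r * Real.sqrt (∫ x in Ω, ‖W x‖ ^ 2) * Real.sqrt (∫ x in Ω, φ x ^ 2) := by
    intro s
    have e1 : ∀ x, inner ℝ (gradient φ (h.rot (-s) x)) (OrthoPair.generator b c (h.rot (-s) x)) =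
        inner ℝ (gradient (fun x => φ (h.rot (-s) x)) x) (OrthoPair.generator b c x) := by
      intro x
      rw [gradient_comp_isometry hφ.smooth, h.generator_rot,
        ← (h.rot (-s)).inner_map_map ((h.rot (-s)).symm _), LinearIsometryEquiv.apply_symm_apply]
    simp only [e1, mul_neg, integral_neg]
    rw [abs_neg, integral_mul_inner_generator hw hW hweak h (hcr (-s)), abs_neg]
    have hJ : MemLp (fun x => inner ℝ (W x) (OrthoPair.generator b c x)) 2
        (volume.restrict Ω) := by
      refine (hW.norm.const_mul (2 * r)).mono (hW.1.inner
        (OrthoPair.continuous_generator b c).aestronglyMeasurable) ?_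
      refine (ae_restrict_mem hΩ.measurableSet).mono fun x hx => ?_
      rw [norm_mul, norm_norm, Real.norm_of_nonneg (by positivity : 0 ≤ 2 * r), mul_comm]
      refine (norm_inner_le_norm _ _).trans (mul_le_mul_of_nonneg_left ?_ (norm_nonneg _))
      have := hr x hx
      exact (h.norm_generator_le x).trans (by linarith)
    refine (abs_integral_mul_le ((hcr (-s)).memLp 2) hJ).trans ?_
    rw [setIntegral_comp_isometry (h.rot (-s)) hΩ.measurableSet (hinv _) (fun x => φ x ^ 2),
      mul_comm]
    refine mul_le_mul_of_nonneg_right ?_ (Real.sqrt_nonneg _)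
    rw [Real.sqrt_le_left (by positivity), mul_pow,
      Real.sq_sqrt (integral_nonneg fun x => by positivity), ← integral_const_mul]
    refine integral_mono_ae ?_ ((MemLp.integrable_sq_norm hW).const_mul _) ?_
    · have := MemLp.integrable_sq_norm hJ
      simpa only [Real.norm_eq_abs, sq_abs] using this
    · refine (ae_restrict_mem hΩ.measurableSet).mono fun x hx => ?_
      have h1 : |inner ℝ (W x) (OrthoPair.generator b c x)| ≤ 2 * r * ‖W x‖ := by
        refine (abs_real_inner_le_norm _ _).trans ?_
        rw [mul_comm]
        refine mul_le_mul_of_nonneg_right ?_ (norm_nonneg _)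
        have := hr x hx
        exact (h.norm_generator_le x).trans (by linarith)
      calc inner ℝ (W x) (OrthoPair.generator b c x) ^ 2
          = |inner ℝ (W x) (OrthoPair.generator b c x)| ^ 2 := (sq_abs _).symm
        _ ≤ (2 * r * ‖W x‖) ^ 2 := by gcongr
        _ = _ := by ring
  have hmv := Convex.norm_image_sub_le_of_norm_hasDerivWithin_le (s := univ) (x := 0) (y := t)
    (fun s _ => (hderiv s).hasDerivWithinAt) (fun s _ => hbound s) convex_univ trivial trivial
  have e2 : I t - I 0 = ∫ x in Ω, (w (h.rot t x) - w x) * φ x := by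
    have e3 : I t = ∫ x in Ω, w (h.rot t x) * φ x := by
      simp only [hI]
      rw [← setIntegral_comp_isometry (h.rot t) hΩ.measurableSet (hinv _)]
      simp only [← h.rot_symm, LinearIsometryEquiv.symm_apply_apply]
    have e4 : I 0 = ∫ x in Ω, w x * φ x := by
      simp only [hI, neg_zero, h.rot_zero]
    have i1 : Integrable (fun x => w (h.rot t x) * φ x) (volume.restrict Ω) :=
      hwR.integrable_mul (hφ.memLp 2)
    have i2 : Integrable (fun x => w x * φ x) (volume.restrict Ω) :=
      hw.integrable_mul (hφ.memLp 2)
    rw [e3, e4, ← integral_sub i1 i2]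
    simp only [sub_mul]
  rw [e2, Real.norm_eq_abs, sub_zero, Real.norm_eq_abs] at hmv
  refine hmv.trans_eq ?_
  ring

end Rotations

/-! ### Solutions on the annulus, their rotations, and the transfer of the interior estimates -/

section AnnulusSolutions

open Filter Topology
open scoped Pointwise

variable {d : ℕ}

/-- The action of a linear isometry on the unit sphere. -/
noncomputable def sphereMap (R : Euc d ≃ₗᵢ[ℝ] Euc d) (y : sphere (0 : Euc d) 1) :
    sphere (0 : Euc d) 1 :=
  ⟨R y, by simp⟩

theorem continuous_sphereMap (R : Euc d ≃ₗᵢ[ℝ] Euc d) : Continuous (sphereMap R) :=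
  Continuous.subtype_mk (R.continuous.comp continuous_subtype_val) _

theorem sphereMap_symm_apply (R : Euc d ≃ₗᵢ[ℝ] Euc d) (y : sphere (0 : Euc d) 1) :
    sphereMap R.symm (sphereMap R y) = y := by
  ext1
  simp [sphereMap]

theorem sphereMap_apply_symm (R : Euc d ≃ₗᵢ[ℝ] Euc d) (y : sphere (0 : Euc d) 1) :
    sphereMap R (sphereMap R.symm y) = y := by
  ext1
  simp [sphereMap]

/-- The action of a linear isometry on the unit sphere, as a homeomorphism. -/
noncomputable def sphereHomeo (R : Euc d ≃ₗᵢ[ℝ] Euc d) :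
    sphere (0 : Euc d) 1 ≃ₜ sphere (0 : Euc d) 1 where
  toFun := sphereMap R
  invFun := sphereMap R.symm
  left_inv := sphereMap_symm_apply R
  right_inv := sphereMap_apply_symm R
  continuous_toFun := continuous_sphereMap R
  continuous_invFun := continuous_sphereMap R.symm

/-- The surface measure is defined through the volume of the cones over subsets of the sphere, and a
linear isometry maps cones to cones of equal volume. -/
theorem measurePreserving_sphereMap (R : Euc d ≃ₗᵢ[ℝ] Euc d) :
    MeasurePreserving (sphereMap R) (surfaceMeasure d) (surfaceMeasure d) := by
  refine ⟨(continuous_sphereMap R).measurable, ?_⟩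
  ext s hs
  rw [Measure.map_apply (continuous_sphereMap R).measurable hs, surfaceMeasure,
    Measure.toSphere_apply' _ hs,
    Measure.toSphere_apply' _ ((continuous_sphereMap R).measurable hs)]
  congr 1
  have : Ioo (0 : ℝ) 1 • ((↑) '' (sphereMap R ⁻¹' s) : Set (Euc d)) =
      R ⁻¹' (Ioo (0 : ℝ) 1 • ((↑) '' s)) := by
    ext x
    simp only [Set.mem_smul, mem_image, mem_preimage]
    constructor
    · rintro ⟨r, hr, _, ⟨y, hy, rfl⟩, rfl⟩
      exact ⟨r, hr, _, ⟨sphereMap R y, hy, rfl⟩, by simp [sphereMap]⟩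
    · rintro ⟨r, hr, _, ⟨y, hy, rfl⟩, hx⟩
      refine ⟨r, hr, _, ⟨sphereMap R.symm y, ?_, rfl⟩, ?_⟩
      · rwa [sphereMap_apply_symm]
      · apply R.injective
        rw [← hx]
        simp [sphereMap]
  rw [this]
  exact R.measurePreserving.measure_preimage_equiv (f := R.toMeasurableEquiv) _

instance : IsFiniteMeasure (surfaceMeasure d) :=
  inferInstanceAs (IsFiniteMeasure (volume : Measure (Euc d)).toSphere)

theorem integral_comp_sphereMap {F : Type*} [NormedAddCommGroup F] [NormedSpace ℝ F]
    (R : Euc d ≃ₗᵢ[ℝ] Euc d) (f : sphere (0 : Euc d) 1 → F) :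
    ∫ y, f (sphereMap R y) ∂(surfaceMeasure d) = ∫ y, f y ∂(surfaceMeasure d) :=
  (measurePreserving_sphereMap R).integral_comp (sphereHomeo R).measurableEmbedding f

theorem isometry_mem_annulus {ρ : ℝ} (R : Euc d ≃ₗᵢ[ℝ] Euc d) (x : Euc d) :
    R x ∈ annulus d ρ ↔ x ∈ annulus d ρ := by
  rw [mem_annulus, mem_annulus, R.norm_map]

theorem isometry_mem_ball {ρ : ℝ} (R : Euc d ≃ₗᵢ[ℝ] Euc d) (x : Euc d) :
    R x ∈ ball (0 : Euc d) ρ ↔ x ∈ ball (0 : Euc d) ρ := by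
  rw [mem_ball_zero_iff, mem_ball_zero_iff, R.norm_map]

theorem annulus_subset_ball (d : ℕ) (ρ : ℝ) : annulus d ρ ⊆ ball 0 ρ := sdiff_subset

theorem annulus_mono {r ρ : ℝ} (h : r ≤ ρ) : annulus d r ⊆ annulus d ρ :=
  sdiff_subset_sdiff_left (ball_subset_ball h)

/-- A weak solution of `v / T - Δ v = g` on the annulus with weak gradient `G`, whose trace on the
unit sphere is the constant `b`. -/
structure AnnulusSol (ρ T b g : ℝ) (v : Euc d → ℝ) (G : Euc d → Euc d) : Prop where
  memLp : MemLp v 2 (volume.restrict (annulus d ρ))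
  gradient_memLp : MemLp G 2 (volume.restrict (annulus d ρ))
  trace : ∀ φ, IsTestFunction (ball 0 ρ) φ →
    (∫ x in annulus d ρ, (v x • gradient φ x + φ x • G x)) =
      - ∫ y, (b * φ (y : Euc d)) • (y : Euc d) ∂(surfaceMeasure d)
  weak_eq : ∀ φ, IsTestFunction (annulus d ρ) φ →
    (∫ x in annulus d ρ, (1 / T * v x * φ x + inner ℝ (G x) (gradient φ x))) =
      ∫ x in annulus d ρ, g * φ x

/-- The gradient of the composition of a function with a linear isometry. -/
noncomputable def pullGrad (R : Euc d ≃ₗᵢ[ℝ] Euc d) (G : Euc d → Euc d) (x : Euc d) : Euc d :=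
  R.symm (G (R x))

theorem gradient_comp_symm {φ : Euc d → ℝ} (hφ : ContDiff ℝ ∞ φ) (R : Euc d ≃ₗᵢ[ℝ] Euc d)
    (x : Euc d) : R.symm (gradient (fun y => φ (R.symm y)) (R x)) = gradient φ x := by
  rw [gradient_comp_isometry hφ]
  simp

theorem memLp_pullGrad {Ω : Set (Euc d)} (hΩ : MeasurableSet Ω) {G : Euc d → Euc d}
    (hG : MemLp G 2 (volume.restrict Ω)) (R : Euc d ≃ₗᵢ[ℝ] Euc d)
    (hR : ∀ x, R x ∈ Ω ↔ x ∈ Ω) : MemLp (pullGrad R G) 2 (volume.restrict Ω) :=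
  (hG.comp_measurePreserving (measurePreserving_isometry R hΩ hR)).of_le
    (R.symm.continuous.comp_aestronglyMeasurable
      (hG.comp_measurePreserving (measurePreserving_isometry R hΩ hR)).1)
    (Eventually.of_forall fun x => by simp [pullGrad])

namespace AnnulusSol

variable {ρ T b b' g g' : ℝ} {v v' : Euc d → ℝ} {G G' : Euc d → Euc d}

/-- Test with `φ ∘ R⁻¹` and change variables. The boundary datum and the right-hand side are
constants, so rotation leaves them unchanged. -/
theorem comp_isometry (h : AnnulusSol ρ T b g v G) (R : Euc d ≃ₗᵢ[ℝ] Euc d) :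
    AnnulusSol ρ T b g (fun x => v (R x)) (pullGrad R G) := by
  have hA := (isOpen_annulus d ρ).measurableSet
  have hR := isometry_mem_annulus (ρ := ρ) R
  refine ⟨h.memLp.comp_measurePreserving (measurePreserving_isometry R hA hR),
    memLp_pullGrad hA h.gradient_memLp R hR, ?_, ?_⟩
  · intro φ hφ
    have hφ' : IsTestFunction (ball 0 ρ) (fun x => φ (R.symm x)) :=
      hφ.comp_isometry _ fun x hx => (isometry_mem_ball R.symm x).mp hx
    have h1 := congrArg R.symm (h.trace _ hφ')
    rw [← setIntegral_comp_isometry R hA hR] at h1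
    rw [← integral_comp_sphereMap R, map_neg] at h1
    have e1 := R.symm.toLinearIsometry.toContinuousLinearMap.integral_comp_comm
      (μ := volume.restrict (annulus d ρ)) (φ := fun x => v (R x) •
        gradient (fun x => φ (R.symm x)) (R x) + φ (R.symm (R x)) • G (R x)) ?_
    · have e2 := R.symm.toLinearIsometry.toContinuousLinearMap.integral_comp_comm
        (μ := surfaceMeasure d) (φ := fun y => (b * φ (R.symm (sphereMap R y : Euc d))) •
          (sphereMap R y : Euc d)) ?_
      · have h2 := e1.trans (h1.trans (congrArg Neg.neg e2.symm))
        refine (integral_congr_ae (Eventually.of_forall fun x => ?_)).trans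
          (h2.trans (congrArg Neg.neg (integral_congr_ae (Eventually.of_forall fun y => ?_))))
        · change _ = R.symm _
          rw [map_add, map_smul, map_smul, gradient_comp_symm hφ.smooth, R.symm_apply_apply]
          rfl
        · change R.symm ((b * φ (R.symm (R (y : Euc d)))) • R (y : Euc d)) = _
          rw [map_smul, R.symm_apply_apply]
      · refine Continuous.integrable_of_hasCompactSupport ?_ (HasCompactSupport.of_compactSpace _)
        have hc : Continuous fun y => (sphereMap R y : Euc d) :=
          continuous_subtype_val.comp (continuous_sphereMap R)
        exact (continuous_const.mul (hφ'.smooth.continuous.comp hc)).smul hc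
    · have j1 : MemLp (fun x => v (R x)) 2 (volume.restrict (annulus d ρ)) :=
        h.memLp.comp_measurePreserving (measurePreserving_isometry R hA hR)
      have j2 : MemLp (fun x => G (R x)) 2 (volume.restrict (annulus d ρ)) :=
        h.gradient_memLp.comp_measurePreserving (measurePreserving_isometry R hA hR)
      have j3 : MemLp (fun x => gradient (fun x => φ (R.symm x)) (R x)) 2
          (volume.restrict (annulus d ρ)) :=
        (hφ'.gradient_memLp 2).comp_measurePreserving (measurePreserving_isometry R hA hR)
      have j4 : MemLp (fun x => φ (R.symm (R x))) 2 (volume.restrict (annulus d ρ)) := by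
        simpa using hφ.memLp 2
      exact (memLp_one_iff_integrable.mp (j3.smul j1)).add
        (memLp_one_iff_integrable.mp (j2.smul j4))
  · intro φ hφ
    have hφ' : IsTestFunction (annulus d ρ) (fun x => φ (R.symm x)) :=
      hφ.comp_isometry _ fun x hx => (isometry_mem_annulus R.symm x).mp hx
    have h1 := h.weak_eq _ hφ'
    rw [← setIntegral_comp_isometry R hA hR,
      ← setIntegral_comp_isometry R hA hR (fun x => g * φ (R.symm x))] at h1
    simp only [LinearIsometryEquiv.symm_apply_apply] at h1
    rw [← h1]
    congr 1
    ext1 x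
    rw [← gradient_comp_symm hφ.smooth R, pullGrad, R.symm.inner_map_map]

theorem integrable_trace (h : AnnulusSol ρ T b g v G) {Ω : Set (Euc d)} {φ : Euc d → ℝ}
    (hφ : IsTestFunction Ω φ) :
    Integrable (fun x => v x • gradient φ x + φ x • G x) (volume.restrict (annulus d ρ)) :=
  (memLp_one_iff_integrable.mp ((hφ.gradient_memLp 2).smul h.memLp)).add
    (memLp_one_iff_integrable.mp (h.gradient_memLp.smul (hφ.memLp 2)))

theorem integrable_weak (h : AnnulusSol ρ T b g v G) {Ω : Set (Euc d)} {φ : Euc d → ℝ}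
    (hφ : IsTestFunction Ω φ) :
    Integrable (fun x => 1 / T * v x * φ x + inner ℝ (G x) (gradient φ x))
      (volume.restrict (annulus d ρ)) :=
  ((h.memLp.const_mul (1 / T)).integrable_mul (hφ.memLp 2)).add
    (MemLp.integrable_inner' h.gradient_memLp (hφ.gradient_memLp 2))

theorem sub (h : AnnulusSol ρ T b g v G) (h' : AnnulusSol ρ T b' g' v' G') :
    AnnulusSol ρ T (b - b') (g - g') (fun x => v x - v' x) (fun x => G x - G' x) := by
  refine ⟨h.memLp.sub h'.memLp, h.gradient_memLp.sub h'.gradient_memLp, ?_, ?_⟩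
  · intro φ hφ
    have e1 := integral_sub (h.integrable_trace hφ) (h'.integrable_trace hφ)
    rw [h.trace φ hφ, h'.trace φ hφ, neg_sub_neg, ← neg_sub, ← integral_sub] at e1
    · refine (integral_congr_ae (Eventually.of_forall fun x => ?_)).trans
        (e1.trans (congrArg Neg.neg (integral_congr_ae (Eventually.of_forall fun y => ?_))))
      · module
      · module
    all_goals
      refine Continuous.integrable_of_hasCompactSupport ?_ (HasCompactSupport.of_compactSpace _)
      exact (continuous_const.mul (hφ.smooth.continuous.comp continuous_subtype_val)).smul
        continuous_subtype_val
  · intro φ hφ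
    have e1 := integral_sub (h.integrable_weak hφ) (h'.integrable_weak hφ)
    rw [h.weak_eq φ hφ, h'.weak_eq φ hφ, ← integral_sub] at e1
    · convert e1 using 2
      · ext1 x
        rw [inner_sub_left]
        ring
      · ext1 x
        ring
    all_goals exact memLp_one_iff_integrable.mp ((hφ.memLp 1).const_mul _)

/-- With zero trace the boundary term in Green's formula disappears, so extension by zero keeps its
weak gradient across the unit sphere. -/
theorem toZeroTraceSol (h : AnnulusSol ρ T 0 0 v G) :
    ZeroTraceSol ρ T ((annulus d ρ).indicator v) ((annulus d ρ).indicator G) := by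
  have hA := (isOpen_annulus d ρ).measurableSet
  refine ⟨(memLp_indicator_iff_restrict hA).mpr h.memLp,
    (memLp_indicator_iff_restrict hA).mpr h.gradient_memLp,
    fun x hx => indicator_of_notMem hx _, ?_, ?_⟩
  · intro φ hφ
    have i1 : Integrable (fun x => v x • gradient φ x) (volume.restrict (annulus d ρ)) :=
      memLp_one_iff_integrable.mp ((hφ.gradient_memLp 2).smul h.memLp)
    have i2 : Integrable (fun x => φ x • G x) (volume.restrict (annulus d ρ)) :=
      memLp_one_iff_integrable.mp (h.gradient_memLp.smul (hφ.memLp 2))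
    have h1 := h.trace φ hφ
    rw [integral_add i1 i2] at h1
    simp only [zero_mul, zero_smul, integral_zero, neg_zero] at h1
    rw [add_eq_zero_iff_eq_neg, ← integral_indicator hA, ← integral_indicator hA] at h1
    refine (integral_congr_ae (Eventually.of_forall fun x => ?_)).trans
      (h1.trans (congrArg Neg.neg (integral_congr_ae (Eventually.of_forall fun x => ?_))))
    all_goals by_cases hx : x ∈ annulus d ρ <;> simp [hx]
  · intro φ hφ
    have h1 := h.weak_eq φ hφ
    simp only [zero_mul, integral_zero] at h1
    rw [← integral_indicator hA] at h1
    rw [← h1]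
    congr 1
    ext1 x
    by_cases hx : x ∈ annulus d ρ <;> simp [hx, add_comm]

/-- The key cancellation: both data are the same for the solution and its rotation, so the
difference is homogeneous with zero trace and every interior estimate applies to it. -/
theorem rotation_difference (h : AnnulusSol ρ T b g v G) (R : Euc d ≃ₗᵢ[ℝ] Euc d) :
    AnnulusSol ρ T 0 0 (fun x => v (R x) - v x) (fun x => pullGrad R G x - G x) := by
  simpa using (h.comp_isometry R).sub h

/-- Test functions of the open annulus vanish on the unit sphere, so the trace term drops out of
Green's formula. -/
theorem weak_gradient_annulus (h : AnnulusSol ρ T b g v G) {r : ℝ} (hr : r ≤ ρ) {φ : Euc d → ℝ}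
    (hφ : IsTestFunction (annulus d r) φ) :
    ∫ x in annulus d r, v x • gradient φ x = - ∫ x in annulus d r, φ x • G x := by
  have hφ' : IsTestFunction (annulus d ρ) φ := hφ.mono (annulus_mono hr)
  have h1 := h.trace φ (hφ'.mono (annulus_subset_ball d ρ))
  have h2 : ∀ y : sphere (0 : Euc d) 1, φ (y : Euc d) = 0 := fun y => hφ.eq_zero fun hy => by
    rw [mem_annulus] at hy
    simp at hy
  have i1 : Integrable (fun x => v x • gradient φ x) (volume.restrict (annulus d ρ)) :=
    memLp_one_iff_integrable.mp ((hφ.gradient_memLp 2).smul h.memLp)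
  have i2 : Integrable (fun x => φ x • G x) (volume.restrict (annulus d ρ)) :=
    memLp_one_iff_integrable.mp (h.gradient_memLp.smul (hφ.memLp 2))
  simp only [h2, mul_zero, zero_smul, integral_zero, neg_zero] at h1
  rw [integral_add i1 i2, add_eq_zero_iff_eq_neg] at h1
  rw [setIntegral_eq_of_subset_of_forall_sdiff_eq_zero (isOpen_annulus d ρ).measurableSet
    (annulus_mono hr) fun x hx => by rw [hφ.gradient_eq_zero hx.2, smul_zero],
    setIntegral_eq_of_subset_of_forall_sdiff_eq_zero (isOpen_annulus d ρ).measurableSet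
    (annulus_mono hr) fun x hx => by rw [hφ.eq_zero hx.2, zero_smul]] at h1
  exact h1

theorem integral_sq_rot_sub_le (h : AnnulusSol ρ T b g v G) {r : ℝ} (hr : r ≤ ρ) {e f : Euc d}
    (hef : OrthoPair e f) (t : ℝ) :
    ∫ x in annulus d r, (v (hef.rot t x) - v x) ^ 2 ≤
      (2 * r * |t|) ^ 2 * ∫ x in annulus d r, ‖G x‖ ^ 2 := by
  have hle : volume.restrict (annulus d r) ≤ volume.restrict (annulus d ρ) :=
    Measure.restrict_mono (annulus_mono hr) le_rfl
  exact integral_sq_comp_rot_sub_le (isOpen_annulus d r) (fun x hx => (mem_annulus.mp hx).1.le)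
    isometry_mem_annulus (h.memLp.mono_measure hle) (h.gradient_memLp.mono_measure hle)
    (fun φ hφ => h.weak_gradient_annulus hr hφ) hef t

end AnnulusSol

theorem setIntegral_ball_indicator {r ρ : ℝ} (hr : r ≤ ρ) {F : Type*} [NormedAddCommGroup F]
    (f : Euc d → F) : ∫ x in ball (0 : Euc d) r, ‖(annulus d ρ).indicator f x‖ ^ 2 =
      ∫ x in annulus d r, ‖f x‖ ^ 2 := by
  rw [← integral_indicator measurableSet_ball,
    ← integral_indicator (isOpen_annulus d r).measurableSet]
  congr 1
  ext1 x
  by_cases hx : x ∈ annulus d r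
  · rw [indicator_of_mem hx, indicator_of_mem (annulus_subset_ball d r hx),
      indicator_of_mem (annulus_mono hr hx)]
  · rw [indicator_of_notMem hx]
    by_cases hb : x ∈ ball (0 : Euc d) r
    · have : x ∉ annulus d ρ := fun hx' => hx ⟨hb, hx'.2⟩
      rw [indicator_of_mem hb, indicator_of_notMem this]
      simp
    · rw [indicator_of_notMem hb]

/-- Caccioppoli's inequality on annuli. -/
theorem exists_caccioppoli_annulus (d : ℕ) {r R : ℝ} (hr : 0 < r) (hrR : r < R) :
    ∃ C : ℝ, 0 < C ∧ ∀ {ρ T : ℝ}, R < ρ → 0 < T → ∀ {w : Euc d → ℝ} {W : Euc d → Euc d},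
      AnnulusSol ρ T 0 0 w W →
      ∫ x in annulus d r, ‖W x‖ ^ 2 ≤ C * ∫ x in annulus d R, w x ^ 2 := by
  obtain ⟨C, hC, h⟩ := exists_caccioppoli d hr hrR
  refine ⟨C, hC, ?_⟩
  intro ρ T hρ hT w W hw
  have h1 := h hρ hT hw.toZeroTraceSol
  have e1 := setIntegral_ball_indicator (d := d) (hrR.trans hρ).le W
  have e2 := setIntegral_ball_indicator (d := d) hρ.le w
  simp only [Real.norm_eq_abs, sq_abs] at e2
  rwa [e1, e2] at h1

theorem exists_annulus_decay (hd : 2 < d) : ∃ C : ℝ, 0 < C ∧ ∀ {ρ T : ℝ}, 4 ≤ ρ → 0 < T →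
    ∀ {w : Euc d → ℝ} {W : Euc d → Euc d}, AnnulusSol ρ T 0 0 w W →
      ∫ x in annulus d 3, w x ^ 2 ≤ C * (ρ ^ d)⁻¹ * ∫ x in annulus d ρ, w x ^ 2 := by
  obtain ⟨C, hC, h⟩ := exists_interior_decay hd
  refine ⟨C, hC, ?_⟩
  intro ρ T hρ hT w W hw
  have h1 := h hρ hT hw.toZeroTraceSol
  have e2 := setIntegral_ball_indicator (d := d) (by linarith : (3 : ℝ) ≤ ρ) w
  simp only [Real.norm_eq_abs, sq_abs] at e2
  rw [e2] at h1
  convert h1 using 2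
  rw [← integral_indicator (isOpen_annulus d ρ).measurableSet]
  congr 1
  ext1 x
  by_cases hx : x ∈ annulus d ρ <;> simp [hx]

end AnnulusSolutions

/-! ### The boundary functional and tangential integration by parts -/

section TraceFunctional

open Filter Topology

variable {d : ℕ}

theorem isFiniteMeasure_annulus (d : ℕ) (ρ : ℝ) :
    IsFiniteMeasure (volume.restrict (annulus d ρ)) :=
  isFiniteMeasure_restrict.mpr (ne_of_lt ((measure_mono (annulus_subset_ball d ρ)).trans_lt
    measure_ball_lt_top))

/-- The boundary functional of a vector field vanishes on test functions which vanish on the unit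
sphere. -/
theorem integral_eq_zero_of_eq_zero_on_sphere {ρ : ℝ} {G : Euc d → Euc d} {F : Euc d → ℝ}
    (hG : MemLp G 2 (volume.restrict (annulus d ρ)))
    (hF : MemLp F 2 (volume.restrict (annulus d ρ)))
    (hweak : ∀ φ, IsTestFunction (annulus d ρ) φ →
      ∫ x in annulus d ρ, (inner ℝ (G x) (gradient φ x) + φ x * F x) = 0)
    {θ : Euc d → ℝ} (hθ : IsTestFunction (ball 0 ρ) θ) (hθ0 : ∀ x : Euc d, ‖x‖ = 1 → θ x = 0) :
    ∫ x in annulus d ρ, (inner ℝ (G x) (gradient θ x) + θ x * F x) = 0 := by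
  have := isFiniteMeasure_annulus d ρ
  have hGi : Integrable G (volume.restrict (annulus d ρ)) := hG.integrable (by norm_num)
  have hFi : Integrable F (volume.restrict (annulus d ρ)) := hF.integrable (by norm_num)
  set k : ℝ → ℝ := fun s => Real.smoothTransition (s - 1) with hk
  have hks : ContDiff ℝ ∞ k := Real.smoothTransition.contDiff.comp (contDiff_id.sub contDiff_const)
  have hk0 : ∀ s, s ≤ 1 → k s = 0 := fun s hs =>
    Real.smoothTransition.zero_of_nonpos (by linarith)
  have hk1 : ∀ s, 2 ≤ s → k s = 1 := fun s hs => Real.smoothTransition.one_of_one_le (by linarith)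
  have hkd0 : ∀ s, s < 1 → deriv k s = 0 := by
    intro s hs
    have : k =ᶠ[𝓝 s] fun _ => 0 := by
      filter_upwards [Iio_mem_nhds hs] with t ht using hk0 t (le_of_lt ht)
    rw [this.deriv_eq, deriv_const]
  have hkd1 : ∀ s, 2 < s → deriv k s = 0 := by
    intro s hs
    have : k =ᶠ[𝓝 s] fun _ => 1 := by
      filter_upwards [Ioi_mem_nhds hs] with t ht using hk1 t (le_of_lt ht)
    rw [this.deriv_eq, deriv_const]
  obtain ⟨K, hK⟩ : ∃ K, ∀ s, ‖deriv k s‖ ≤ K := by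
    refine HasCompactSupport.exists_bound_of_continuous
      (HasCompactSupport.intro (isCompact_Icc (a := (1 : ℝ)) (b := 2)) fun s hs => ?_)
      (contDiff_infty_iff_deriv.mp hks).2.continuous
    rcases lt_or_ge s 1 with h | h
    · exact hkd0 s h
    · exact hkd1 s (not_le.mp fun h' => hs ⟨h, h'⟩)
  have hK0 : 0 ≤ K := (norm_nonneg _).trans (hK 0)
  obtain ⟨C, hC0, hC⟩ := hθ.exists_bound
  -- Since `θ` vanishes on the sphere, it is at most a multiple of the distance to it; this
  -- compensates for the growing gradients of the cutoffs `κ n`.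
  have hlip : ∀ x : Euc d, 1 < ‖x‖ → |θ x| ≤ C * (‖x‖ - 1) := by
    intro x hx
    have h0 : 0 < ‖x‖ := by linarith
    have hn : ‖‖x‖⁻¹ • x‖ = 1 := by
      rw [norm_smul, norm_inv, norm_norm, inv_mul_cancel₀ h0.ne']
    have h1 := Convex.norm_image_sub_le_of_norm_hasFDerivWithin_le (s := univ) (C := C)
      (x := ‖x‖⁻¹ • x) (y := x)
      (fun z _ => (hasFDerivAt_of_contDiff hθ.smooth z).hasFDerivWithinAt) (fun z _ => by
        refine ContinuousLinearMap.opNorm_le_bound _ hC0 fun y => ?_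
        rw [← inner_gradient_left]
        exact (norm_inner_le_norm _ _).trans
          (mul_le_mul_of_nonneg_right (hC z).2 (norm_nonneg _)))
      convex_univ trivial trivial
    rw [hθ0 _ hn, sub_zero, Real.norm_eq_abs] at h1
    have h2 : ‖x - ‖x‖⁻¹ • x‖ = ‖x‖ - 1 := by
      have : x - ‖x‖⁻¹ • x = (1 - ‖x‖⁻¹) • x := by module
      rw [this, norm_smul, Real.norm_of_nonneg]
      · field_simp
      · rw [sub_nonneg]
        exact inv_le_one_of_one_le₀ hx.le
    rwa [h2] at h1
  set κ : ℕ → Euc d → ℝ := fun n x => k ((n + 1) * (‖x‖ ^ 2 - 1)) with hκ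
  have hκs : ∀ n, ContDiff ℝ ∞ (κ n) := fun n =>
    hks.comp (contDiff_const.mul ((contDiff_norm_sq ℝ).sub contDiff_const))
  have hκg : ∀ n x, gradient (κ n) x =
      (2 * ((n + 1) * deriv k ((n + 1) * (‖x‖ ^ 2 - 1)))) • x := by
    intro n x
    have h1 := (hks.differentiable (by simp) ((n + 1) * (‖x‖ ^ 2 - 1))).hasDerivAt
    have h2 := h1.comp_hasFDerivAt (f := fun z : Euc d => ((n : ℝ) + 1) * (‖z‖ ^ 2 - 1)) x
      (((hasStrictFDerivAt_norm_sq x).hasFDerivAt.sub_const 1).const_mul ((n : ℝ) + 1))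
    refine gradient_eq_of_hasFDerivAt (φ := κ n) h2 fun y => ?_
    simp [inner_smul_left]
    ring
  have htest : ∀ n, IsTestFunction (annulus d ρ) (fun x => θ x * κ n x) := by
    intro n
    have ht := hθ.mul_smooth (hκs n)
    refine ⟨ht.smooth, ht.compact, fun x hx => ?_⟩
    have h1 := ht.support hx
    have h2 : tsupport (fun x => θ x * κ n x) ⊆ {x | 1 ≤ (n + 1) * (‖x‖ ^ 2 - 1)} := by
      refine closure_minimal (fun z hz => ?_) (isClosed_le continuous_const (by fun_prop))
      by_contra hlt
      apply hz
      have : κ n z = 0 := hk0 _ (not_le.mp hlt).le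
      simp [this]
    have h3 : 1 ≤ ((n : ℝ) + 1) * (‖x‖ ^ 2 - 1) := h2 hx
    rw [mem_ball_zero_iff] at h1
    rw [mem_annulus]
    refine ⟨h1, ?_⟩
    by_contra hle
    have hle' := not_lt.mp hle
    have h4 : ‖x‖ ^ 2 ≤ 1 := by nlinarith [norm_nonneg x]
    have : (0 : ℝ) ≤ (n : ℝ) + 1 := by positivity
    nlinarith
  have hlim : Tendsto (fun n => ∫ x in annulus d ρ, (inner ℝ (G x)
      (gradient (fun x => θ x * κ n x) x) + (θ x * κ n x) * F x)) atTop
      (𝓝 (∫ x in annulus d ρ, (inner ℝ (G x) (gradient θ x) + θ x * F x))) := by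
    refine tendsto_integral_of_dominated_convergence
      (fun x => ‖G x‖ * (C + 4 * C * K) + C * ‖F x‖) ?_ ?_ ?_ ?_
    · intro n
      exact (hG.1.inner (htest n).continuous_gradient.aestronglyMeasurable).add
        ((htest n).smooth.continuous.aestronglyMeasurable.mul hF.1)
    · exact (hGi.norm.mul_const _).add (hFi.norm.const_mul _)
    · intro n
      refine (ae_restrict_mem (isOpen_annulus d ρ).measurableSet).mono fun x hx => ?_
      have hx1 := (mem_annulus.mp hx).2
      have hκ01 : |κ n x| ≤ 1 := by
        rw [abs_of_nonneg (Real.smoothTransition.nonneg _)]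
        exact Real.smoothTransition.le_one _
      have hg : ‖gradient (fun x => θ x * κ n x) x‖ ≤ C + 4 * C * K := by
        rw [gradient_mul hθ.smooth (hκs n), hκg, add_comm]
        refine (norm_add_le _ _).trans (add_le_add ?_ ?_)
        · rw [norm_smul, Real.norm_eq_abs]
          calc |κ n x| * ‖gradient θ x‖ ≤ 1 * C :=
                mul_le_mul hκ01 (hC x).2 (norm_nonneg _) zero_le_one
            _ = C := one_mul C
        · by_cases hs : (2 : ℝ) < (n + 1) * (‖x‖ ^ 2 - 1)
          · rw [hkd1 _ hs]
            simp only [mul_zero, zero_smul, smul_zero, norm_zero]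
            positivity
          · rw [not_lt] at hs
            have hn : (0 : ℝ) ≤ (n : ℝ) + 1 := by positivity
            rw [norm_smul, norm_smul, norm_mul, norm_mul, Real.norm_of_nonneg hn, Real.norm_eq_abs,
              Real.norm_two]
            -- On the transition layer `(n + 1) (|x|² - 1) ≤ 2`. As `|x|² - 1 = (|x| - 1) (|x| +
            -- 1)`, the factor `n + 1` from the gradient is absorbed, uniformly in `n`.
            calc |θ x| * (2 * ((↑n + 1) * ‖deriv k ((↑n + 1) * (‖x‖ ^ 2 - 1))‖) * ‖x‖)
                ≤ (C * (‖x‖ - 1)) * (2 * ((↑n + 1) * K) * (‖x‖ + 1)) := by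
                  gcongr
                  · exact hlip x hx1
                  · exact hK _
                  · linarith
              _ = 2 * C * K * ((n + 1) * (‖x‖ ^ 2 - 1)) := by ring
              _ ≤ 2 * C * K * 2 := by gcongr
              _ = _ := by ring
      refine (norm_add_le _ _).trans (add_le_add ?_ ?_)
      · exact (norm_inner_le_norm _ _).trans (mul_le_mul_of_nonneg_left hg (norm_nonneg _))
      · rw [norm_mul]
        refine mul_le_mul_of_nonneg_right ?_ (norm_nonneg _)
        rw [norm_mul, Real.norm_eq_abs, Real.norm_eq_abs]
        calc |θ x| * |κ n x| ≤ C * 1 := mul_le_mul (hC x).1 hκ01 (abs_nonneg _) hC0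
          _ = C := mul_one C
    · refine (ae_restrict_mem (isOpen_annulus d ρ).measurableSet).mono fun x hx => ?_
      have hx1 := (mem_annulus.mp hx).2
      refine tendsto_const_nhds.congr' ?_
      have hpos : 0 < ‖x‖ ^ 2 - 1 := by nlinarith
      obtain ⟨N, hN⟩ := exists_nat_gt (2 / (‖x‖ ^ 2 - 1))
      filter_upwards [eventually_ge_atTop N] with n hn
      have hn' : (N : ℝ) ≤ n := by exact_mod_cast hn
      have h2 : 2 < ((n : ℝ) + 1) * (‖x‖ ^ 2 - 1) := by
        rw [div_lt_iff₀ hpos] at hN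
        nlinarith
      have hκ1 : κ n x = 1 := hk1 _ h2.le
      rw [gradient_mul hθ.smooth (hκs n), hκg, hkd1 _ h2, hκ1]
      simp
  refine tendsto_nhds_unique hlim ?_
  simp only [fun n => hweak _ (htest n)]
  exact tendsto_const_nhds

/-- Integration by parts along the generator of a rotation, as a bound. -/
theorem abs_integral_tangential_le {G : Euc d → Euc d}
    (hG : MemLp G 2 (volume.restrict (annulus d 2))) {b c : Euc d} (h : OrthoPair b c) {M : ℝ}
    (hM0 : 0 ≤ M)
    -- This bound on difference quotients of `G` is the quantitative form of one tangential weak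
    -- derivative of `G` in `L²`.
    (hM : ∀ t, ∫ x in annulus d 2, ‖pullGrad (h.rot t) G x - G x‖ ^ 2 ≤ (t * M) ^ 2)
    {Ω : Set (Euc d)} {Φ : Euc d → ℝ} (hΦ : IsTestFunction Ω Φ) :
    |∫ x in annulus d 2, (‖x‖ ^ 2)⁻¹ * (inner ℝ (G x) (OrthoPair.generator b c x) *
      inner ℝ (gradient Φ x) (OrthoPair.generator b c x))| ≤
      2 * M * Real.sqrt (∫ x in annulus d 2, Φ x ^ 2) := by
  have hA := (isOpen_annulus d 2).measurableSet
  have hfin := isFiniteMeasure_annulus d 2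
  have hinv : ∀ t x, h.rot t x ∈ annulus d 2 ↔ x ∈ annulus d 2 := fun t x =>
    isometry_mem_annulus _ x
  set Y : Euc d → Euc d := fun x => (‖x‖ ^ 2)⁻¹ • OrthoPair.generator b c x with hY
  have hYm : Measurable Y :=
    ((continuous_norm.pow 2).measurable.inv).smul (OrthoPair.continuous_generator b c).measurable
  have hYb : ∀ x ∈ annulus d 2, ‖Y x‖ ≤ 2 := by
    intro x hx
    have hx1 := (mem_annulus.mp hx).2
    rw [hY]
    simp only
    rw [norm_smul, norm_inv, norm_pow, norm_norm, inv_mul_le_iff₀ (by positivity)]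
    have := h.norm_generator_le x
    nlinarith
  have hH : ∀ {V : Euc d → Euc d}, MemLp V 2 (volume.restrict (annulus d 2)) →
      MemLp (fun x => inner ℝ (V x) (Y x)) 2 (volume.restrict (annulus d 2)) := by
    intro V hV
    refine (hV.norm.const_mul 2).mono (hV.1.inner hYm.aestronglyMeasurable) ?_
    refine (ae_restrict_mem hA).mono fun x hx => ?_
    rw [norm_mul, norm_norm, Real.norm_two, mul_comm]
    exact (norm_inner_le_norm _ _).trans
      (mul_le_mul_of_nonneg_left (hYb x hx) (norm_nonneg _))
  have hHi : Integrable (fun x => inner ℝ (G x) (Y x)) (volume.restrict (annulus d 2)) :=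
    (hH hG).integrable (by norm_num)
  obtain ⟨C, hC0, hC⟩ := hΦ.exists_bound
  have hΦr : ∀ t, IsTestFunction univ (fun x => Φ (h.rot t x)) := fun t =>
    (hΦ.mono (subset_univ _)).comp_isometry _ fun _ _ => trivial
  -- The integral to be bounded is `D' (0)`. It therefore suffices to show that `D` is Lipschitz at
  -- `0`.
  set D : ℝ → ℝ := fun t => ∫ x in annulus d 2, inner ℝ (G x) (Y x) * Φ (h.rot t x) with hD
  have hderiv : HasDerivAt D (∫ x in annulus d 2, inner ℝ (G x) (Y x) *
      inner ℝ (gradient Φ (h.rot 0 x)) (OrthoPair.generator b c (h.rot 0 x))) 0 := by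
    refine (hasDerivAt_integral_of_dominated_loc_of_deriv_le
      (F := fun t x => inner ℝ (G x) (Y x) * Φ (h.rot t x))
      (F' := fun t x => inner ℝ (G x) (Y x) * inner ℝ (gradient Φ (h.rot t x))
        (OrthoPair.generator b c (h.rot t x)))
      (bound := fun x => |inner ℝ (G x) (Y x)| * (C * 4)) (s := univ)
      Filter.univ_mem ?_ ?_ ?_ ?_ ?_ ?_).2
    · exact Eventually.of_forall fun t =>
        hHi.1.mul (hΦr t).smooth.continuous.aestronglyMeasurable
    · exact (hH hG).integrable_mul ((hΦr 0).memLp 2)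
    · refine hHi.1.mul (Continuous.aestronglyMeasurable ?_)
      exact (hΦ.continuous_gradient.comp (h.rot _).continuous).inner
        ((OrthoPair.continuous_generator b c).comp (h.rot _).continuous)
    · refine (ae_restrict_mem hA).mono fun x hx t _ => ?_
      rw [norm_mul, Real.norm_eq_abs]
      refine mul_le_mul_of_nonneg_left ?_ (abs_nonneg _)
      refine (norm_inner_le_norm _ _).trans (mul_le_mul (hC _).2 ?_ (norm_nonneg _) hC0)
      refine (h.norm_generator_le _).trans ?_
      rw [LinearIsometryEquiv.norm_map]
      have := (mem_annulus.mp hx).1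
      linarith
    · exact hHi.abs.mul_const _
    · refine Eventually.of_forall fun x t _ => HasDerivAt.const_mul _ ?_
      have h2 := (hasFDerivAt_of_contDiff hΦ.smooth (h.rot t x)).comp_hasDerivAt t
        (h.hasDerivAt_rot t x)
      refine h2.congr_deriv ?_
      rw [inner_gradient_left]
  have hlip : ∀ t, ‖D t - D 0‖ ≤
      2 * M * Real.sqrt (∫ x in annulus d 2, Φ x ^ 2) * ‖t - 0‖ := by
    intro t
    have hP : MemLp (fun x => pullGrad (h.rot (-t)) G x) 2 (volume.restrict (annulus d 2)) :=
      memLp_pullGrad hA hG _ (hinv _)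
    have hPG : MemLp (fun x => pullGrad (h.rot (-t)) G x - G x) 2
        (volume.restrict (annulus d 2)) := hP.sub hG
    -- The field `Y` is equivariant, so changing variables moves the rotation from `Φ` onto `G`,
    -- where the difference quotient is controlled.
    have e1 : D t = ∫ x in annulus d 2, inner ℝ (pullGrad (h.rot (-t)) G x) (Y x) * Φ x := by
      rw [hD]
      simp only
      rw [← setIntegral_comp_isometry (h.rot (-t)) hA (hinv _)]
      congr 1
      ext1 x
      have hxx : h.rot t (h.rot (-t) x) = x := by
        rw [← h.rot_symm, LinearIsometryEquiv.apply_symm_apply]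
      rw [hxx]
      congr 1
      simp only [hY, inner_smul_right, LinearIsometryEquiv.norm_map]
      rw [h.generator_rot, pullGrad, ← (h.rot (-t)).inner_map_map ((h.rot (-t)).symm _),
        LinearIsometryEquiv.apply_symm_apply]
    have e2 : D 0 = ∫ x in annulus d 2, inner ℝ (G x) (Y x) * Φ x := by
      simp only [hD, h.rot_zero]
    have i1 : Integrable (fun x => inner ℝ (pullGrad (h.rot (-t)) G x) (Y x) * Φ x)
        (volume.restrict (annulus d 2)) := (hH hP).integrable_mul (hΦ.memLp 2)
    have i2 : Integrable (fun x => inner ℝ (G x) (Y x) * Φ x)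
        (volume.restrict (annulus d 2)) := (hH hG).integrable_mul (hΦ.memLp 2)
    have e3 : D t - D 0 = ∫ x in annulus d 2,
        inner ℝ (pullGrad (h.rot (-t)) G x - G x) (Y x) * Φ x := by
      rw [e1, e2, ← integral_sub i1 i2]
      congr 1
      ext1 x
      rw [inner_sub_left]
      ring
    rw [e3, Real.norm_eq_abs, sub_zero]
    refine (abs_integral_mul_le (hH hPG) (hΦ.memLp 2)).trans ?_
    have h3 : Real.sqrt (∫ x in annulus d 2,
        inner ℝ (pullGrad (h.rot (-t)) G x - G x) (Y x) ^ 2) ≤ 2 * (M * |t|) := by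
      rw [Real.sqrt_le_left (by positivity)]
      calc ∫ x in annulus d 2, inner ℝ (pullGrad (h.rot (-t)) G x - G x) (Y x) ^ 2
          ≤ ∫ x in annulus d 2, 4 * ‖pullGrad (h.rot (-t)) G x - G x‖ ^ 2 := by
            refine integral_mono_ae ?_ ((MemLp.integrable_sq_norm hPG).const_mul _) ?_
            · have := MemLp.integrable_sq_norm (hH hPG)
              simpa only [Real.norm_eq_abs, sq_abs] using this
            · refine (ae_restrict_mem hA).mono fun x hx => ?_
              have h4 : |inner ℝ (pullGrad (h.rot (-t)) G x - G x) (Y x)| ≤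
                  ‖pullGrad (h.rot (-t)) G x - G x‖ * 2 :=
                (abs_real_inner_le_norm _ _).trans
                  (mul_le_mul_of_nonneg_left (hYb x hx) (norm_nonneg _))
              have h5 := pow_le_pow_left₀ (abs_nonneg _) h4 2
              rw [sq_abs] at h5
              simp only
              linarith [mul_pow ‖pullGrad (h.rot (-t)) G x - G x‖ 2 2]
        _ ≤ 4 * (-t * M) ^ 2 := by
            rw [integral_const_mul]
            exact mul_le_mul_of_nonneg_left (hM (-t)) (by norm_num)
        _ = (2 * (M * |t|)) ^ 2 := by
            rw [mul_pow, mul_pow, mul_pow, sq_abs]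
            ring
    refine (mul_le_mul_of_nonneg_right h3 (Real.sqrt_nonneg _)).trans_eq ?_
    rw [Real.norm_eq_abs]
    ring
  have hfinal := hderiv.le_of_lip' (by positivity) (Eventually.of_forall hlip)
  rw [Real.norm_eq_abs] at hfinal
  convert hfinal using 3
  ext1 x
  rw [h.rot_zero, hY]
  simp only [inner_smul_right]
  ring

/-- Lagrange's identity for the generators of the coordinate rotations. -/
theorem sum_inner_generator (u z x : Euc d) :
    ∑ i, ∑ j, inner ℝ u (OrthoPair.generator (EuclideanSpace.basisFun (Fin d) ℝ i)
        (EuclideanSpace.basisFun (Fin d) ℝ j) x) *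
      inner ℝ z (OrthoPair.generator (EuclideanSpace.basisFun (Fin d) ℝ i)
        (EuclideanSpace.basisFun (Fin d) ℝ j) x) =
      2 * (‖x‖ ^ 2 * inner ℝ u z - inner ℝ u x * inner ℝ z x) := by
  set e := EuclideanSpace.basisFun (Fin d) ℝ with he
  have h1 : ∀ a b : Euc d, ∑ i, inner ℝ (e i) a * inner ℝ (e i) b = inner ℝ a b := by
    intro a b
    rw [← e.sum_inner_mul_inner a b]
    simp only [real_inner_comm]
  simp only [OrthoPair.inner_generator]
  have h2 : ∀ i j, (inner ℝ (e i) x * inner ℝ (e j) u - inner ℝ (e j) x * inner ℝ (e i) u) *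
      (inner ℝ (e i) x * inner ℝ (e j) z - inner ℝ (e j) x * inner ℝ (e i) z) =
      (inner ℝ (e i) x * inner ℝ (e i) x) * (inner ℝ (e j) u * inner ℝ (e j) z) +
      (inner ℝ (e i) u * inner ℝ (e i) z) * (inner ℝ (e j) x * inner ℝ (e j) x) -
      (inner ℝ (e i) x * inner ℝ (e i) z) * (inner ℝ (e j) u * inner ℝ (e j) x) -
      (inner ℝ (e i) u * inner ℝ (e i) x) * (inner ℝ (e j) x * inner ℝ (e j) z) := by
    intro i j
    ring
  simp only [h2, Finset.sum_sub_distrib, Finset.sum_add_distrib, ← Finset.mul_sum,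
    ← Finset.sum_mul, h1]
  rw [real_inner_self_eq_norm_sq, real_inner_comm x z]
  ring

end TraceFunctional

/-! ### Radial extension from the sphere and the bound on the boundary functional -/

section RadialExtension

open Filter Topology

variable {d : ℕ}

/-- The extension of the restriction of `φ` to the unit sphere with radial profile `k`. -/
noncomputable def radialExt (k : ℝ → ℝ) (φ : Euc d → ℝ) (x : Euc d) : ℝ :=
  k (‖x‖ ^ 2) * φ (‖x‖⁻¹ • x)

/-- A profile supported where `1/2 ≤ |x|² ≤ 3/2` avoids the singularity of `x / |x|` at the origin
and stays inside the ball of radius `2`. -/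
theorem isTestFunction_radialExt {k : ℝ → ℝ} (hk : ContDiff ℝ ∞ k)
    (hk0 : ∀ s, s < 1 / 2 → k s = 0) (hk1 : ∀ s, 3 / 2 < s → k s = 0) {φ : Euc d → ℝ}
    (hφ : ContDiff ℝ ∞ φ) : IsTestFunction (ball 0 2) (radialExt k φ) := by
  have hsupp : tsupport (radialExt k φ) ⊆ {x | ‖x‖ ^ 2 ≤ 3 / 2} := by
    refine closure_minimal (fun z hz => ?_) (isClosed_le (by fun_prop) continuous_const)
    by_contra hlt
    exact hz (by simp [radialExt, hk1 _ (not_le.mp hlt)])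
  have hsub : {x : Euc d | ‖x‖ ^ 2 ≤ 3 / 2} ⊆ ball 0 2 := by
    intro x hx
    have hx' : ‖x‖ ^ 2 ≤ 3 / 2 := hx
    rw [mem_ball_zero_iff]
    nlinarith [norm_nonneg x]
  refine ⟨?_, ?_, hsupp.trans hsub⟩
  · rw [contDiff_iff_contDiffAt]
    intro x
    by_cases hx : x = 0
    · have : radialExt k φ =ᶠ[𝓝 x] fun _ => 0 := by
        have hc : ContinuousAt (fun z : Euc d => ‖z‖ ^ 2) x := by fun_prop
        have hx2 : ‖x‖ ^ 2 < 1 / 2 := by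
          rw [hx]
          norm_num
        filter_upwards [hc.eventually (gt_mem_nhds hx2)] with z hz
        simp [radialExt, hk0 _ hz]
      exact contDiffAt_const.congr_of_eventuallyEq this
    · have h1 : ContDiffAt ℝ ∞ (fun z : Euc d => ‖z‖⁻¹ • z) x :=
        ((contDiffAt_norm ℝ hx).inv (norm_ne_zero_iff.mpr hx)).smul contDiffAt_id
      exact ((hk.comp (contDiff_norm_sq ℝ)).contDiffAt).mul (hφ.contDiffAt.comp x h1)
  · refine (isCompact_closedBall (0 : Euc d) 2).of_isClosed_subset (isClosed_tsupport _) ?_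
    exact (hsupp.trans hsub).trans ball_subset_closedBall

/-- The factor `φ (x / |x|)` is homogeneous of degree zero, so the radial derivative falls on the
profile alone and involves no derivative of `φ`. -/
theorem inner_gradient_radialExt {k : ℝ → ℝ} (hk : ContDiff ℝ ∞ k)
    (hk0 : ∀ s, s < 1 / 2 → k s = 0) (hk1 : ∀ s, 3 / 2 < s → k s = 0) {φ : Euc d → ℝ}
    (hφ : ContDiff ℝ ∞ φ) {x : Euc d} (hx : x ≠ 0) :
    inner ℝ (gradient (radialExt k φ) x) x =
      ‖x‖ ^ 2 * (radialExt (fun s => 2 * deriv k s) φ x) := by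
  have ht := isTestFunction_radialExt hk hk0 hk1 hφ
  have h1 : HasDerivAt (fun s : ℝ => radialExt k φ (s • x))
      (inner ℝ (gradient (radialExt k φ) x) x) 1 := by
    have h2 : HasDerivAt (fun s : ℝ => s • x) ((1 : ℝ) • x) 1 :=
      (hasDerivAt_id (1 : ℝ)).smul_const x
    have h3 := (hasFDerivAt_of_contDiff ht.smooth ((1 : ℝ) • x)).comp_hasDerivAt (1 : ℝ) h2
    rw [one_smul] at h3
    rw [inner_gradient_left]
    exact h3
  have h4 : HasDerivAt (fun s : ℝ => k (s ^ 2 * ‖x‖ ^ 2) * φ (‖x‖⁻¹ • x))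
      (deriv k (‖x‖ ^ 2) * (2 * ‖x‖ ^ 2) * φ (‖x‖⁻¹ • x)) 1 := by
    have h5 : HasDerivAt (fun s : ℝ => s ^ 2 * ‖x‖ ^ 2) (2 * ‖x‖ ^ 2) 1 := by
      simpa using (hasDerivAt_pow 2 (1 : ℝ)).mul_const (‖x‖ ^ 2)
    have h6 : HasDerivAt k (deriv k (‖x‖ ^ 2)) ((1 : ℝ) ^ 2 * ‖x‖ ^ 2) := by
      rw [one_pow, one_mul]
      exact (hk.differentiable (by simp) _).hasDerivAt
    exact (h6.comp 1 h5).mul_const _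
  have h7 : (fun s : ℝ => radialExt k φ (s • x)) =ᶠ[𝓝 1]
      fun s : ℝ => k (s ^ 2 * ‖x‖ ^ 2) * φ (‖x‖⁻¹ • x) := by
    filter_upwards [Ioi_mem_nhds (show (0 : ℝ) < 1 by norm_num)] with s hs
    have hs' : 0 < s := hs
    rw [radialExt, norm_smul, Real.norm_of_nonneg hs'.le, mul_pow, smul_smul]
    congr 3
    field_simp
  rw [h1.unique (h4.congr_of_eventuallyEq h7), radialExt]
  ring

/-- Integration in polar coordinates of a product over the annulus. -/
theorem exists_integral_polar (d : ℕ) (f : ℝ → ℝ) (hf : ∀ s, 0 ≤ f s) : ∃ K : ℝ, 0 ≤ K ∧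
    ∀ φ : Euc d → ℝ, ∫ x in annulus d 2, f ‖x‖ * φ (‖x‖⁻¹ • x) ^ 2 =
      K * ∫ y, φ (y : Euc d) ^ 2 ∂(surfaceMeasure d) := by
  set g : ℝ → ℝ := (Ioo (1 : ℝ) 2).indicator f with hg
  -- The constant is the integral of `f` over `(1, 2)` against `r ^ (d - 1) dr`.
  refine ⟨∫ r : Ioi (0 : ℝ), g r ∂(Measure.volumeIoiPow (Module.finrank ℝ (Euc d) - 1)),
    integral_nonneg fun r => indicator_nonneg (fun s _ => hf s) _, fun φ => ?_⟩
  have h1 : ∫ x in annulus d 2, f ‖x‖ * φ (‖x‖⁻¹ • x) ^ 2 =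
      ∫ x in ({0}ᶜ : Set (Euc d)), g ‖x‖ * φ (‖x‖⁻¹ • x) ^ 2 := by
    rw [← integral_indicator (isOpen_annulus d 2).measurableSet,
      ← integral_indicator (measurableSet_singleton _).compl]
    congr 1
    ext1 x
    by_cases hx : x ∈ annulus d 2
    · have h2 := mem_annulus.mp hx
      have hx0 : x ∈ ({0}ᶜ : Set (Euc d)) := by
        rintro rfl
        rw [norm_zero] at h2
        linarith [h2.2]
      have h3 : ‖x‖ ∈ Ioo (1 : ℝ) 2 := ⟨h2.2, h2.1⟩
      rw [indicator_of_mem hx, indicator_of_mem hx0, hg, indicator_of_mem h3]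
    · have h3 : ‖x‖ ∉ Ioo (1 : ℝ) 2 := fun h => hx (mem_annulus.mpr ⟨h.2, h.1⟩)
      rw [indicator_of_notMem hx, hg]
      by_cases hx0 : x ∈ ({0}ᶜ : Set (Euc d))
      · rw [indicator_of_mem hx0, indicator_of_notMem h3, zero_mul]
      · rw [indicator_of_notMem hx0]
  rw [h1, ← integral_subtype_comap (measurableSet_singleton _).compl
    fun x : Euc d => g ‖x‖ * φ (‖x‖⁻¹ • x) ^ 2]
  have h2 := (volume : Measure (Euc d)).measurePreserving_homeomorphUnitSphereProd.integral_comp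
    (Homeomorph.measurableEmbedding _)
    (fun p : sphere (0 : Euc d) 1 × Ioi (0 : ℝ) => φ (p.1 : Euc d) ^ 2 * g p.2)
  rw [integral_prod_mul (fun y : sphere (0 : Euc d) 1 => φ (y : Euc d) ^ 2)
    (fun r : Ioi (0 : ℝ) => g r)] at h2
  rw [mul_comm, surfaceMeasure, ← h2]
  congr 1
  ext1 x
  simp [mul_comm]

/-- The boundary functional of a vector field with square integrable divergence is bounded in terms
of the vector field and its difference quotients along rotations. -/
theorem exists_trace_functional_bound (d : ℕ) : ∃ C : ℝ, 0 < C ∧ ∀ {ρ : ℝ}, 2 ≤ ρ →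
    ∀ {G : Euc d → Euc d} {F : Euc d → ℝ} {M : ℝ}, 0 ≤ M →
    MemLp G 2 (volume.restrict (annulus d ρ)) → MemLp F 2 (volume.restrict (annulus d ρ)) →
    (∀ φ, IsTestFunction (annulus d ρ) φ →
      ∫ x in annulus d ρ, (inner ℝ (G x) (gradient φ x) + φ x * F x) = 0) →
    ∫ x in annulus d 2, ‖G x‖ ^ 2 ≤ M ^ 2 → ∫ x in annulus d 2, F x ^ 2 ≤ M ^ 2 →
    (∀ {b c : Euc d} (h : OrthoPair b c) (t : ℝ),
      ∫ x in annulus d 2, ‖pullGrad (h.rot t) G x - G x‖ ^ 2 ≤ (t * M) ^ 2) →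
    ∀ φ, IsTestFunction (ball 0 ρ) φ →
      |∫ x in annulus d ρ, (inner ℝ (G x) (gradient φ x) + φ x * F x)| ≤
        C * M * Real.sqrt (∫ y, φ (y : Euc d) ^ 2 ∂(surfaceMeasure d)) := by
  -- The profile equals `1` at `|x|² = 1`, so the radial extension agrees with `φ` on the sphere;
  -- below, `2 η'` is the profile of its radial derivative.
  let η : ContDiffBump (1 : ℝ) := ⟨1 / 4, 1 / 2, by norm_num, by norm_num⟩
  have hη : ContDiff ℝ ∞ η := η.contDiff
  have hη1 : η 1 = 1 := η.one_of_mem_closedBall (mem_closedBall_self η.rIn_pos.le)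
  have hηz : ∀ s, (1 / 2 : ℝ) ≤ dist s 1 → η s = 0 := fun s hs => η.zero_of_le_dist hs
  have hη0 : ∀ s, s < 1 / 2 → η s = 0 := fun s hs => hηz s (by
    rw [Real.dist_eq, abs_sub_comm]
    exact le_trans (by linarith) (le_abs_self _))
  have hη2 : ∀ s, 3 / 2 < s → η s = 0 := fun s hs => hηz s (by
    rw [Real.dist_eq]
    exact le_trans (by linarith) (le_abs_self _))
  set k : ℝ → ℝ := fun s => 2 * deriv η s with hk
  have hks : ContDiff ℝ ∞ k := contDiff_const.mul (contDiff_infty_iff_deriv.mp hη).2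
  have hk0 : ∀ s, s < 1 / 2 → k s = 0 := by
    intro s hs
    have : η =ᶠ[𝓝 s] fun _ => 0 := by
      filter_upwards [Iio_mem_nhds hs] with t ht using hη0 t ht
    rw [hk]
    simp only
    rw [this.deriv_eq, deriv_const, mul_zero]
  have hk2 : ∀ s, 3 / 2 < s → k s = 0 := by
    intro s hs
    have : η =ᶠ[𝓝 s] fun _ => 0 := by
      filter_upwards [Ioi_mem_nhds hs] with t ht using hη2 t ht
    rw [hk]
    simp only
    rw [this.deriv_eq, deriv_const, mul_zero]
  obtain ⟨K₁, hK₁, hp₁⟩ := exists_integral_polar d (fun r => η (r ^ 2) ^ 2) fun _ => sq_nonneg _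
  obtain ⟨K₂, hK₂, hp₂⟩ := exists_integral_polar d (fun r => k (r ^ 2) ^ 2) fun _ => sq_nonneg _
  refine ⟨2 * Real.sqrt K₂ + (d ^ 2 + 1) * Real.sqrt K₁ + 1, by positivity, ?_⟩
  intro ρ hρ G F M hM hG hF hweak hGM hFM hrot φ hφ
  set e := EuclideanSpace.basisFun (Fin d) ℝ with he
  set Φ := radialExt (d := d) η φ with hΦ
  set Ψ := radialExt (d := d) k φ with hΨ
  have hΦt : IsTestFunction (ball 0 2) Φ := isTestFunction_radialExt hη hη0 hη2 hφ.smooth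
  have hΨt : IsTestFunction (ball 0 2) Ψ := isTestFunction_radialExt hks hk0 hk2 hφ.smooth
  set S := Real.sqrt (∫ y, φ (y : Euc d) ^ 2 ∂(surfaceMeasure d)) with hS
  have hΦn : Real.sqrt (∫ x in annulus d 2, Φ x ^ 2) = Real.sqrt K₁ * S := by
    rw [hS, ← Real.sqrt_mul hK₁, ← hp₁]
    simp only [hΦ, radialExt, mul_pow]
  have hΨn : Real.sqrt (∫ x in annulus d 2, Ψ x ^ 2) = Real.sqrt K₂ * S := by
    rw [hS, ← Real.sqrt_mul hK₂, ← hp₂]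
    simp only [hΨ, radialExt, mul_pow]
  have hA := (isOpen_annulus d 2).measurableSet
  have hle : volume.restrict (annulus d 2) ≤ volume.restrict (annulus d ρ) :=
    Measure.restrict_mono (annulus_mono hρ) le_rfl
  have hG2 := hG.mono_measure hle
  have hF2 := hF.mono_measure hle
  have hint : ∀ {Ω : Set (Euc d)} {ψ : Euc d → ℝ}, IsTestFunction Ω ψ →
      Integrable (fun x => inner ℝ (G x) (gradient ψ x) + ψ x * F x)
        (volume.restrict (annulus d ρ)) := fun {Ω ψ} hψ =>
    (MemLp.integrable_inner' hG (hψ.gradient_memLp 2)).add ((hψ.memLp 2).integrable_mul hF)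
  have hΦρ : IsTestFunction (ball 0 ρ) Φ := hΦt.mono (ball_subset_ball hρ)
  have hsub : ∫ x in annulus d ρ, (inner ℝ (G x) (gradient φ x) + φ x * F x) =
      ∫ x in annulus d ρ, (inner ℝ (G x) (gradient Φ x) + Φ x * F x) := by
    have h0 := integral_eq_zero_of_eq_zero_on_sphere hG hF hweak (hφ.sub hΦρ) ?_
    · rw [← sub_eq_zero, ← integral_sub (hint hφ) (hint hΦρ), ← h0]
      congr 1
      ext1 x
      have hgs : gradient (fun x => φ x - Φ x) x = gradient φ x - gradient Φ x :=
        gradient_eq_of_hasFDerivAt ((hasFDerivAt_of_contDiff hφ.smooth x).sub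
          (hasFDerivAt_of_contDiff hΦρ.smooth x)) fun y => by simp [inner_sub_left]
      rw [hgs, inner_sub_right]
      ring
    · intro x hx
      simp [hΦ, radialExt, hx, hη1]
  have hsub2 : ∫ x in annulus d ρ, (inner ℝ (G x) (gradient Φ x) + Φ x * F x) =
      ∫ x in annulus d 2, (inner ℝ (G x) (gradient Φ x) + Φ x * F x) :=
    setIntegral_eq_of_subset_of_forall_sdiff_eq_zero (isOpen_annulus d ρ).measurableSet
      (annulus_mono hρ) fun x hx => by
        have hx2 : x ∉ ball (0 : Euc d) 2 := fun h => hx.2 ⟨h, hx.1.2⟩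
        rw [hΦt.gradient_eq_zero hx2, hΦt.eq_zero hx2]
        simp
  set J : Fin d → Fin d → Euc d → ℝ := fun i j x => (‖x‖ ^ 2)⁻¹ *
    (inner ℝ (G x) (OrthoPair.generator (e i) (e j) x) *
      inner ℝ (gradient Φ x) (OrthoPair.generator (e i) (e j) x)) with hJ
  -- Splitting of `G · ∇Φ` into radial and tangential parts. Lagrange's identity counts each pair
  -- `i, j` twice, hence the factor `1/2`.
  have hpt : ∀ x ∈ annulus d 2, inner ℝ (G x) (gradient Φ x) + Φ x * F x =
      (inner ℝ (G x) x * Ψ x + 1 / 2 * ∑ i, ∑ j, J i j x) + Φ x * F x := by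
    intro x hx
    have hx1 := (mem_annulus.mp hx).2
    have hx0 : x ≠ 0 := by
      rintro rfl
      rw [norm_zero] at hx1
      linarith
    have h1 := sum_inner_generator (G x) (gradient Φ x) x
    have h2 := inner_gradient_radialExt hη hη0 hη2 hφ.smooth hx0
    simp only [hJ, ← Finset.mul_sum]
    rw [h1, h2]
    have hn : ‖x‖ ^ 2 ≠ 0 := by positivity
    change _ = _ * radialExt k φ x + _ + _
    field_simp
    ring
  have hfin := isFiniteMeasure_annulus d 2
  have hxG : MemLp (fun x => inner ℝ (G x) x) 2 (volume.restrict (annulus d 2)) := by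
    refine (hG2.norm.const_mul 2).mono (hG2.1.inner continuous_id.aestronglyMeasurable) ?_
    refine (ae_restrict_mem hA).mono fun x hx => ?_
    rw [norm_mul, norm_norm, Real.norm_two, mul_comm]
    exact (norm_inner_le_norm _ _).trans
      (mul_le_mul_of_nonneg_left (mem_annulus.mp hx).1.le (norm_nonneg _))
  have hGs : Real.sqrt (∫ x in annulus d 2, inner ℝ (G x) x ^ 2) ≤ 2 * M := by
    rw [Real.sqrt_le_left (by positivity)]
    calc ∫ x in annulus d 2, inner ℝ (G x) x ^ 2 ≤ ∫ x in annulus d 2, 4 * ‖G x‖ ^ 2 := by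
          refine integral_mono_ae ?_ ((MemLp.integrable_sq_norm hG2).const_mul _) ?_
          · have := MemLp.integrable_sq_norm hxG
            simpa only [Real.norm_eq_abs, sq_abs] using this
          · refine (ae_restrict_mem hA).mono fun x hx => ?_
            have h4 : |inner ℝ (G x) x| ≤ ‖G x‖ * 2 :=
              (abs_real_inner_le_norm _ _).trans
                (mul_le_mul_of_nonneg_left (mem_annulus.mp hx).1.le (norm_nonneg _))
            have h5 := pow_le_pow_left₀ (abs_nonneg _) h4 2
            rw [sq_abs] at h5
            simp only
            linarith [mul_pow ‖G x‖ 2 2]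
      _ ≤ (2 * M) ^ 2 := by
          rw [integral_const_mul, mul_pow]
          linarith
  have hJi : ∀ i j, Integrable (J i j) (volume.restrict (annulus d 2)) := by
    intro i j
    have hb : ∀ x ∈ annulus d 2, ‖(‖x‖ ^ 2)⁻¹ • OrthoPair.generator (e i) (e j) x‖ ≤ 2 := by
      intro x hx
      have hx1 := (mem_annulus.mp hx).2
      rw [norm_smul, norm_inv, norm_pow, norm_norm, inv_mul_le_iff₀ (by positivity),
        OrthoPair.generator_apply]
      have a : ∀ l, |inner ℝ (e l) x| ≤ ‖x‖ := fun l => by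
        simpa [e.orthonormal.1 l] using abs_real_inner_le_norm (e l) x
      refine (norm_sub_le _ _).trans ?_
      rw [norm_smul, norm_smul, e.orthonormal.1 i, e.orthonormal.1 j, Real.norm_eq_abs,
        Real.norm_eq_abs]
      nlinarith [a i, a j]
    have hY : MemLp (fun x => inner ℝ (G x) ((‖x‖ ^ 2)⁻¹ • OrthoPair.generator (e i) (e j) x)) 2
        (volume.restrict (annulus d 2)) := by
      refine (hG2.norm.const_mul 2).mono (hG2.1.inner ?_) ?_
      · exact (((continuous_norm.pow 2).measurable.inv).smul
          (OrthoPair.continuous_generator (e i) (e j)).measurable).aestronglyMeasurable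
      · refine (ae_restrict_mem hA).mono fun x hx => ?_
        rw [norm_mul, norm_norm, Real.norm_two, mul_comm]
        exact (norm_inner_le_norm _ _).trans
          (mul_le_mul_of_nonneg_left (hb x hx) (norm_nonneg _))
    have hZ : MemLp (fun x => inner ℝ (gradient Φ x) (OrthoPair.generator (e i) (e j) x)) 2
        (volume.restrict (annulus d 2)) := by
      refine Continuous.memLp_of_hasCompactSupport
        (hΦt.continuous_gradient.inner (OrthoPair.continuous_generator (e i) (e j))) ?_
      refine hΦt.compact.mono' fun x hx => support_gradient_subset Φ fun h0 => hx ?_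
      simp [h0]
    refine (hY.integrable_mul hZ).congr (Eventually.of_forall fun x => ?_)
    simp only [Pi.mul_apply, inner_smul_right, hJ]
    ring
  -- Off the diagonal this is the tangential estimate; on the diagonal the generator is zero.
  have hJb : ∀ i j, |∫ x in annulus d 2, J i j x| ≤ 2 * M * (Real.sqrt K₁ * S) := by
    intro i j
    by_cases hij : i = j
    · have : ∀ x, J i j x = 0 := fun x => by
        simp [hJ, hij, OrthoPair.generator_apply]
      simp only [this, integral_zero, abs_zero]
      positivity
    · have hop : OrthoPair (e i) (e j) :=
        ⟨e.orthonormal.1 i, e.orthonormal.1 j, e.orthonormal.2 hij⟩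
      rw [← hΦn]
      exact abs_integral_tangential_le hG2 hop hM (hrot hop) hΦt
  have i1 : Integrable (fun x => inner ℝ (G x) x * Ψ x) (volume.restrict (annulus d 2)) :=
    hxG.integrable_mul (hΨt.memLp 2)
  have i2 : Integrable (fun x => 1 / 2 * ∑ i, ∑ j, J i j x) (volume.restrict (annulus d 2)) :=
    (integrable_finsetSum _ fun i _ => integrable_finsetSum _ fun j _ => hJi i j).const_mul _
  have i3 : Integrable (fun x => Φ x * F x) (volume.restrict (annulus d 2)) :=
    (hΦt.memLp 2).integrable_mul hF2
  have i12 : Integrable (fun x => inner ℝ (G x) x * Ψ x + 1 / 2 * ∑ i, ∑ j, J i j x)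
    (volume.restrict (annulus d 2)) := i1.add i2
  rw [hsub, hsub2, setIntegral_congr_fun hA hpt, integral_add i12 i3, integral_add i1 i2,
    integral_const_mul, integral_finsetSum _ fun i _ => integrable_finsetSum _ fun j _ => hJi i j]
  simp only [fun i => integral_finsetSum (μ := volume.restrict (annulus d 2)) Finset.univ
    fun j _ => hJi i j]
  have b1 : |∫ x in annulus d 2, inner ℝ (G x) x * Ψ x| ≤ 2 * M * (Real.sqrt K₂ * S) := by
    refine (abs_integral_mul_le hxG (hΨt.memLp 2)).trans ?_
    rw [hΨn]
    exact mul_le_mul_of_nonneg_right hGs (by positivity)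
  have b2 : |1 / 2 * ∑ i, ∑ j, ∫ x in annulus d 2, J i j x| ≤
      d ^ 2 * M * (Real.sqrt K₁ * S) := by
    rw [abs_mul, abs_of_pos (by norm_num : (0 : ℝ) < 1 / 2)]
    have : |∑ i, ∑ j, ∫ x in annulus d 2, J i j x| ≤
        ∑ _i : Fin d, ∑ _j : Fin d, 2 * M * (Real.sqrt K₁ * S) :=
      (Finset.abs_sum_le_sum_abs _ _).trans (Finset.sum_le_sum fun i _ =>
        (Finset.abs_sum_le_sum_abs _ _).trans (Finset.sum_le_sum fun j _ => hJb i j))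
    simp only [Finset.sum_const, Finset.card_univ, Fintype.card_fin, nsmul_eq_mul] at this
    linarith
  have b3 : |∫ x in annulus d 2, Φ x * F x| ≤ M * (Real.sqrt K₁ * S) := by
    refine (abs_integral_mul_le (hΦt.memLp 2) hF2).trans ?_
    rw [hΦn, mul_comm]
    refine mul_le_mul_of_nonneg_right ?_ (by positivity)
    rw [Real.sqrt_le_left hM]
    exact hFM
  have hSM : 0 ≤ M * S := by positivity
  calc _ ≤ 2 * M * (Real.sqrt K₂ * S) + d ^ 2 * M * (Real.sqrt K₁ * S) +
        M * (Real.sqrt K₁ * S) :=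
        (abs_add_le _ _).trans (add_le_add ((abs_add_le _ _).trans (add_le_add b1 b2)) b3)
    _ ≤ _ := by
        have : (2 * Real.sqrt K₂ + (d ^ 2 + 1) * Real.sqrt K₁ + 1) * M * S =
          2 * M * (Real.sqrt K₂ * S) + d ^ 2 * M * (Real.sqrt K₁ * S) +
            M * (Real.sqrt K₁ * S) + M * S := by ring
        linarith

end RadialExtension

/-! ### Duality with test functions on the unit sphere -/

section SphereDuality

open Filter Topology

variable {d : ℕ}

theorem IsTestFunction.memLp_sphere {Ω : Set (Euc d)} {φ : Euc d → ℝ} (h : IsTestFunction Ω φ) :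
    MemLp (fun y : sphere (0 : Euc d) 1 => φ y) 2 (surfaceMeasure d) :=
  (h.smooth.continuous.comp continuous_subtype_val).memLp_of_hasCompactSupport
    (HasCompactSupport.of_compactSpace _)

theorem IsTestFunction.integrable_mul_sphere {Ω : Set (Euc d)} {φ : Euc d → ℝ}
    (h : IsTestFunction Ω φ) {b : sphere (0 : Euc d) 1 → ℝ} (hb : Integrable b (surfaceMeasure d)) :
    Integrable (fun y : sphere (0 : Euc d) 1 => b y * φ y) (surfaceMeasure d) := by
  obtain ⟨C, -, hC⟩ := h.exists_bound
  refine hb.mul_bdd (c := C) ?_ (Eventually.of_forall fun y => ?_)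
  · exact (h.smooth.continuous.comp continuous_subtype_val).aestronglyMeasurable
  · exact (hC y).1

/-- An integrable function on the unit sphere is determined by its integrals against test
functions. -/
theorem sphere_ae_eq_zero_of_test {ρ : ℝ} (hρ : 1 < ρ) {h : sphere (0 : Euc d) 1 → ℝ}
    (hh : Integrable h (surfaceMeasure d))
    (h0 : ∀ φ, IsTestFunction (ball 0 ρ) φ → ∫ y, h y * φ (y : Euc d) ∂(surfaceMeasure d) = 0) :
    ∀ᵐ y ∂(surfaceMeasure d), h y = 0 := by
  have hemb : MeasurableEmbedding ((↑) : sphere (0 : Euc d) 1 → Euc d) :=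
    MeasurableEmbedding.subtype_coe (isClosed_sphere.measurableSet)
  let f : Euc d → ℝ := Function.extend (↑) h 0
  have hf : ∀ y : sphere (0 : Euc d) 1, f y = h y := fun y =>
    Subtype.val_injective.extend_apply _ _ _
  have hfi : Integrable f ((surfaceMeasure d).map (↑)) := by
    rw [hemb.integrable_map_iff]
    exact hh.congr (Eventually.of_forall fun y => (hf y).symm)
  -- The fundamental lemma is applied in the ambient ball to the pushforward of the surface measure,
  -- with `h` extended by zero off the sphere.
  have key := isOpen_ball.ae_eq_zero_of_integral_contDiff_smul_eq_zero (U := ball (0 : Euc d) ρ)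
    (hfi.locallyIntegrable.locallyIntegrableOn _) (fun φ h1 h2 h3 => by
      rw [hemb.integral_map, ← h0 φ ⟨h1, h2, h3⟩]
      refine integral_congr_ae (Eventually.of_forall fun y => ?_)
      simp only [hf, smul_eq_mul]
      ring)
  filter_upwards [hemb.ae_map_iff.mp key] with y hy
  rw [← hf]
  exact hy (by
    have : ‖(y : Euc d)‖ = 1 := by simp
    rw [mem_ball_zero_iff, this]
    exact hρ)

/-- A linear functional on test functions which is bounded by the `L²` norm on the unit sphere is
represented by a square integrable function. -/
theorem exists_sphere_representation {ρ : ℝ} (L : testSubmodule (ball (0 : Euc d) ρ) →ₗ[ℝ] ℝ)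
    {M : ℝ} (hM : 0 ≤ M)
    (hL : ∀ φ, |L φ| ≤ M * Real.sqrt (∫ y, φ.1 (y : Euc d) ^ 2 ∂(surfaceMeasure d))) :
    ∃ h : sphere (0 : Euc d) 1 → ℝ, MemLp h 2 (surfaceMeasure d) ∧
      ∫ y, h y ^ 2 ∂(surfaceMeasure d) ≤ M ^ 2 ∧
      ∀ φ, L φ = ∫ y, h y * φ.1 (y : Euc d) ∂(surfaceMeasure d) := by
  let μ := surfaceMeasure d
  let ι : testSubmodule (ball (0 : Euc d) ρ) →ₗ[ℝ] Lp ℝ 2 μ :=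
    { toFun := fun φ => (IsTestFunction.memLp_sphere φ.2).toLp (fun y => φ.1 (y : Euc d))
      map_add' := fun φ ψ => rfl
      map_smul' := fun c φ => rfl }
  have norm_sq : ∀ {g : sphere (0 : Euc d) 1 → ℝ} (hg : MemLp g 2 μ),
      ‖hg.toLp g‖ ^ 2 = ∫ x, g x ^ 2 ∂μ := by
    intro g hg
    rw [← @real_inner_self_eq_norm_sq, L2.inner_def]
    refine integral_congr_ae ?_
    filter_upwards [hg.coeFn_toLp] with x hx
    rw [hx, real_inner_self_eq_norm_sq, Real.norm_eq_abs, sq_abs]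
  have hnorm : ∀ φ : testSubmodule (ball (0 : Euc d) ρ),
      ‖ι φ‖ = Real.sqrt (∫ y, φ.1 (y : Euc d) ^ 2 ∂μ) := by
    intro φ
    rw [← norm_sq (IsTestFunction.memLp_sphere φ.2), Real.sqrt_sq (norm_nonneg _)]
    rfl
  obtain ⟨g, hgM, hg⟩ := exists_inner_eq_of_bound ι L M hM (fun φ => by
    rw [hnorm]
    exact hL φ)
  refine ⟨g, Lp.memLp g, ?_, fun φ => ?_⟩
  · rw [← norm_sq (Lp.memLp g), Lp.toLp_coeFn]
    gcongr
  · rw [hg φ, L2.inner_def]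
    refine integral_congr_ae ?_
    filter_upwards [(IsTestFunction.memLp_sphere φ.2).coeFn_toLp] with x hx
    have : (ι φ : sphere (0 : Euc d) 1 → ℝ) x = φ.1 x := hx
    rw [this]
    simp [mul_comm]

/-- The functional has an `L²` representative of norm at most `M`, which must equal `h` almost
everywhere; Cauchy-Schwarz against the constant `1` then bounds the `L¹` norm. -/
theorem integral_abs_le_of_sphere_test {ρ : ℝ} (hρ : 1 < ρ) {h : sphere (0 : Euc d) 1 → ℝ}
    (hh : Integrable h (surfaceMeasure d)) {M : ℝ} (hM : 0 ≤ M)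
    (hb : ∀ φ, IsTestFunction (ball 0 ρ) φ → |∫ y, h y * φ (y : Euc d) ∂(surfaceMeasure d)| ≤
      M * Real.sqrt (∫ y, φ (y : Euc d) ^ 2 ∂(surfaceMeasure d))) :
    ∫ y, |h y| ∂(surfaceMeasure d) ≤ M * Real.sqrt ((surfaceMeasure d).real univ) := by
  let L : testSubmodule (ball (0 : Euc d) ρ) →ₗ[ℝ] ℝ :=
    { toFun := fun φ => ∫ y, h y * φ.1 (y : Euc d) ∂(surfaceMeasure d)
      map_add' := fun φ ψ => by
        rw [← integral_add (IsTestFunction.integrable_mul_sphere φ.2 hh)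
          (IsTestFunction.integrable_mul_sphere ψ.2 hh)]
        refine integral_congr_ae (Eventually.of_forall fun x => ?_)
        exact mul_add _ _ _
      map_smul' := fun c φ => by
        rw [RingHom.id_apply, smul_eq_mul, ← integral_const_mul]
        refine integral_congr_ae (Eventually.of_forall fun x => ?_)
        simp
        ring }
  obtain ⟨g, hg2, hgM, hg⟩ := exists_sphere_representation L hM (fun φ => hb φ.1 φ.2)
  have hgi : Integrable g (surfaceMeasure d) := hg2.integrable (by norm_num)
  have hae := sphere_ae_eq_zero_of_test hρ (hh.sub hgi) (fun φ hφ => by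
    have e1 : ∫ y, h y * φ (y : Euc d) ∂(surfaceMeasure d) =
      ∫ y, g y * φ (y : Euc d) ∂(surfaceMeasure d) := hg ⟨φ, hφ⟩
    rw [← sub_eq_zero, ← integral_sub (hφ.integrable_mul_sphere hh)
      (hφ.integrable_mul_sphere hgi)] at e1
    rw [← e1]
    refine integral_congr_ae (Eventually.of_forall fun x => ?_)
    simp only [Pi.sub_apply]
    ring)
  have e2 : ∫ y, |h y| ∂(surfaceMeasure d) = ∫ y, |g y| * 1 ∂(surfaceMeasure d) := by
    refine integral_congr_ae ?_
    filter_upwards [hae] with y hy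
    rw [mul_one, sub_eq_zero.mp hy]
  rw [e2]
  refine (le_abs_self _).trans ((abs_integral_mul_le hg2.abs (memLp_const 1)).trans ?_)
  simp only [one_pow, integral_const, smul_eq_mul, mul_one]
  refine mul_le_mul_of_nonneg_right ?_ (Real.sqrt_nonneg _)
  rw [Real.sqrt_le_left hM]
  simpa using hgM

end SphereDuality

/-! ### Existence of the normal derivative and its variation under rotations -/

section NormalTraces

open Filter Topology

variable {d : ℕ} {ρ T b g : ℝ} {v : Euc d → ℝ} {G : Euc d → Euc d}

/-- Green's formula on the annulus: `h` represents the normal trace on the unit sphere of the field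
`G` with weak divergence `F`. -/
def GreenIdentity (ρ : ℝ) (G : Euc d → Euc d) (F : Euc d → ℝ)
    (h : sphere (0 : Euc d) 1 → ℝ) : Prop :=
  ∀ φ, IsTestFunction (ball 0 ρ) φ →
    (∫ x in annulus d ρ, (inner ℝ (G x) (gradient φ x) + φ x * F x)) =
      - ∫ y, h y * φ (y : Euc d) ∂(surfaceMeasure d)

theorem integrable_green (hG : MemLp G 2 (volume.restrict (annulus d ρ))) {F : Euc d → ℝ}
    (hF : MemLp F 2 (volume.restrict (annulus d ρ))) {Ω : Set (Euc d)} {φ : Euc d → ℝ}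
    (hφ : IsTestFunction Ω φ) :
    Integrable (fun x => inner ℝ (G x) (gradient φ x) + φ x * F x)
      (volume.restrict (annulus d ρ)) :=
  (MemLp.integrable_inner' hG (hφ.gradient_memLp 2)).add ((hφ.memLp 2).integrable_mul hF)

namespace AnnulusSol

theorem divergence_memLp (h : AnnulusSol ρ T b g v G) :
    MemLp (fun x => 1 / T * v x - g) 2 (volume.restrict (annulus d ρ)) :=
  haveI := isFiniteMeasure_annulus d ρ
  (h.memLp.const_mul _).sub (memLp_const g)

theorem green_eq_zero (h : AnnulusSol ρ T b g v G) {φ : Euc d → ℝ}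
    (hφ : IsTestFunction (annulus d ρ) φ) :
    ∫ x in annulus d ρ, (inner ℝ (G x) (gradient φ x) + φ x * (1 / T * v x - g)) = 0 := by
  have := isFiniteMeasure_annulus d ρ
  have e := h.weak_eq φ hφ
  rw [← sub_eq_zero, ← integral_sub (h.integrable_weak hφ)
    ((hφ.memLp 1).integrable (le_refl _) |>.const_mul g)] at e
  rw [← e]
  refine integral_congr_ae (Eventually.of_forall fun x => ?_)
  simp only
  ring

/-- A normal trace comes with an unspecified divergence. Testing inside the annulus and using the
equation identifies it almost everywhere with `v / T - g`. -/
theorem greenIdentity (h : AnnulusSol ρ T b g v G) {k : sphere (0 : Euc d) 1 → ℝ}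
    (hk : HasNormalTrace ρ G k) : GreenIdentity ρ G (fun x => 1 / T * v x - g) k := by
  obtain ⟨-, F, hF, hFe⟩ := hk
  have hF0 := h.divergence_memLp
  have hae : ∀ᵐ x ∂volume, x ∈ annulus d ρ → F x - (1 / T * v x - g) = 0 := by
    apply (isOpen_annulus d ρ).ae_eq_zero_of_integral_contDiff_smul_eq_zero
    · exact locallyIntegrableOn_of_locallyIntegrable_restrict
        ((hF.sub hF0).locallyIntegrable (by norm_num))
    · intro φ h1 h2 h3
      have hφ : IsTestFunction (annulus d ρ) φ := ⟨h1, h2, h3⟩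
      have e1 : ∫ x, φ x • (F x - (1 / T * v x - g)) =
          ∫ x in annulus d ρ, φ x • (F x - (1 / T * v x - g)) := by
        refine (setIntegral_eq_integral_of_forall_compl_eq_zero fun x hx => ?_).symm
        rw [hφ.eq_zero hx, zero_smul]
      have e2 := hFe φ (hφ.mono (annulus_subset_ball d ρ))
      have e3 : ∀ y : sphere (0 : Euc d) 1, φ y = 0 := fun y =>
        hφ.eq_zero fun hy => by simpa using (mem_annulus.mp hy).2
      simp only [e3, mul_zero, integral_zero, neg_zero] at e2
      have e4 := h.green_eq_zero hφ
      rw [e1, ← sub_zero (0 : ℝ)]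
      nth_rewrite 1 [← e2]
      rw [← e4, ← integral_sub (integrable_green h.gradient_memLp hF hφ)
        (integrable_green h.gradient_memLp hF0 hφ)]
      refine integral_congr_ae (Eventually.of_forall fun x => ?_)
      simp only [smul_eq_mul]
      ring
  intro φ hφ
  rw [← hFe φ hφ]
  refine integral_congr_ae ?_
  rw [EventuallyEq, ae_restrict_iff' (isOpen_annulus d ρ).measurableSet]
  filter_upwards [hae] with x hx hxA
  rw [sub_eq_zero.mp (hx hxA)]

end AnnulusSol

theorem GreenIdentity.comp_isometry {F : Euc d → ℝ} {k : sphere (0 : Euc d) 1 → ℝ}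
    (h : GreenIdentity ρ G F k) (R : Euc d ≃ₗᵢ[ℝ] Euc d) :
    GreenIdentity ρ (pullGrad R G) (fun x => F (R x)) (fun y => k (sphereMap R y)) := by
  intro φ hφ
  have hφ' : IsTestFunction (ball 0 ρ) (fun y => φ (R.symm y)) :=
    hφ.comp_isometry R.symm fun x hx =>
      (isometry_mem_ball R.symm x).mp hx
  have e := h _ hφ'
  rw [← setIntegral_comp_isometry R (isOpen_annulus d ρ).measurableSet
    (fun x => isometry_mem_annulus R x), ← integral_comp_sphereMap R] at e
  refine Eq.trans ?_ (e.trans ?_)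
  · refine integral_congr_ae (Eventually.of_forall fun x => ?_)
    simp only [LinearIsometryEquiv.symm_apply_apply]
    rw [← gradient_comp_symm hφ.smooth R x, pullGrad, LinearIsometryEquiv.inner_map_map]
  · congr 1
    refine integral_congr_ae (Eventually.of_forall fun y => ?_)
    simp [sphereMap]

theorem GreenIdentity.sub {G' : Euc d → Euc d} {F F' : Euc d → ℝ}
    {k k' : sphere (0 : Euc d) 1 → ℝ} (h : GreenIdentity ρ G F k) (h' : GreenIdentity ρ G' F' k')
    (hG : MemLp G 2 (volume.restrict (annulus d ρ)))
    (hG' : MemLp G' 2 (volume.restrict (annulus d ρ)))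
    (hF : MemLp F 2 (volume.restrict (annulus d ρ)))
    (hF' : MemLp F' 2 (volume.restrict (annulus d ρ)))
    (hk : Integrable k (surfaceMeasure d)) (hk' : Integrable k' (surfaceMeasure d)) :
    GreenIdentity ρ (fun x => G x - G' x) (fun x => F x - F' x) (fun y => k y - k' y) := by
  intro φ hφ
  have e1 : ∫ x in annulus d ρ, (inner ℝ (G x - G' x) (gradient φ x) + φ x * (F x - F' x)) =
      (∫ x in annulus d ρ, (inner ℝ (G x) (gradient φ x) + φ x * F x)) -
        ∫ x in annulus d ρ, (inner ℝ (G' x) (gradient φ x) + φ x * F' x) := by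
    rw [← integral_sub (integrable_green hG hF hφ) (integrable_green hG' hF' hφ)]
    refine integral_congr_ae (Eventually.of_forall fun x => ?_)
    simp only [inner_sub_left]
    ring
  have e2 : ∫ y, (k y - k' y) * φ (y : Euc d) ∂(surfaceMeasure d) =
      (∫ y, k y * φ (y : Euc d) ∂(surfaceMeasure d)) -
        ∫ y, k' y * φ (y : Euc d) ∂(surfaceMeasure d) := by
    rw [← integral_sub (hφ.integrable_mul_sphere hk) (hφ.integrable_mul_sphere hk')]
    refine integral_congr_ae (Eventually.of_forall fun x => ?_)
    simp only
    ring
  rw [e1, e2, h φ hφ, h' φ hφ]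
  ring

/-- The functional defining the normal derivative of a solution with constant trace is bounded by
the `L²` norm on the unit sphere. -/
theorem exists_normal_trace_bound (d : ℕ) : ∃ C : ℝ, 0 < C ∧ ∀ {ρ T b g : ℝ} {v : Euc d → ℝ}
    {G : Euc d → Euc d} {M : ℝ}, 4 ≤ ρ → 0 < T → AnnulusSol ρ T b g v G → 0 ≤ M →
      ∫ x in annulus d (5 / 2), ‖G x‖ ^ 2 ≤ M ^ 2 →
      ∫ x in annulus d 2, (1 / T * v x - g) ^ 2 ≤ M ^ 2 →
      ∀ φ, IsTestFunction (ball 0 ρ) φ →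
        |∫ x in annulus d ρ, (inner ℝ (G x) (gradient φ x) + φ x * (1 / T * v x - g))| ≤
          C * M * Real.sqrt (∫ y, φ (y : Euc d) ^ 2 ∂(surfaceMeasure d)) := by
  obtain ⟨C₀, hC₀, h₀⟩ := exists_trace_functional_bound d
  obtain ⟨C₁, hC₁, h₁⟩ := exists_caccioppoli_annulus d (r := 2) (R := 5 / 2) (by norm_num)
    (by norm_num)
  -- The factor `25 = (2 · 5/2)²` is the rotation modulus on the annulus of outer radius `5/2`, and
  -- `C₁` comes from Caccioppoli between the radii `2` and `5/2`; adding `1` makes `K ≥ 1`, so that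
  -- `K M` also bounds `G` and its divergence.
  let K := Real.sqrt (25 * C₁ + 1)
  have hK2 : K ^ 2 = 25 * C₁ + 1 := Real.sq_sqrt (by positivity)
  have hK : 0 < K := Real.sqrt_pos.mpr (by positivity)
  refine ⟨C₀ * K, by positivity, ?_⟩
  intro ρ T b g v G M hρ hT h hM hG hF φ hφ
  have hsub : ∀ {r : ℝ}, r ≤ ρ → volume.restrict (annulus d r) ≤ volume.restrict (annulus d ρ) :=
    fun hr => Measure.restrict_mono (annulus_mono hr) le_rfl
  have hmono : ∫ x in annulus d 2, ‖G x‖ ^ 2 ≤ ∫ x in annulus d (5 / 2), ‖G x‖ ^ 2 :=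
    setIntegral_mono_set
      (MemLp.integrable_sq_norm (h.gradient_memLp.mono_measure (hsub (by linarith))))
      (Eventually.of_forall fun x => by positivity)
      (annulus_mono (by norm_num)).eventuallyLE
  have hMK : M ^ 2 ≤ (K * M) ^ 2 := by
    rw [mul_pow, hK2]
    nlinarith [sq_nonneg M]
  rw [mul_assoc C₀]
  refine h₀ (by linarith) (by positivity) h.gradient_memLp h.divergence_memLp
    (fun φ hφ => h.green_eq_zero hφ) (hmono.trans (hG.trans hMK)) (hF.trans hMK) ?_ φ hφ
  -- The difference quotient of `G` is the gradient of `v ∘ R_t - v`, a solution with zero data: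
  -- Caccioppoli bounds it by the `L²` norm of that difference, which is of order `t`.
  intro b' c hbc t
  refine (h₁ (by linarith) hT (h.rotation_difference (hbc.rot t))).trans ?_
  have h2 := h.integral_sq_rot_sub_le (r := 5 / 2) (by linarith) hbc t
  have h3 : (2 * (5 / 2) * |t|) ^ 2 * ∫ x in annulus d (5 / 2), ‖G x‖ ^ 2 ≤
      25 * t ^ 2 * M ^ 2 := by
    have : (2 * (5 / 2) * |t|) ^ 2 = 25 * t ^ 2 := by
      rw [mul_pow, sq_abs]
      norm_num
    rw [this]
    gcongr
  have h4 : C₁ * (25 * t ^ 2 * M ^ 2) ≤ (t * (K * M)) ^ 2 := by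
    rw [mul_pow, mul_pow, hK2]
    nlinarith [mul_nonneg (sq_nonneg t) (sq_nonneg M)]
  exact (mul_le_mul_of_nonneg_left (h2.trans h3) hC₁.le).trans h4

/-- The normal derivative on the unit sphere of a solution with constant trace is a function. -/
theorem AnnulusSol.exists_hasNormalTrace (h : AnnulusSol ρ T b g v G) (hρ : 4 ≤ ρ) (hT : 0 < T) :
    ∃ k : sphere (0 : Euc d) 1 → ℝ, HasNormalTrace ρ G k := by
  obtain ⟨C, hC, hb⟩ := exists_normal_trace_bound d
  have hF := h.divergence_memLp
  let F : Euc d → ℝ := fun x => 1 / T * v x - g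
  let A := ∫ x in annulus d (5 / 2), ‖G x‖ ^ 2
  let B := ∫ x in annulus d 2, F x ^ 2
  have hA : 0 ≤ A := integral_nonneg fun x => by positivity
  have hB : 0 ≤ B := integral_nonneg fun x => by positivity
  have hM2 : Real.sqrt (A + B) ^ 2 = A + B := Real.sq_sqrt (by positivity)
  have hbound := hb hρ hT h (Real.sqrt_nonneg (A + B)) (by
    rw [hM2]
    exact le_add_of_nonneg_right hB) (by
    rw [hM2]
    exact le_add_of_nonneg_left hA)
  have hint : ∀ φ : testSubmodule (ball (0 : Euc d) ρ),
      Integrable (fun x => inner ℝ (G x) (gradient φ.1 x) + φ.1 x * F x)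
        (volume.restrict (annulus d ρ)) := fun φ =>
    integrable_green h.gradient_memLp hF φ.2
  let L : testSubmodule (ball (0 : Euc d) ρ) →ₗ[ℝ] ℝ :=
    { toFun := fun φ => ∫ x in annulus d ρ, (inner ℝ (G x) (gradient φ.1 x) + φ.1 x * F x)
      map_add' := fun φ ψ => by
        rw [← integral_add (hint φ) (hint ψ)]
        refine integral_congr_ae (Eventually.of_forall fun x => ?_)
        have : gradient (φ + ψ).1 x = gradient φ.1 x + gradient ψ.1 x :=
          gradient_eq_of_hasFDerivAt (by
            have := (hasFDerivAt_of_contDiff φ.2.smooth x).add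
              (hasFDerivAt_of_contDiff ψ.2.smooth x)
            exact this) (fun y => by simp [inner_add_left])
        beta_reduce
        rw [this, inner_add_right]
        simp only [Submodule.coe_add, Pi.add_apply]
        ring
      map_smul' := fun c φ => by
        rw [RingHom.id_apply, smul_eq_mul, ← integral_const_mul]
        refine integral_congr_ae (Eventually.of_forall fun x => ?_)
        have : gradient (c • φ).1 x = c • gradient φ.1 x :=
          gradient_eq_of_hasFDerivAt (by
            have := (hasFDerivAt_of_contDiff φ.2.smooth x).const_smul c
            exact this) (fun y => by simp [inner_smul_left])
        beta_reduce
        rw [this, inner_smul_right]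
        simp only [Submodule.coe_smul, Pi.smul_apply, smul_eq_mul]
        ring }
  obtain ⟨k, hk2, -, hk⟩ := exists_sphere_representation L (by positivity)
    (fun φ => hbound φ.1 φ.2)
  -- The outward normal of the unit ball points into the annulus, whence the minus sign in Green's
  -- formula.
  refine ⟨fun y => - k y, (hk2.integrable (by norm_num)).neg, F, hF, fun φ hφ => ?_⟩
  have e : _ = _ := hk ⟨φ, hφ⟩
  refine Eq.trans e ?_
  simp only [neg_mul, integral_neg, neg_neg]

/-- The normal derivative on the unit sphere of a solution on the annulus of radii `1` and `ρ`
differs from its rotation by a quantity that decays in `ρ`. -/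
theorem exists_normal_trace_rotation_bound (hd : 2 < d) : ∃ C : ℝ, 0 < C ∧ ∀ {ρ T b g : ℝ}
    {v : Euc d → ℝ} {G : Euc d → Euc d}, 4 ≤ ρ → 1 ≤ T → AnnulusSol ρ T b g v G →
      ∀ {k : sphere (0 : Euc d) 1 → ℝ}, HasNormalTrace ρ G k → ∀ R : Euc d ≃ₗᵢ[ℝ] Euc d,
        ∫ y, |k (sphereMap R y) - k y| ∂(surfaceMeasure d) ≤
          C * Real.sqrt ((ρ ^ d)⁻¹ * ∫ x in annulus d ρ, (v (R x) - v x) ^ 2) := by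
  obtain ⟨C₀, hC₀, h₀⟩ := exists_normal_trace_bound d
  obtain ⟨C₁, hC₁, h₁⟩ := exists_caccioppoli_annulus d (r := 5 / 2) (R := 3) (by norm_num)
    (by norm_num)
  obtain ⟨C₂, hC₂, h₂⟩ := exists_annulus_decay hd
  refine ⟨C₀ * Real.sqrt ((C₁ + 1) * C₂) * (Real.sqrt ((surfaceMeasure d).real univ) + 1),
    by positivity, ?_⟩
  intro ρ T b g v G hρ hT h k hk R
  have hT0 : 0 < T := by linarith
  have hw := h.rotation_difference R
  let w : Euc d → ℝ := fun x => v (R x) - v x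
  let J := ∫ x in annulus d ρ, w x ^ 2
  have hJ : 0 ≤ J := integral_nonneg fun x => by positivity
  have hρd : 0 < ρ ^ d := by positivity
  -- The size of `w = v ∘ R - v` near the sphere: decay gives its `L²` norm on the annulus of outer
  -- radius `3`, and Caccioppoli between `5/2` and `3` its gradient. Both carry the factor `ρ ^ (-d
  -- / 2)`.
  let M := Real.sqrt ((C₁ + 1) * C₂) * Real.sqrt ((ρ ^ d)⁻¹ * J)
  have hM2 : M ^ 2 = (C₁ + 1) * (C₂ * (ρ ^ d)⁻¹ * J) := by
    rw [mul_pow, Real.sq_sqrt (by positivity), Real.sq_sqrt (by positivity)]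
    ring
  have hM : 0 ≤ M := by positivity
  have hw3 : ∫ x in annulus d 3, w x ^ 2 ≤ C₂ * (ρ ^ d)⁻¹ * J := h₂ hρ hT0 hw
  have hw3' : 0 ≤ ∫ x in annulus d 3, w x ^ 2 := integral_nonneg fun x => by positivity
  have hW : ∫ x in annulus d (5 / 2), ‖pullGrad R G x - G x‖ ^ 2 ≤ M ^ 2 := by
    refine (h₁ (by linarith) hT0 hw).trans ?_
    rw [hM2]
    change C₁ * (∫ x in annulus d 3, w x ^ 2) ≤ _
    nlinarith
  have hwi : IntegrableOn (fun x => w x ^ 2) (annulus d 3) :=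
    (hw.memLp.mono_measure (Measure.restrict_mono (annulus_mono (by linarith)) le_rfl)).integrable_sq
  have hF : ∫ x in annulus d 2, (1 / T * w x - 0) ^ 2 ≤ M ^ 2 := by
    have h1 : ∫ x in annulus d 2, (1 / T * w x - 0) ^ 2 ≤ ∫ x in annulus d 2, w x ^ 2 := by
      refine integral_mono_of_nonneg (Eventually.of_forall fun x => by positivity)
        (hwi.mono_set (annulus_mono (by norm_num))) (Eventually.of_forall fun x => ?_)
      -- This is where `T ≥ 1` is needed: the divergence `w / T` is then controlled by `w` uniformly
      -- in `T`.
      have h2 : (1 / T) ^ 2 ≤ 1 := by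
        refine pow_le_one₀ (by positivity) ?_
        rw [div_le_one hT0]
        exact hT
      simp only [sub_zero, mul_pow]
      exact mul_le_of_le_one_left (sq_nonneg _) h2
    have h2 : ∫ x in annulus d 2, w x ^ 2 ≤ ∫ x in annulus d 3, w x ^ 2 :=
      setIntegral_mono_set hwi (Eventually.of_forall fun x => by positivity)
        (annulus_mono (by norm_num)).eventuallyLE
    rw [hM2]
    nlinarith
  have hbound := h₀ hρ hT0 hw hM hW hF
  have hg := h.greenIdentity hk
  have hkR : Integrable (fun y => k (sphereMap R y)) (surfaceMeasure d) :=
    (measurePreserving_sphereMap R).integrable_comp_of_integrable hk.1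
  have hR := h.comp_isometry R
  have hgd := (hg.comp_isometry R).sub hg hR.gradient_memLp h.gradient_memLp hR.divergence_memLp
    h.divergence_memLp hkR hk.1
  have key := integral_abs_le_of_sphere_test (ρ := ρ) (by linarith) (hkR.sub hk.1)
    (M := C₀ * M) (by positivity) (fun φ hφ => by
      have e1 := hbound φ hφ
      have e2 := hgd φ hφ
      have e3 : ∫ x in annulus d ρ, (inner ℝ (pullGrad R G x - G x) (gradient φ x) +
          φ x * ((1 / T * v (R x) - g) - (1 / T * v x - g))) =
          ∫ x in annulus d ρ, (inner ℝ (pullGrad R G x - G x) (gradient φ x) +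
          φ x * (1 / T * (v (R x) - v x) - 0)) := by
        refine integral_congr_ae (Eventually.of_forall fun x => ?_)
        simp only
        ring
      rw [← e3, e2, abs_neg] at e1
      exact e1)
  refine key.trans ?_
  have e : C₀ * Real.sqrt ((C₁ + 1) * C₂) * (Real.sqrt ((surfaceMeasure d).real univ) + 1) *
      Real.sqrt ((ρ ^ d)⁻¹ * J) =
      C₀ * M * Real.sqrt ((surfaceMeasure d).real univ) + C₀ * M := by
    simp only [M]
    ring
  change _ ≤ C₀ * Real.sqrt ((C₁ + 1) * C₂) * (Real.sqrt ((surfaceMeasure d).real univ) + 1) *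
      Real.sqrt ((ρ ^ d)⁻¹ * J)
  rw [e]
  exact le_add_of_nonneg_right (by positivity)

end NormalTraces

/-! ### Decomposition of rotations into plane rotations -/

section RotationGroup

open Filter Topology

variable {d : ℕ}

theorem exists_unit_orthogonal (hd : 2 ≤ d) (a : Euc d) :
    ∃ c : Euc d, ‖c‖ = 1 ∧ inner ℝ a c = 0 := by
  have hne : (ℝ ∙ a)ᗮ ≠ ⊥ := by
    intro h
    rw [Submodule.orthogonal_eq_bot_iff] at h
    have h1 := finrank_span_le_card (R := ℝ) ({a} : Set (Euc d))
    rw [Set.toFinset_card, Set.card_singleton] at h1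
    rw [h, finrank_top, finrank_euclideanSpace_fin] at h1
    omega
  obtain ⟨p, hp, hp0⟩ := Submodule.exists_mem_ne_zero_of_ne_bot hne
  refine ⟨‖p‖⁻¹ • p, norm_smul_inv_norm hp0, ?_⟩
  rw [inner_smul_right, Submodule.mem_orthogonal_singleton_iff_inner_right.mp hp, mul_zero]

/-- The angle is the arccosine of `a · b`, and `c` is the normalized component of `b` orthogonal to
`a`. If `b = ± a` any unit vector orthogonal to `a` serves, and `d ≥ 2` provides one. -/
theorem exists_orthoPair_decomposition (hd : 2 ≤ d) {a b : Euc d} (ha : ‖a‖ = 1) (hb : ‖b‖ = 1) :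
    ∃ (c : Euc d) (θ : ℝ), OrthoPair a c ∧ |θ| ≤ Real.pi ∧
      b = Real.cos θ • a + Real.sin θ • c := by
  let s : ℝ := inner ℝ a b
  let p := b - s • a
  have haa : inner ℝ a a = (1 : ℝ) := by rw [real_inner_self_eq_norm_sq, ha, one_pow]
  have hp2 : ‖p‖ ^ 2 = 1 - s ^ 2 := by
    rw [norm_sub_sq_real, norm_smul, hb, ha, inner_smul_right, real_inner_comm]
    simp only [Real.norm_eq_abs, mul_one, sq_abs]
    ring
  have hs1 : -1 ≤ s ∧ s ≤ 1 := abs_le.mp (by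
    have := abs_real_inner_le_norm a b
    rwa [ha, hb, one_mul] at this)
  have hap : inner ℝ a p = (0 : ℝ) := by
    simp only [p, inner_sub_right, inner_smul_right, haa, s]
    ring
  have hsin : Real.sin (Real.arccos s) = ‖p‖ := by
    rw [Real.sin_arccos, ← hp2, Real.sqrt_sq (norm_nonneg _)]
  have hθ : |Real.arccos s| ≤ Real.pi := by
    rw [abs_of_nonneg (Real.arccos_nonneg s)]
    exact Real.arccos_le_pi s
  by_cases hp : p = 0
  · obtain ⟨c, hc, hac⟩ := exists_unit_orthogonal hd a
    refine ⟨c, Real.arccos s, ⟨ha, hc, hac⟩, hθ, ?_⟩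
    rw [Real.cos_arccos hs1.1 hs1.2, hsin, hp, norm_zero, zero_smul, add_zero]
    exact sub_eq_zero.mp hp
  · refine ⟨‖p‖⁻¹ • p, Real.arccos s, ⟨ha, norm_smul_inv_norm hp, ?_⟩, hθ, ?_⟩
    · rw [inner_smul_right, hap, mul_zero]
    · rw [Real.cos_arccos hs1.1 hs1.2, hsin, smul_smul, mul_inv_cancel₀ (norm_ne_zero_iff.mpr hp),
        one_smul]
      simp [p]

theorem reflection_orthogonal_singleton_apply (a x : Euc d) :
    (ℝ ∙ a)ᗮ.reflection x = x - (2 * (inner ℝ a x / ‖a‖ ^ 2)) • a := by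
  rw [Submodule.reflection_orthogonal_apply, Submodule.reflection_singleton_apply]
  simp only [RCLike.ofReal_real_eq_id, id_eq]
  module

theorem reflection_smul_eq {a : Euc d} {c : ℝ} (hc : c ≠ 0) :
    (ℝ ∙ (c • a))ᗮ.reflection = (ℝ ∙ a)ᗮ.reflection := by
  have : ℝ ∙ (c • a) = ℝ ∙ a := Submodule.span_singleton_smul_eq hc.isUnit a
  simp only [this]

/-- A rotation in a plane is the composition of two reflections. -/
theorem OrthoPair.rot_eq_reflection_mul {a c : Euc d} (h : OrthoPair a c) (θ : ℝ) :
    h.rot (2 * θ) =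
      (ℝ ∙ (Real.cos θ • a + Real.sin θ • c))ᗮ.reflection * (ℝ ∙ a)ᗮ.reflection := by
  have hcs := Real.sin_sq_add_cos_sq θ
  have hn : ‖Real.cos θ • a + Real.sin θ • c‖ ^ 2 = 1 := by
    rw [norm_add_sq_real, norm_smul, norm_smul, h.norm_left, h.norm_right, inner_smul_left,
      inner_smul_right, h.inner_eq]
    simp
  ext1 x
  rw [LinearIsometryEquiv.coe_mul, Function.comp_apply, reflection_orthogonal_singleton_apply,
    reflection_orthogonal_singleton_apply, h.rot_apply, hn, h.norm_left, Real.cos_two_mul,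
    Real.sin_two_mul]
  simp only [inner_add_left, inner_sub_right, inner_smul_left, inner_smul_right, h.inner_left_self,
    h.inner_eq', one_pow, div_one, RCLike.conj_to_real, mul_zero, mul_one]
  have hs : Real.sin θ ^ 2 = 1 - Real.cos θ ^ 2 := by linarith
  match_scalars
  · ring
  · ring
  · linear_combination (2 * inner ℝ c x) * hs

/-- The rotation takes place in a plane containing `a` and `b`, through twice the angle between
them, which gives the bound `2 π`. -/
theorem reflection_mul_reflection (hd : 2 ≤ d) {a b : Euc d} (ha : a ≠ 0) (hb : b ≠ 0) :
    ∃ (c e : Euc d) (h : OrthoPair e c) (t : ℝ), |t| ≤ 2 * Real.pi ∧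
      (ℝ ∙ b)ᗮ.reflection * (ℝ ∙ a)ᗮ.reflection = h.rot t := by
  obtain ⟨c, θ, h, hθ, hbe⟩ := exists_orthoPair_decomposition hd
    (norm_smul_inv_norm (𝕜 := ℝ) ha) (norm_smul_inv_norm (𝕜 := ℝ) hb)
  refine ⟨c, _, h, 2 * θ, ?_, ?_⟩
  · rw [abs_mul, abs_two]
    linarith
  · rw [h.rot_eq_reflection_mul, ← hbe]
    simp only [RCLike.ofReal_real_eq_id, id_eq]
    rw [reflection_smul_eq (inv_ne_zero (norm_ne_zero_iff.mpr ha)),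
      reflection_smul_eq (inv_ne_zero (norm_ne_zero_iff.mpr hb))]

/-- The determinant of a linear isometry. -/
noncomputable def isometryDet (d : ℕ) : (Euc d ≃ₗᵢ[ℝ] Euc d) →* ℝ where
  toFun R := LinearMap.det (R.toLinearEquiv : Euc d →ₗ[ℝ] Euc d)
  map_one' := LinearMap.det_id
  map_mul' R S := map_mul LinearMap.det (R.toLinearEquiv : Euc d →ₗ[ℝ] Euc d)
    (S.toLinearEquiv : Euc d →ₗ[ℝ] Euc d)

theorem isometryDet_reflection {a : Euc d} (ha : a ≠ 0) :
    isometryDet d (ℝ ∙ a)ᗮ.reflection = -1 := by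
  have := Submodule.det_reflection (𝕜 := ℝ) (ℝ ∙ a)ᗮ
  rw [Submodule.orthogonal_orthogonal, finrank_span_singleton ha, pow_one] at this
  exact this

theorem OrthoPair.isometryDet_rot {a c : Euc d} (h : OrthoPair a c) (t : ℝ) :
    isometryDet d (h.rot t) = 1 := by
  have ht : t = 2 * (t / 2) := by ring
  have ha : a ≠ 0 := norm_ne_zero_iff.mp (by
    rw [h.norm_left]
    exact one_ne_zero)
  rw [ht, h.rot_eq_reflection_mul, map_mul, isometryDet_reflection ha, isometryDet_reflection]
  · norm_num
  · intro h0
    have h1 : inner ℝ a (Real.cos (t / 2) • a + Real.sin (t / 2) • c) = (0 : ℝ) := by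
      rw [h0, inner_zero_right]
    have h2 : inner ℝ c (Real.cos (t / 2) • a + Real.sin (t / 2) • c) = (0 : ℝ) := by
      rw [h0, inner_zero_right]
    simp only [inner_add_right, inner_smul_right, h.inner_left_self, h.inner_right_self, h.inner_eq,
      h.inner_eq', mul_one, mul_zero, add_zero, zero_add] at h1 h2
    have := Real.sin_sq_add_cos_sq (t / 2)
    rw [h1, h2] at this
    norm_num at this

theorem isometryDet_list_prod {l : List (Euc d)} (hl : ∀ a ∈ l, a ≠ 0) :
    isometryDet d (l.map fun a => (ℝ ∙ a)ᗮ.reflection).prod = (-1) ^ l.length := by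
  induction l with
  | nil => simp
  | cons a l ih =>
    rw [List.map_cons, List.prod_cons, map_mul, isometryDet_reflection (hl a (by simp)),
      ih fun b hb => hl b (by simp [hb]), List.length_cons, pow_succ']

/-- Cartan-Dieudonné gives at most `d` reflections. Those with zero vector are the identity and are
discarded; each remaining one has determinant `-1`, so their number is even. -/
theorem exists_reflections_of_isometryDet_eq_one {R : Euc d ≃ₗᵢ[ℝ] Euc d}
    (hR : isometryDet d R = 1) : ∃ l : List (Euc d), (∀ a ∈ l, a ≠ 0) ∧ Even l.length ∧
      l.length ≤ d ∧ R = (l.map fun a => (ℝ ∙ a)ᗮ.reflection).prod := by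
  obtain ⟨l, hl, hRl⟩ := R.reflections_generate_dim
  rw [finrank_euclideanSpace_fin] at hl
  classical
  have hfilter : ∀ l : List (Euc d), (l.map fun a => (ℝ ∙ a)ᗮ.reflection).prod =
      ((l.filter (· ≠ 0)).map fun a => (ℝ ∙ a)ᗮ.reflection).prod := by
    intro l
    induction l with
    | nil => rfl
    | cons a l ih =>
      by_cases ha : a = 0
      · have : (ℝ ∙ (0 : Euc d))ᗮ.reflection = 1 := by
          ext1 x
          rw [reflection_orthogonal_singleton_apply]
          simp
        rw [List.map_cons, List.prod_cons, ih, ha, this, one_mul, List.filter_cons_of_neg (by simp)]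
      · rw [List.map_cons, List.prod_cons, ih, List.filter_cons_of_pos (by simpa using ha),
          List.map_cons, List.prod_cons]
  have hne : ∀ a ∈ l.filter (· ≠ 0), a ≠ 0 := fun a ha => by
    simpa using (List.mem_filter.mp ha).2
  rw [hfilter] at hRl
  refine ⟨_, hne, ?_, (List.length_filter_le _ _).trans hl, hRl⟩
  rw [hRl, isometryDet_list_prod hne] at hR
  exact (neg_one_pow_eq_one_iff_even (by norm_num)).mp hR

namespace AnnulusSol

variable {ρ T b g : ℝ} {v : Euc d → ℝ} {G : Euc d → Euc d}

/-- Insert `v (R x)`, use `(a + b)² ≤ 2 a² + 2 b²`, and remove `R` from the first term by invariance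
of the annulus. -/
theorem integral_sq_comp_mul_sub_le (h : AnnulusSol ρ T b g v G) (Q R : Euc d ≃ₗᵢ[ℝ] Euc d) :
    ∫ x in annulus d ρ, (v ((Q * R) x) - v x) ^ 2 ≤
      2 * (∫ x in annulus d ρ, (v (Q x) - v x) ^ 2) +
        2 * ∫ x in annulus d ρ, (v (R x) - v x) ^ 2 := by
  have hA := (isOpen_annulus d ρ).measurableSet
  have e := setIntegral_comp_isometry R hA (fun x => isometry_mem_annulus R x)
    (fun x => (v (Q x) - v x) ^ 2)
  have hQ := (((h.rotation_difference Q).comp_isometry R).memLp).integrable_sq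
  have hR := ((h.rotation_difference R).memLp).integrable_sq
  rw [← e, ← integral_const_mul, ← integral_const_mul, ← integral_add (hQ.const_mul 2)
    (hR.const_mul 2)]
  refine integral_mono_of_nonneg (Eventually.of_forall fun x => sq_nonneg _)
    ((hQ.const_mul 2).add (hR.const_mul 2)) (Eventually.of_forall fun x => ?_)
  simp only [LinearIsometryEquiv.coe_mul, Function.comp_apply]
  nlinarith [sq_nonneg ((v (Q (R x)) - v (R x)) - (v (R x) - v x))]

/-- Rotational invariance up to the Dirichlet energy. -/
theorem integral_sq_isometry_sub_le (hd : 2 ≤ d) (h : AnnulusSol ρ T b g v G)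
    {R : Euc d ≃ₗᵢ[ℝ] Euc d} (hR : isometryDet d R = 1) :
    ∫ x in annulus d ρ, (v (R x) - v x) ^ 2 ≤
      4 ^ d * ((4 * Real.pi) ^ 2 * ρ ^ 2 * ∫ x in annulus d ρ, ‖G x‖ ^ 2) := by
  let B := (4 * Real.pi) ^ 2 * ρ ^ 2 * ∫ x in annulus d ρ, ‖G x‖ ^ 2
  have hE : 0 ≤ ∫ x in annulus d ρ, ‖G x‖ ^ 2 := integral_nonneg fun x => by positivity
  have hB : 0 ≤ B := by positivity
  have hrot : ∀ {e c : Euc d} (hec : OrthoPair e c) (t : ℝ), |t| ≤ 2 * Real.pi →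
      ∫ x in annulus d ρ, (v (hec.rot t x) - v x) ^ 2 ≤ B := by
    intro e c hec t ht
    refine (h.integral_sq_rot_sub_le le_rfl hec t).trans ?_
    have : (2 * ρ * |t|) ^ 2 ≤ (4 * Real.pi) ^ 2 * ρ ^ 2 := by
      have h1 : |t| ^ 2 ≤ (2 * Real.pi) ^ 2 := by gcongr
      nlinarith [mul_le_mul_of_nonneg_left h1 (sq_nonneg ρ)]
    exact mul_le_mul_of_nonneg_right this hE
  -- Consecutive reflections are grouped in pairs, each a plane rotation costing at most `B`. The
  -- induction closes since `2 B + 2 · 4 ^ n B ≤ 4 ^ (n + 1) B`.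
  have key : ∀ n, ∀ l : List (Euc d), l.length = 2 * n → (∀ a ∈ l, a ≠ 0) →
      ∫ x in annulus d ρ, (v ((l.map fun a => (ℝ ∙ a)ᗮ.reflection).prod x) - v x) ^ 2 ≤
        4 ^ n * B := by
    intro n
    induction n with
    | zero =>
      intro l hl _
      rw [mul_zero, List.length_eq_zero_iff] at hl
      rw [hl]
      simpa using hB
    | succ n ih =>
      intro l hl hne
      match l, hl, hne with
      | a :: c :: l, hl, hne =>
        have hl' : l.length = 2 * n := by
          simp only [List.length_cons] at hl
          omega
        have h1 := ih l hl' fun x hx => hne x (by simp [hx])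
        obtain ⟨p, e, hpe, t, ht, hrt⟩ := reflection_mul_reflection hd (a := c) (b := a)
          (hne c (by simp)) (hne a (by simp))
        rw [List.map_cons, List.prod_cons, List.map_cons, List.prod_cons, ← mul_assoc, hrt]
        refine (h.integral_sq_comp_mul_sub_le _ _).trans ?_
        have h2 := hrot hpe t ht
        have h3 : B ≤ 4 ^ n * B := le_mul_of_one_le_left hB (one_le_pow₀ (by norm_num))
        rw [pow_succ]
        linarith
  obtain ⟨l, hne, ⟨n, hn⟩, hl, rfl⟩ := exists_reflections_of_isometryDet_eq_one hR
  refine (key n l (by omega) hne).trans ?_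
  have : (4 : ℝ) ^ n ≤ 4 ^ d := pow_le_pow_right₀ (by norm_num) (by omega)
  exact mul_le_mul_of_nonneg_right this hB

end AnnulusSol

end RotationGroup

/-! ### Haar measure on the rotation group and averaging on the sphere -/

section HaarAverage

open Filter Topology

variable {d : ℕ}

/-- The group of rotations about the origin. -/
noncomputable def rotationGroup (d : ℕ) : Subgroup (unitary (Euc d →L[ℝ] Euc d)) :=
  ((isometryDet d).comp
    (Unitary.linearIsometryEquiv (𝕜 := ℝ) (H := Euc d)).toMonoidHom).toHomUnits.ker

theorem mem_rotationGroup {u : unitary (Euc d →L[ℝ] Euc d)} :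
    u ∈ rotationGroup d ↔ isometryDet d (Unitary.linearIsometryEquiv u) = 1 := by
  rw [rotationGroup, MonoidHom.mem_ker, Units.ext_iff]
  rfl

instance : ContinuousStar (Euc d →L[ℝ] Euc d) :=
  ⟨(ContinuousLinearMap.adjoint (𝕜 := ℝ) (E := Euc d) (F := Euc d)).continuous⟩

instance : IsTopologicalGroup (rotationGroup d) :=
  inferInstanceAs (IsTopologicalGroup (rotationGroup d : Subgroup (unitary (Euc d →L[ℝ] Euc d))))

instance : SecondCountableTopology (rotationGroup d) :=
  TopologicalSpace.Subtype.secondCountableTopology _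

instance : BorelSpace (rotationGroup d) := inferInstance

instance : CompactSpace (unitary (Euc d →L[ℝ] Euc d)) := by
  refine isCompact_iff_compactSpace.mp ?_
  refine Metric.isCompact_of_isClosed_isBounded isClosed_unitary ?_
  refine (Metric.isBounded_closedBall (x := (0 : Euc d →L[ℝ] Euc d)) (r := 1)).subset fun u hu => ?_
  rw [mem_closedBall_zero_iff]
  refine ContinuousLinearMap.opNorm_le_bound _ zero_le_one fun x => ?_
  rw [one_mul]
  exact (Unitary.norm_map ⟨u, hu⟩ x).le

instance : CompactSpace (rotationGroup d) := by
  refine isCompact_iff_compactSpace.mp ?_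
  refine IsClosed.isCompact ?_
  have : (rotationGroup d : Set (unitary (Euc d →L[ℝ] Euc d))) =
      {u : unitary (Euc d →L[ℝ] Euc d) | (u : Euc d →L[ℝ] Euc d).det = 1} := by
    ext u
    exact mem_rotationGroup
  rw [this]
  exact isClosed_eq (ContinuousLinearMap.continuous_det.comp continuous_subtype_val)
    continuous_const

/-- The linear isometry given by a rotation. -/
noncomputable def rotationIsometry (u : rotationGroup d) : Euc d ≃ₗᵢ[ℝ] Euc d :=
  Unitary.linearIsometryEquiv u.1

theorem isometryDet_rotationIsometry (u : rotationGroup d) :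
    isometryDet d (rotationIsometry u) = 1 := mem_rotationGroup.mp u.2

theorem exists_rotationIsometry_eq {R : Euc d ≃ₗᵢ[ℝ] Euc d} (hR : isometryDet d R = 1) :
    ∃ u : rotationGroup d, rotationIsometry u = R :=
  ⟨⟨Unitary.linearIsometryEquiv.symm R, mem_rotationGroup.mpr (by simpa using hR)⟩, by
    simp [rotationIsometry]⟩

theorem continuous_rotation_sphere : Continuous
    (fun p : rotationGroup d × sphere (0 : Euc d) 1 => sphereMap (rotationIsometry p.1) p.2) := by
  refine Continuous.subtype_mk ?_ _
  have h1 : Continuous fun p : rotationGroup d × sphere (0 : Euc d) 1 =>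
      ((p.1 : unitary (Euc d →L[ℝ] Euc d)) : Euc d →L[ℝ] Euc d) :=
    continuous_subtype_val.comp (continuous_subtype_val.comp continuous_fst)
  exact h1.clm_apply (continuous_subtype_val.comp continuous_snd)

/-- The rotations act transitively on the unit sphere. -/
theorem exists_rotation_sphereMap_eq (hd : 2 ≤ d) (y z : sphere (0 : Euc d) 1) :
    ∃ u : rotationGroup d, sphereMap (rotationIsometry u) y = z := by
  obtain ⟨c, θ, h, -, hz⟩ := exists_orthoPair_decomposition hd (a := (y : Euc d)) (b := z)
    (by simp) (by simp)
  obtain ⟨u, hu⟩ := exists_rotationIsometry_eq (h.isometryDet_rot θ)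
  refine ⟨u, Subtype.ext ?_⟩
  rw [hu, hz]
  simp only [sphereMap, h.rot_apply, h.inner_left_self, h.inner_eq']
  module

/-- The Haar probability measure on the group of rotations. -/
noncomputable def rotationHaar (d : ℕ) : Measure (rotationGroup d) :=
  Measure.haarMeasure ⊤

instance : IsProbabilityMeasure (rotationHaar d) := by
  have h := Measure.haarMeasure_self
    (K₀ := (⊤ : TopologicalSpace.PositiveCompacts (rotationGroup d)))
  rw [TopologicalSpace.PositiveCompacts.coe_top] at h
  exact ⟨h⟩

instance : (rotationHaar d).IsMulLeftInvariant :=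
  inferInstanceAs (Measure.haarMeasure ⊤).IsMulLeftInvariant

/-- The action of inverse rotations on a point of the unit sphere. -/
noncomputable def orbitMap (y : sphere (0 : Euc d) 1) (u : rotationGroup d) :
    sphere (0 : Euc d) 1 :=
  sphereMap (rotationIsometry u⁻¹) y

theorem continuous_orbitMap_uncurry : Continuous
    (fun p : sphere (0 : Euc d) 1 × rotationGroup d => orbitMap p.1 p.2) :=
  continuous_rotation_sphere.comp' ((continuous_inv.comp' continuous_snd).prodMk continuous_fst)

theorem continuous_orbitMap (y : sphere (0 : Euc d) 1) : Continuous (orbitMap y) :=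
  continuous_rotation_sphere.comp' (continuous_inv.prodMk continuous_const)

/-- If `y = k z`, then `u⁻¹ y = (k⁻¹ u)⁻¹ z`. Because orbits are taken with inverses, a change of
base point is a left translation, and left invariance of the Haar measure suffices. -/
theorem lintegral_orbitMap_eq (hd : 2 ≤ d) {f : sphere (0 : Euc d) 1 → ENNReal}
    (y z : sphere (0 : Euc d) 1) :
    ∫⁻ u, f (orbitMap y u) ∂(rotationHaar d) = ∫⁻ u, f (orbitMap z u) ∂(rotationHaar d) := by
  obtain ⟨k, hk⟩ := exists_rotation_sphereMap_eq hd z y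
  have : ∀ u, orbitMap y u = orbitMap z (k⁻¹ * u) := by
    intro u
    rw [orbitMap, orbitMap, ← hk, mul_inv_rev, inv_inv]
    rfl
  simp only [this]
  exact lintegral_mul_left_eq_self (fun u => f (orbitMap z u)) k⁻¹

theorem lintegral_comp_sphereMap (R : Euc d ≃ₗᵢ[ℝ] Euc d) (f : sphere (0 : Euc d) 1 → ENNReal) :
    ∫⁻ y, f (sphereMap R y) ∂(surfaceMeasure d) = ∫⁻ y, f y ∂(surfaceMeasure d) :=
  (measurePreserving_sphereMap R).lintegral_comp_emb (sphereHomeo R).measurableEmbedding f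

/-- Average an indicator over both the sphere and the group. Integrating over the sphere first gives
the surface measure, by rotation invariance; integrating over the group first gives a constant in
the base point, by transitivity. -/
theorem surfaceMeasure_eq_smul_map (hd : 2 ≤ d) (y : sphere (0 : Euc d) 1) :
    surfaceMeasure d = surfaceMeasure d univ • (rotationHaar d).map (orbitMap y) := by
  ext s hs
  have hf : Measurable (s.indicator (fun _ => (1 : ENNReal))) := measurable_const.indicator hs
  have e1 : surfaceMeasure d s = ∫⁻ z, ∫⁻ u, s.indicator (fun _ => (1 : ENNReal)) (orbitMap z u)
      ∂(rotationHaar d) ∂(surfaceMeasure d) := by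
    rw [lintegral_lintegral_swap]
    · simp only [orbitMap, lintegral_comp_sphereMap, lintegral_const, measure_univ, mul_one]
      rw [lintegral_indicator hs, setLIntegral_const, one_mul]
    · exact (hf.comp continuous_orbitMap_uncurry.measurable).aemeasurable
  rw [e1]
  simp only [lintegral_orbitMap_eq hd _ y, lintegral_const]
  rw [Measure.smul_apply, smul_eq_mul, mul_comm,
    ← lintegral_map hf (continuous_orbitMap y).measurable,
    lintegral_indicator hs, setLIntegral_const, one_mul]

/-- The average over rotations of an integrable function on the unit sphere is its mean value. -/
theorem integral_orbitMap (hd : 2 ≤ d) {f : sphere (0 : Euc d) 1 → ℝ}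
    (hf : Integrable f (surfaceMeasure d)) (y : sphere (0 : Euc d) 1) :
    Integrable (fun u => f (orbitMap y u)) (rotationHaar d) ∧
      ∫ u, f (orbitMap y u) ∂(rotationHaar d) = ⨍ z, f z ∂(surfaceMeasure d) := by
  have he := surfaceMeasure_eq_smul_map hd y
  have hmap : AEMeasurable (orbitMap y) (rotationHaar d) := (continuous_orbitMap y).aemeasurable
  have := Measure.isProbabilityMeasure_map hmap
  have hne : surfaceMeasure d univ ≠ 0 := by
    rw [surfaceMeasure, Measure.toSphere_apply_univ]
    have : volume (ball (0 : Euc d) 1) ≠ 0 := (measure_ball_pos _ _ one_pos).ne'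
    have hd0 : d ≠ 0 := by omega
    simp [hd0, this]
  have hmap' : (rotationHaar d).map (orbitMap y) =
      (surfaceMeasure d univ)⁻¹ • surfaceMeasure d := by
    conv_rhs =>
      arg 2
      rw [he]
    rw [smul_smul, ENNReal.inv_mul_cancel hne (measure_ne_top _ _), one_smul]
  have hi : Integrable f ((rotationHaar d).map (orbitMap y)) := by
    rw [hmap']
    exact hf.smul_measure (ENNReal.inv_ne_top.mpr hne)
  refine ⟨hi.comp_aemeasurable hmap, ?_⟩
  rw [average, ← hmap', integral_map hmap hi.aestronglyMeasurable]

/-- An integrable function on the unit sphere which is almost invariant under rotations is close to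
its mean value. -/
theorem integral_abs_sub_average_le (hd : 2 ≤ d) {f : sphere (0 : Euc d) 1 → ℝ}
    (hf : Integrable f (surfaceMeasure d)) {K : ℝ} (hK : 0 ≤ K)
    (h : ∀ R : Euc d ≃ₗᵢ[ℝ] Euc d, isometryDet d R = 1 →
      ∫ y, |f (sphereMap R y) - f y| ∂(surfaceMeasure d) ≤ K) :
    ∫ y, |f y - ⨍ z, f z ∂(surfaceMeasure d)| ∂(surfaceMeasure d) ≤ K := by
  -- Fubini requires joint measurability of `f (u⁻¹ y)`, so `f` is replaced by a strongly measurable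
  -- representative; rotations preserve null sets.
  wlog hm : StronglyMeasurable f generalizing f
  · obtain ⟨f', hm', hae⟩ := hf.aestronglyMeasurable
    have hR : ∀ R : Euc d ≃ₗᵢ[ℝ] Euc d,
        (fun y => f (sphereMap R y)) =ᵐ[surfaceMeasure d] fun y => f' (sphereMap R y) := fun R =>
      (measurePreserving_sphereMap R).quasiMeasurePreserving.ae_eq_comp hae
    have key := this (hf.congr hae) (fun R hdet => by
      refine (integral_congr_ae ?_).trans_le (h R hdet)
      filter_upwards [hR R, hae] with y h1 h2
      rw [h1, h2]) hm'
    refine (integral_congr_ae ?_).trans_le key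
    filter_upwards [hae] with y hy
    rw [hy, average_congr hae]
  have hi : Integrable (fun y => f y - ⨍ z, f z ∂(surfaceMeasure d)) (surfaceMeasure d) :=
    hf.sub (integrable_const _)
  -- The mean value is the average of `f (u⁻¹ y)` over the group, so the deviation at `y` is at most
  -- the average of `|f (u⁻¹ y) - f y|`.
  have h1 : ∀ y, ‖f y - ⨍ z, f z ∂(surfaceMeasure d)‖ₑ ≤
      ∫⁻ u, ‖f (orbitMap y u) - f y‖ₑ ∂(rotationHaar d) := by
    intro y
    obtain ⟨h2, h3⟩ := integral_orbitMap hd hf y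
    have : f y - ⨍ z, f z ∂(surfaceMeasure d) =
        - ∫ u, (f (orbitMap y u) - f y) ∂(rotationHaar d) := by
      rw [integral_sub h2 (integrable_const _), h3]
      simp
    rw [this, enorm_neg]
    exact enorm_integral_le_lintegral_enorm _
  have h2 : ∀ u : rotationGroup d,
      ∫⁻ y, ‖f (orbitMap y u) - f y‖ₑ ∂(surfaceMeasure d) ≤ ENNReal.ofReal K := by
    intro u
    have hu : Integrable (fun y => f (orbitMap y u) - f y) (surfaceMeasure d) :=
      ((measurePreserving_sphereMap (rotationIsometry u⁻¹)).integrable_comp_of_integrable hf).sub hf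
    rw [← ofReal_integral_norm_eq_lintegral_enorm hu]
    exact ENNReal.ofReal_le_ofReal (h _ (isometryDet_rotationIsometry u⁻¹))
  have hmeas : AEMeasurable
      (Function.uncurry fun (y : sphere (0 : Euc d) 1) (u : rotationGroup d) =>
      ‖f (orbitMap y u) - f y‖ₑ) ((surfaceMeasure d).prod (rotationHaar d)) := by
    have m1 : Measurable fun p : sphere (0 : Euc d) 1 × rotationGroup d => f (orbitMap p.1 p.2) :=
      hm.measurable.comp continuous_orbitMap_uncurry.measurable
    exact (m1.sub (hm.measurable.comp measurable_fst)).enorm.aemeasurable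
  have h3 : ∫⁻ y, ‖f y - ⨍ z, f z ∂(surfaceMeasure d)‖ₑ ∂(surfaceMeasure d) ≤ ENNReal.ofReal K := by
    refine (lintegral_mono h1).trans ?_
    rw [lintegral_lintegral_swap hmeas]
    refine (lintegral_mono h2).trans ?_
    rw [lintegral_const, measure_univ, mul_one]
  rw [← ofReal_integral_norm_eq_lintegral_enorm hi] at h3
  exact (ENNReal.ofReal_le_ofReal_iff hK).mp h3

end HaarAverage

/-! ### The exponent and the conclusion -/

theorem sqrt_inv_pow_mul_sq {d : ℕ} {ρ : ℝ} (hρ : 0 < ρ) :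
    Real.sqrt ((ρ ^ d)⁻¹ * ρ ^ 2) = ρ ^ (-((d : ℝ) / 2 - 1)) := by
  rw [Real.sqrt_eq_iff_mul_self_eq (by positivity) (by positivity), ← Real.rpow_add hρ,
    ← Real.rpow_natCast, ← Real.rpow_natCast, ← Real.rpow_neg hρ.le, ← Real.rpow_add hρ]
  congr 1
  push_cast
  ring

theorem mainTheorem5 (d : ℕ) (hd : 2 < d) :
    ∃ α : ℝ, 0 < α ∧ ∃ C : ℝ, 0 < C ∧
      ∀ (ρ T : ℝ), 4 ≤ ρ → 1 ≤ T →
      ∀ (g₂ vbar : ℝ) (v : Euc d → ℝ) (G : Euc d → Euc d),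
        IsH1WithGradient (ball 0 ρ) v G →
        IsWeakSolution (annulus d ρ) T g₂ v G →
        HasSphereTrace ρ v G (fun _ => vbar) →
        (∃ h : sphere (0 : Euc d) 1 → ℝ, HasNormalTrace ρ G h) ∧
        ∀ (g₁ : ℝ) (h : sphere (0 : Euc d) 1 → ℝ),
          HasNormalTrace ρ G h →
          (⨍ y, h y ∂(surfaceMeasure d)) = g₁ →
          (∫ y, |h y - g₁| ∂(surfaceMeasure d)) ≤
            C * ρ ^ (-α) *
              Real.sqrt ((∫ x in ball (0 : Euc d) ρ, ‖G x‖ ^ 2) +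
                ρ ^ d * (1 + ρ ^ 2 / T) *
                  (g₁ ^ 2 + ρ ^ 2 * (g₂ ^ 2 + vbar ^ 2 / T ^ 2))) := by
  obtain ⟨C₀, hC₀, h₀⟩ := exists_normal_trace_rotation_bound hd
  have hα : (0 : ℝ) < (d : ℝ) / 2 - 1 := by
    have : (2 : ℝ) < d := by exact_mod_cast hd
    linarith
  -- The exponent balances `ρ ^ (-d / 2)`, from the decay near the sphere, against `ρ`, from the
  -- Poincaré-type bound on `v ∘ R - v` in the whole annulus; it is positive exactly when `d > 2`.
  refine ⟨(d : ℝ) / 2 - 1, hα, C₀ * Real.sqrt (4 ^ d * (4 * Real.pi) ^ 2), by positivity, ?_⟩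
  intro ρ T hρ hT g₂ vbar v G hH1 hweak htrace
  have hρ0 : 0 < ρ := by linarith
  have hT0 : 0 < T := by linarith
  have hsub : volume.restrict (annulus d ρ) ≤ volume.restrict (ball 0 ρ) :=
    Measure.restrict_mono (annulus_subset_ball d ρ) le_rfl
  have hsol : AnnulusSol ρ T vbar g₂ v G :=
    ⟨hH1.memLp.mono_measure hsub, hH1.gradient_memLp.mono_measure hsub, htrace.2, hweak⟩
  refine ⟨hsol.exists_hasNormalTrace hρ hT0, ?_⟩
  intro g₁ h hh hg₁
  let E := ∫ x in annulus d ρ, ‖G x‖ ^ 2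
  have hE : 0 ≤ E := integral_nonneg fun x => by positivity
  have hK : ∀ R : Euc d ≃ₗᵢ[ℝ] Euc d, isometryDet d R = 1 →
      ∫ y, |h (sphereMap R y) - h y| ∂(surfaceMeasure d) ≤
        C₀ * Real.sqrt ((ρ ^ d)⁻¹ * (4 ^ d * ((4 * Real.pi) ^ 2 * ρ ^ 2 * E))) := by
    intro R hR
    refine (h₀ hρ hT hsol hh R).trans ?_
    have := hsol.integral_sq_isometry_sub_le hd.le hR
    gcongr
  have key := integral_abs_sub_average_le hd.le hh.1 (by positivity) hK
  rw [hg₁] at key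
  refine key.trans ?_
  have e : (ρ ^ d)⁻¹ * (4 ^ d * ((4 * Real.pi) ^ 2 * ρ ^ 2 * E)) =
      (4 ^ d * (4 * Real.pi) ^ 2) * ((ρ ^ d)⁻¹ * ρ ^ 2) * E := by ring
  rw [e, Real.sqrt_mul (by positivity), Real.sqrt_mul (by positivity), sqrt_inv_pow_mul_sq hρ0,
    ← mul_assoc, ← mul_assoc]
  refine mul_le_mul_of_nonneg_left (Real.sqrt_le_sqrt ?_) (by positivity)
  have hEb : E ≤ ∫ x in ball (0 : Euc d) ρ, ‖G x‖ ^ 2 :=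
    setIntegral_mono_set (MemLp.integrable_sq_norm hH1.gradient_memLp)
      (Filter.Eventually.of_forall fun x => by positivity) (annulus_subset_ball d ρ).eventuallyLE
  -- The Dirichlet energy alone controls the deviation; the remaining terms under the root are
  -- nonnegative.
  exact hEb.trans (le_add_of_nonneg_right (by positivity))
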